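/- Let $S$ be a smooth variety of dimension $n$ over $\mathbb C$ (an integral separated scheme of finite type over $\mathbb C$, smooth of relative dimension $n$), let $p\in S$ be a closed point, let $\sigma\colon S'\to S$ be the blow-up of $S$ at $p$, and let $i\colon E=\sigma^{-1}(p)\hookrightarrow S'$ be the exceptional divisor. For a scheme $X$ over $\mathbb C$ write $\mathcal T_X=\mathcal Hom_{\mathcal O_X}(\Omega_{X/\mathbb C},\mathcal O_X)$, and put $\mathcal O_E(E)=i^*\mathcal O_{S'}(E)$, where $\mathcal O_{S'}(E)=\mathcal Hom_{\mathcal O_{S'}}(\mathcal I_E,\mathcal O_{S'})$ and $\mathcal I_E\subset\mathcal O_{S'}$ is the ideal sheaf of $E$. Then there is a short exact sequence of $\mathcal O_{S'}$-modules $$0\longrightarrow \mathcal T_{S'}\xrightarrow{\ d\sigma\ }\sigma^*\mathcal T_S\longrightarrow i_*\bigl(\mathcal T_E\otimes_{\mathcal O_E}\mathcal O_E(E)\bigr)\longrightarrow 0,$$ in which $d\sigma$ is the differential of $\sigma$. If moreover $n=2$, then $E\cong\mathbb P^1_{\mathbb C}$ over $\mathbb C$, and there is a short exact sequence $$0\longrightarrow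 \mathcal T_{S'}\xrightarrow{\ d\sigma\ }\sigma^*\mathcal T_S\longrightarrow i_*\mathcal O_E(1)\longrightarrow 0,$$ where $\mathcal O_E(1)$ corresponds to $\mathcal O_{\mathbb P^1}(1)$ under an isomorphism $E\cong\mathbb P^1_{\mathbb C}$. -/

import Mathlib

open CategoryTheory AlgebraicGeometry TopologicalSpace Opposite

universe u

namespace BlowupTangent

noncomputable section

section InternalHom

variable {X : Scheme.{u}}

/-- The sections over `V` of a presheaf of `𝒪_X`-modules form a `Γ(X, V)`-module. -/
instance instModuleSections (M : X.PresheafOfModules) (V : X.Opens) :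
    Module Γ(X, V) (M.presheaf.obj (op V)) :=
  (M.obj (op V)).isModule

/-- The morphisms `M|_U ⟶ N|_U` of (pre)sheaves of `𝒪_U`-modules: families of `Γ(X, V)`-linear maps
`M(V) → N(V)`, for `V ⊆ U` open, which commute with the restriction maps. -/
def homOn (M : X.PresheafOfModules) (N : X.Modules) (U : X.Opens) :
    AddSubgroup (∀ V : {V : X.Opens // V ≤ U},
      M.presheaf.obj (op V.1) →ₗ[Γ(X, V.1)] Γ(N, V.1)) where
  carrier := {φ | ∀ (V W : {V : X.Opens // V ≤ U}) (i : W.1 ⟶ V.1) (m : M.presheaf.obj (op V.1)),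
    N.presheaf.map i.op (φ V m) = φ W (M.presheaf.map i.op m)}
  zero_mem' V W i m := map_zero _
  add_mem' {a b} ha hb V W i m := by
    change N.presheaf.map i.op (a V m + b V m) = a W _ + b W _
    rw [map_add, ha V W i m, hb V W i m]
  neg_mem' {a} ha V W i m := by
    change N.presheaf.map i.op (- a V m) = - a W _
    rw [map_neg, ha V W i m]

/-- A function on `U` multiplies a morphism `M|_U ⟶ N|_U` on the target. -/
instance (M : X.PresheafOfModules) (N : X.Modules) (U : X.Opens) :
    SMul Γ(X, U) (homOn M N U) where
  smul r φ := ⟨fun V => X.presheaf.map (homOfLE V.2).op r • φ.1 V, fun V W i m => by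
    have e : X.presheaf.map i.op (X.presheaf.map (homOfLE V.2).op r)
        = X.presheaf.map (homOfLE W.2).op r := by
      rw [← CommRingCat.comp_apply, ← Functor.map_comp]; rfl
    change N.presheaf.map i.op (X.presheaf.map (homOfLE V.2).op r • φ.1 V m) =
      X.presheaf.map (homOfLE W.2).op r • φ.1 W (M.presheaf.map i.op m)
    rw [Scheme.Modules.map_smul, φ.2 V W i m, e]⟩

theorem homOn_smul_apply {M : X.PresheafOfModules} {N : X.Modules} {U : X.Opens}
    (r : Γ(X, U)) (φ : homOn M N U) (V : {V : X.Opens // V ≤ U}) :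
    (r • φ).1 V = X.presheaf.map (homOfLE V.2).op r • φ.1 V := rfl

instance (M : X.PresheafOfModules) (N : X.Modules) (U : X.Opens) :
    Module Γ(X, U) (homOn M N U) where
  one_smul φ := by
    apply Subtype.ext; funext V
    rw [homOn_smul_apply, map_one, one_smul]
  mul_smul r s φ := by
    apply Subtype.ext; funext V
    simp only [homOn_smul_apply, map_mul, mul_smul]
  smul_zero r := by
    apply Subtype.ext; funext V
    rw [homOn_smul_apply]; exact smul_zero _
  smul_add r φ ψ := by
    apply Subtype.ext; funext V
    rw [homOn_smul_apply]; exact smul_add _ _ _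
  add_smul r s φ := by
    apply Subtype.ext; funext V
    rw [homOn_smul_apply, map_add, add_smul]; rfl
  zero_smul φ := by
    apply Subtype.ext; funext V
    rw [homOn_smul_apply, map_zero, zero_smul]; rfl

/-- The value of a morphism `M|_U ⟶ N|_U` on a section of `M` over `U`. -/
def evalHom {M : X.PresheafOfModules} {N : X.Modules} {U : X.Opens} (φ : homOn M N U)
    (m : M.presheaf.obj (op U)) : Γ(N, U) :=
  φ.1 ⟨U, le_rfl⟩ m

/-- Restriction of a morphism `M|_U ⟶ N|_U` to a smaller open `U' ⊆ U`. -/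
def homOnRestrict (M : X.PresheafOfModules) (N : X.Modules) {U U' : X.Opens} (h : U' ≤ U) :
    homOn M N U →+ homOn M N U' where
  toFun φ := ⟨fun V => φ.1 ⟨V.1, V.2.trans h⟩,
    fun V W i m => φ.2 ⟨V.1, V.2.trans h⟩ ⟨W.1, W.2.trans h⟩ i m⟩
  map_zero' := rfl
  map_add' _ _ := rfl

/-- The abelian presheaf `U ↦ Hom(M|_U, N|_U)`. -/
def homPresheaf (M : X.PresheafOfModules) (N : X.Modules) : TopCat.Presheaf Ab.{u} X where
  obj U := AddCommGrpCat.of (homOn M N U.unop)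
  map i := AddCommGrpCat.ofHom (homOnRestrict M N i.unop.le)

instance (M : X.PresheafOfModules) (N : X.Modules) (U : X.Opensᵒᵖ) :
    Module (X.ringCatSheaf.obj.obj U) ((homPresheaf M N).obj U) :=
  inferInstanceAs (Module Γ(X, U.unop) (homOn M N U.unop))

theorem homPresheaf_map_smul (M : X.PresheafOfModules) (N : X.Modules) ⦃U V : X.Opensᵒᵖ⦄
    (i : U ⟶ V) (r : X.ringCatSheaf.obj.obj U) (φ : (homPresheaf M N).obj U) :
    (homPresheaf M N).map i (r • φ) =
      X.ringCatSheaf.obj.map i r • (homPresheaf M N).map i φ := by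
  apply Subtype.ext; funext W
  have e : X.presheaf.map (homOfLE (W.2.trans i.unop.le)).op r =
      X.presheaf.map (homOfLE W.2).op (X.presheaf.map i r) := by
    change X.presheaf.map _ (show Γ(X, U.unop) from r) =
      X.presheaf.map _ (X.presheaf.map i (show Γ(X, U.unop) from r))
    rw [← CommRingCat.comp_apply, ← Functor.map_comp]; rfl
  exact congrArg (fun t : Γ(X, W.1) => t • φ.1 ⟨W.1, W.2.trans i.unop.le⟩) e

theorem presheaf_map_map (P : TopCat.Presheaf Ab.{u} X) {U V W : X.Opens} (i : V ⟶ U) (j : W ⟶ V)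
    (k : W ⟶ U) (s : P.obj (op U)) : P.map j.op (P.map i.op s) = P.map k.op s := by
  rw [Subsingleton.elim k (j ≫ i), op_comp, P.map_comp]; rfl

theorem homPresheaf_isSheaf (M : X.PresheafOfModules) (N : X.Modules) :
    (homPresheaf M N).IsSheaf := by
  rw [TopCat.Presheaf.isSheaf_iff_isSheafUniqueGluing]
  intro ι U sf hsf
  have hcov : ∀ V : {V : X.Opens // V ≤ iSup U}, V.1 ≤ ⨆ i, V.1 ⊓ U i := fun V x hx => by
    obtain ⟨i, hi⟩ := Opens.mem_iSup.mp (V.2 hx)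
    exact Opens.mem_iSup.mpr ⟨i, hx, hi⟩
  have sep : ∀ (V : {V : X.Opens // V ≤ iSup U}) (s t : Γ(N, V.1)),
      (∀ i, N.presheaf.map (homOfLE (inf_le_left : V.1 ⊓ U i ≤ V.1)).op s =
        N.presheaf.map (homOfLE (inf_le_left : V.1 ⊓ U i ≤ V.1)).op t) → s = t :=
    fun V s t h => TopCat.Sheaf.eq_of_locally_eq' ⟨N.presheaf, N.isSheaf⟩ _ V.1
      (fun i => homOfLE inf_le_left) (hcov V) s t h
  have compat : ∀ (i j : ι) (W : X.Opens) (hi : W ≤ U i) (hj : W ≤ U j)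
      (m : M.presheaf.obj (op W)), (sf i).1 ⟨W, hi⟩ m = (sf j).1 ⟨W, hj⟩ m := fun i j W hi hj m =>
    congrArg (fun φ : homOn M N (U i ⊓ U j) => φ.1 ⟨W, le_inf hi hj⟩ m) (hsf i j)
  have key : ∀ (V : {V : X.Opens // V ≤ iSup U}) (m : M.presheaf.obj (op V.1)),
      ∃ s : Γ(N, V.1), ∀ i, N.presheaf.map (homOfLE (inf_le_left : V.1 ⊓ U i ≤ V.1)).op s =
        (sf i).1 ⟨V.1 ⊓ U i, inf_le_right⟩ (M.presheaf.map (homOfLE inf_le_left).op m) := by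
    intro V m
    refine (TopCat.Sheaf.existsUnique_gluing' ⟨N.presheaf, N.isSheaf⟩ (fun i => V.1 ⊓ U i) V.1
      (fun i => homOfLE inf_le_left) (hcov V)
      (fun i => (sf i).1 ⟨V.1 ⊓ U i, inf_le_right⟩ (M.presheaf.map (homOfLE inf_le_left).op m))
      ?_).exists
    intro i j
    have hWi : (V.1 ⊓ U i) ⊓ (V.1 ⊓ U j) ≤ U i := inf_le_left.trans inf_le_right
    have hWj : (V.1 ⊓ U i) ⊓ (V.1 ⊓ U j) ≤ U j := inf_le_right.trans inf_le_right
    have h1 := (sf i).2 ⟨V.1 ⊓ U i, inf_le_right⟩ ⟨(V.1 ⊓ U i) ⊓ (V.1 ⊓ U j), hWi⟩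
      (Opens.infLELeft _ _) (M.presheaf.map (homOfLE inf_le_left).op m)
    have h2 := (sf j).2 ⟨V.1 ⊓ U j, inf_le_right⟩ ⟨(V.1 ⊓ U i) ⊓ (V.1 ⊓ U j), hWj⟩
      (Opens.infLERight _ _) (M.presheaf.map (homOfLE inf_le_left).op m)
    refine h1.trans (Eq.trans ?_ h2.symm)
    rw [presheaf_map_map M.presheaf _ _ (homOfLE (inf_le_left.trans inf_le_left)),
      presheaf_map_map M.presheaf _ _ (homOfLE (inf_le_left.trans inf_le_left))]
    exact compat i j _ _ _ _
  choose g hg using key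
  refine ⟨⟨fun V => { toFun := g V, map_add' := fun m m' => ?_, map_smul' := fun r m => ?_ },
    fun V W i m => ?_⟩, fun i => ?_, fun ψ hψ => ?_⟩
  · refine sep V _ _ fun i => ?_
    rw [map_add, hg, hg, hg, map_add, map_add]
  · refine sep V _ _ fun i => ?_
    rw [hg]
    have e : M.presheaf.map (homOfLE (inf_le_left : V.1 ⊓ U i ≤ V.1)).op (r • m) =
      X.presheaf.map (homOfLE (inf_le_left : V.1 ⊓ U i ≤ V.1)).op r •
        M.presheaf.map (homOfLE (inf_le_left : V.1 ⊓ U i ≤ V.1)).op m :=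
      PresheafOfModules.map_smul M _ r m
    rw [e, LinearMap.map_smul, ← hg, RingHom.id_apply, Scheme.Modules.map_smul]
  · refine sep W _ _ fun j => ?_
    change N.presheaf.map _ (N.presheaf.map i.op (g V m)) = N.presheaf.map _ (g W _)
    have h1 := (sf j).2 ⟨V.1 ⊓ U j, inf_le_right⟩ ⟨W.1 ⊓ U j, inf_le_right⟩
      (homOfLE (inf_le_inf_right _ i.le)) (M.presheaf.map (homOfLE inf_le_left).op m)
    rw [hg, presheaf_map_map N.presheaf _ _ (homOfLE (inf_le_left.trans i.le)),
      presheaf_map_map M.presheaf _ _ (homOfLE (inf_le_left.trans i.le)),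
      ← presheaf_map_map N.presheaf (homOfLE (inf_le_left : V.1 ⊓ U j ≤ V.1))
        (homOfLE (inf_le_inf_right _ i.le)), hg, h1,
      presheaf_map_map M.presheaf _ _ (homOfLE (inf_le_left.trans i.le))]
  · apply Subtype.ext; funext V; apply LinearMap.ext; intro m
    change g ⟨V.1, _⟩ m = (sf i).1 V m
    refine sep ⟨V.1, V.2.trans (le_iSup U i)⟩ _ _ fun j => ?_
    have h1 := (sf i).2 V ⟨V.1 ⊓ U j, inf_le_left.trans V.2⟩ (homOfLE inf_le_left) m
    rw [hg, h1]
    exact compat _ _ _ _ _ _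
  · apply Subtype.ext; funext V; apply LinearMap.ext; intro m
    refine sep V _ _ fun i => ?_
    have h1 := ψ.2 V ⟨V.1 ⊓ U i, inf_le_left.trans V.2⟩ (homOfLE inf_le_left) m
    have h2 : homOnRestrict M N (le_iSup U i) ψ = sf i := hψ i
    have h3 := congrArg (fun φ : homOn M N (U i) => φ.1 ⟨V.1 ⊓ U i, inf_le_right⟩
      (M.presheaf.map (homOfLE inf_le_left).op m)) h2
    exact h1.trans (h3.trans (hg V m i).symm)

/-- The sheaf of modules `ℋom(M, N)`, with sections `Hom(M|_U, N|_U)` over `U`.  The source `M` may be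
any presheaf of modules; as `N` is a sheaf, the result only depends on the sheafification of `M`. -/
def sheafHom (M : X.PresheafOfModules) (N : X.Modules) : X.Modules where
  val := PresheafOfModules.ofPresheaf (homPresheaf M N) (homPresheaf_map_smul M N)
  isSheaf := homPresheaf_isSheaf M N

end InternalHom
section Geometry
variable {X Y Z : Scheme.{u}}

/-- The structure morphism `s : X ⟶ Spec k` makes `𝒪_X` a presheaf of `k`-algebras. -/
def constToStructure {k : CommRingCat.{u}} (s : X ⟶ Spec k) :
    (Functor.const X.Opensᵒᵖ).obj k ⟶ X.presheaf where
  app U := (Scheme.ΓSpecIso k).inv ≫ s.appLE ⊤ U.unop le_top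
  naturality U V i := by
    dsimp
    rw [Category.id_comp, Category.assoc]
    congr 1
    exact (Scheme.Hom.appLE_map s _ i).symm

/-- The presheaf `U ↦ Ω_{Γ(X, U) / k}` of Kähler differentials; its sheafification is the cotangent
sheaf `Ω_{X/k}`. -/
def differentials {k : CommRingCat.{u}} (s : X ⟶ Spec k) : X.PresheafOfModules :=
  PresheafOfModules.DifferentialsConstruction.relativeDifferentials' (constToStructure s)

/-- `𝒪_X` as a module over itself. -/
def structureModule (X : Scheme.{u}) : X.Modules := SheafOfModules.unit X.ringCatSheaf

/-- The tangent sheaf `𝒯_X = ℋom(Ω_{X/k}, 𝒪_X)` of a scheme `X` over `k`. -/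
def tangentSheaf {k : CommRingCat.{u}} (s : X ⟶ Spec k) : X.Modules :=
  sheafHom (differentials s) (structureModule X)

/-- The derivative `D(g) = D(dg)` of a function `g` on `U` along a vector field `D ∈ Γ(𝒯_X, U)`. -/
def derive {k : CommRingCat.{u}} {s : X ⟶ Spec k} {U : X.Opens} (D : Γ(tangentSheaf s, U))
    (g : Γ(X, U)) : Γ(X, U) :=
  evalHom (M := differentials s) (N := structureModule X) D
    (CommRingCat.KaehlerDifferential.d (f := (constToStructure s).app (op U)) g)

/-- The section `(f^*θ)|_V` of `f^*M` defined by a section `θ` of `M` over `U`, for `V ⊆ f⁻¹(U)`. -/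
def pullbackSection (f : X ⟶ Y) (M : Y.Modules) {U : Y.Opens} {V : X.Opens} (h : V ≤ f ⁻¹ᵁ U)
    (θ : Γ(M, U)) : Γ((Scheme.Modules.pullback f).obj M, V) :=
  ((Scheme.Modules.pullback f).obj M).presheaf.map (homOfLE h).op
    (((Scheme.Modules.pullbackPushforwardAdjunction f).unit.app M).app U θ)

/-- A morphism `α : 𝒯_X ⟶ f^*𝒯_Y` is the differential of the `k`-morphism `f : X ⟶ Y` if its composite
with the canonical map `f^*𝒯_Y = f^*ℋom(Ω_Y, 𝒪_Y) ⟶ ℋom(f^*Ω_Y, 𝒪_X) = 𝒟er_k(f⁻¹𝒪_Y, 𝒪_X)` is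
`D ↦ D ∘ f^♯`.  The canonical map sends `∑ bᵢ f^*θᵢ` to `g ↦ ∑ bᵢ f^♯(θᵢ(g))`, and every section of
`f^*𝒯_Y` is locally of the form `∑ bᵢ f^*θᵢ`, so this is a condition on such expressions for the
sections `α(D)`.  For `Y` smooth over `k` the canonical map is an isomorphism, so `α` is unique. -/
def IsDifferential {k : CommRingCat.{u}} {s : X ⟶ Spec k} {t : Y ⟶ Spec k} (f : X ⟶ Y)
    (α : tangentSheaf s ⟶ (Scheme.Modules.pullback f).obj (tangentSheaf t)) : Prop :=
  ∀ (U : Y.Opens) (V : X.Opens) (h : V ≤ f ⁻¹ᵁ U) (D : Γ(tangentSheaf s, V)) (m : ℕ)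
    (b : Fin m → Γ(X, V)) (θ : Fin m → Γ(tangentSheaf t, U)),
    α.app V D = ∑ i, b i • pullbackSection f (tangentSheaf t) h (θ i) →
    ∀ g : Γ(Y, U), derive D (f.appLE U V h g) = ∑ i, b i * f.appLE U V h (derive (θ i) g)

/-- The tensor product `M ⊗ N` of sheaves of modules: the sheafification of
`U ↦ M(U) ⊗_{Γ(X, U)} N(U)`. -/
def tensor (M N : X.Modules) : X.Modules :=
  (PresheafOfModules.sheafification (𝟙 X.ringCatSheaf.obj)).obj
    (PresheafOfModules.Monoidal.tensorObj (R := X.presheaf) M.val N.val)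

/-- The ideal sheaf `ℐ_Z = ker (𝒪_X → i_*𝒪_Z)` of `i : Z ⟶ X`. -/
def idealPresheaf (i : Z ⟶ X) : X.PresheafOfModules :=
  PresheafOfModules.Submodule.toPresheafOfModules (M := PresheafOfModules.unit X.ringCatSheaf.obj)
    { obj := fun U => RingHom.ker (i.app U.unop).hom
      map := fun {U V} j x hx => by
        have h : i.app U.unop x = 0 := hx
        change i.app V.unop (X.presheaf.map j x) = 0
        have e := ConcreteCategory.congr_hom (i.naturality j) x
        refine e.trans ?_
        change Z.presheaf.map _ (i.app U.unop x) = 0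
        rw [h, map_zero] }

/-- The sheaf `𝒪_X(Z) = ℋom(ℐ_Z, 𝒪_X)`, for an effective Cartier divisor `i : Z ⟶ X`. -/
def divisorSheaf (i : Z ⟶ X) : X.Modules := sheafHom (idealPresheaf i) (structureModule X)
end Geometry

section Rees

open Polynomial

variable {R : Type u} [CommRing R] (I : Ideal R)

/-- The degree `i` piece `Iⁱ tⁱ` of the Rees algebra `⨁ Iⁱ tⁱ ⊆ R[t]`. -/
def reesPiece (i : ℕ) : Submodule R (reesAlgebra I) where
  carrier := {f | ∀ j, j ≠ i → f.1.coeff j = 0}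
  zero_mem' _ _ := rfl
  add_mem' {f g} hf hg j hj := by
    change (f.1 + g.1).coeff j = 0
    rw [coeff_add, hf j hj, hg j hj, add_zero]
  smul_mem' r f hf j hj := by
    change (r • f.1).coeff j = 0
    rw [coeff_smul, hf j hj, smul_zero]

/-- The degree `i` component of an element of the Rees algebra. -/
def reesComponent (f : reesAlgebra I) (i : ℕ) : reesPiece I i :=
  ⟨⟨monomial i (f.1.coeff i), reesAlgebra.monomial_mem.mpr (f.2 i)⟩, fun _ hj =>
    coeff_monomial_of_ne _ hj⟩

/-- The decomposition of an element of the Rees algebra into its homogeneous components. -/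
def reesDecompose (f : reesAlgebra I) : DirectSum ℕ fun i => reesPiece I i :=
  DirectSum.mk (fun i => reesPiece I i) f.1.support fun i => reesComponent I f i

theorem reesDecompose_coeff (f : reesAlgebra I) (j : ℕ) :
    (reesDecompose I f j).1.1.coeff j = f.1.coeff j := by
  by_cases h : j ∈ f.1.support
  · rw [reesDecompose, DirectSum.mk_apply_of_mem h]
    exact coeff_monomial_same _ _
  · rw [reesDecompose, DirectSum.mk_apply_of_notMem h]
    exact (notMem_support_iff.mp h).symm

theorem reesCoe_coeff (x : DirectSum ℕ fun i => reesPiece I i) (j : ℕ) :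
    (DirectSum.coeAddMonoidHom (reesPiece I) x).1.coeff j = (x j).1.1.coeff j := by
  induction x using DirectSum.induction_on with
  | zero => rw [map_zero]; rfl
  | of i y =>
    rw [DirectSum.coeAddMonoidHom_of]
    by_cases h : i = j
    · subst h
      rw [DirectSum.of_eq_same]
    · rw [DirectSum.of_eq_of_ne _ _ _ (Ne.symm h), y.2 j (Ne.symm h)]; rfl
  | add x y hx hy =>
    rw [map_add]
    change (_ + _ : R[X]).coeff j = ((x j).1.1 + (y j).1.1 : R[X]).coeff j
    rw [coeff_add, coeff_add, hx, hy]

/-- The Rees algebra is graded by `⨁ Iⁱ tⁱ`. -/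
instance reesGradedAlgebra : GradedAlgebra (reesPiece I) where
  one_mem j hj := by
    change (1 : R[X]).coeff j = 0
    rw [coeff_one, if_neg hj]
  mul_mem {i j} f g hf hg k hk := by
    change (f.1 * g.1).coeff k = 0
    rw [coeff_mul]
    refine Finset.sum_eq_zero fun p hp => ?_
    have hp' := Finset.HasAntidiagonal.mem_antidiagonal.mp hp
    by_cases h : p.1 = i
    · rw [hg p.2 (by omega), mul_zero]
    · rw [hf p.1 h, zero_mul]
  decompose' f := reesDecompose I f
  left_inv f := by
    apply Subtype.ext
    ext j
    rw [reesCoe_coeff, reesDecompose_coeff]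
  right_inv x := by
    refine DFinsupp.ext fun i => Subtype.ext (Subtype.ext ?_)
    ext j
    by_cases h : j = i
    · subst h
      rw [reesDecompose_coeff, reesCoe_coeff]
    · rw [(reesDecompose I _ i).2 j h, (x i).2 j h]

end Rees

section Twist
variable {A σ : Type u} [CommRing A] [SetLike σ A] [AddSubgroupClass σ A]
  (𝒜 : ℕ → σ) [GradedRing 𝒜] (d : ℕ)

instance instIsPrimeTop (x : ProjectiveSpectrum.top 𝒜) : x.asHomogeneousIdeal.toIdeal.IsPrime :=
  ProjectiveSpectrum.isPrime x

/-- The localization `A_𝔭` of `A` at a point `𝔭` of `Proj A`. -/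
abbrev stalkRing (x : ProjectiveSpectrum.top 𝒜) : Type u :=
  Localization.AtPrime x.asHomogeneousIdeal.toIdeal

/-- A function `f` on `U` with `f(𝔭) ∈ A_𝔭` is a fraction of degree `d` if there are homogeneous `r`, `s`
with `deg r = deg s + d` such that `s ∉ 𝔭` and `f(𝔭) = r / s` for all `𝔭 ∈ U`. -/
def twistPrelocal : TopCat.PrelocalPredicate (stalkRing 𝒜) where
  pred {U} f := ∃ (i : ℕ) (r : 𝒜 (i + d)) (s : 𝒜 i)
    (hs : ∀ x : U, s.1 ∉ x.1.asHomogeneousIdeal.toIdeal),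
    ∀ x : U, f x = Localization.mk r.1 ⟨s.1, hs x⟩
  res := by rintro V U i f ⟨j, r, s, h, w⟩; exact ⟨j, r, s, (h <| i ·), (w <| i ·)⟩

/-- Being locally a fraction of degree `d`. -/
def twistLocal : TopCat.LocalPredicate (stalkRing 𝒜) := (twistPrelocal 𝒜 d).sheafify

/-- The sections of `𝒪(d)` over `U`: the functions on `U` that are locally fractions of degree `d`. -/
def twistSections (U : Opens (ProjectiveSpectrum.top 𝒜)) : AddSubgroup (∀ x : U, stalkRing 𝒜 x.1) where
  carrier := {f | (twistLocal 𝒜 d).pred f}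
  zero_mem' := fun x => ⟨U, x.2, 𝟙 _, 0, ⟨0, zero_mem _⟩, ⟨1, SetLike.one_mem_graded _⟩,
    fun y h => y.1.isPrime.ne_top ((Ideal.eq_top_iff_one _).mpr h), fun y => (Localization.mk_zero _).symm⟩
  add_mem' {a b} ha hb x := by
    rcases ha x with ⟨Va, ma, ia, ja, ⟨ra, ra_mem⟩, ⟨sa, sa_mem⟩, hwa, wa⟩
    rcases hb x with ⟨Vb, mb, ib, jb, ⟨rb, rb_mem⟩, ⟨sb, sb_mem⟩, hwb, wb⟩
    refine ⟨Va ⊓ Vb, ⟨ma, mb⟩, Opens.infLELeft _ _ ≫ ia, ja + jb,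
      ⟨sa * rb + sb * ra, add_mem ?_ ?_⟩,
      ⟨sa * sb, SetLike.mul_mem_graded sa_mem sb_mem⟩, fun y =>
      y.1.asHomogeneousIdeal.toIdeal.primeCompl.mul_mem (hwa ⟨y.1, y.2.1⟩) (hwb ⟨y.1, y.2.2⟩), ?_⟩
    · rw [add_assoc]; exact SetLike.mul_mem_graded sa_mem rb_mem
    · rw [add_comm ja, add_assoc]; exact SetLike.mul_mem_graded sb_mem ra_mem
    · rintro ⟨y, hy⟩
      have h1 := wa ⟨y, hy.1⟩
      have h2 := wb ⟨y, hy.2⟩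
      exact (congrArg₂ (· + ·) h1 h2).trans (Localization.add_mk _ _ _ _)
  neg_mem' {a} ha x := by
    rcases ha x with ⟨V, m, i, j, ⟨r, r_mem⟩, ⟨s, s_mem⟩, nin, hy⟩
    refine ⟨V, m, i, j, ⟨-r, neg_mem r_mem⟩, ⟨s, s_mem⟩, nin, fun y => ?_⟩
    exact (congrArg Neg.neg (hy y)).trans (Localization.neg_mk _ _)

/-- A section of `𝒪` over `U` is a function on `U` with values in the degree zero parts of the `A_𝔭`, and
acts on the sections of `𝒪(d)` by multiplication. -/
instance instSMulTwist (U : (Proj 𝒜).Opens) : SMul Γ(Proj 𝒜, U) (twistSections 𝒜 d U) where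
  smul r f := ⟨fun x => HomogeneousLocalization.val (r.1 x) * f.1 x, fun x => by
    rcases r.2 x with ⟨Va, ma, ia, ja, ⟨ra, ra_mem⟩, ⟨sa, sa_mem⟩, hwa, wa⟩
    rcases f.2 x with ⟨Vb, mb, ib, jb, ⟨rb, rb_mem⟩, ⟨sb, sb_mem⟩, hwb, wb⟩
    refine ⟨Va ⊓ Vb, ⟨ma, mb⟩, Opens.infLELeft _ _ ≫ ia, ja + jb, ⟨ra * rb, ?_⟩,
      ⟨sa * sb, SetLike.mul_mem_graded sa_mem sb_mem⟩, fun y =>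
      y.1.asHomogeneousIdeal.toIdeal.primeCompl.mul_mem (hwa ⟨y.1, y.2.1⟩) (hwb ⟨y.1, y.2.2⟩), ?_⟩
    · rw [add_assoc]; exact SetLike.mul_mem_graded ra_mem rb_mem
    · rintro ⟨y, hy⟩
      have h1 := congrArg HomogeneousLocalization.val (wa ⟨y, hy.1⟩)
      have h2 := wb ⟨y, hy.2⟩
      rw [HomogeneousLocalization.val_mk] at h1
      exact (congrArg₂ (· * ·) h1 h2).trans (Localization.mk_mul _ _ _ _)⟩

theorem twist_smul_apply (U : (Proj 𝒜).Opens) (r : Γ(Proj 𝒜, U)) (f : twistSections 𝒜 d U)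
    (x : U) : (r • f).1 x = HomogeneousLocalization.val (r.1 x) * f.1 x := rfl

instance instModuleTwist (U : (Proj 𝒜).Opens) : Module Γ(Proj 𝒜, U) (twistSections 𝒜 d U) where
  one_smul f := by
    apply Subtype.ext; funext x
    exact (congrArg (· * f.1 x) HomogeneousLocalization.val_one).trans (one_mul _)
  mul_smul r s f := by
    apply Subtype.ext; funext x
    exact (congrArg (· * f.1 x) (HomogeneousLocalization.val_mul _ _)).trans (mul_assoc _ _ _)
  smul_zero r := by
    apply Subtype.ext; funext x
    exact mul_zero _
  smul_add r f g := by
    apply Subtype.ext; funext x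
    exact mul_add _ _ _
  add_smul r s f := by
    apply Subtype.ext; funext x
    exact (congrArg (· * f.1 x) (HomogeneousLocalization.val_add _ _)).trans (add_mul _ _ _)
  zero_smul f := by
    apply Subtype.ext; funext x
    exact (congrArg (· * f.1 x) HomogeneousLocalization.val_zero).trans (zero_mul _)

/-- The abelian presheaf `𝒪(d)` on `Proj A`. -/
def twistPresheaf : TopCat.Presheaf Ab.{u} (Proj 𝒜) where
  obj U := AddCommGrpCat.of (twistSections 𝒜 d U.unop)
  map i := AddCommGrpCat.ofHom
    { toFun := fun f => ⟨fun x => f.1 (i.unop x), (twistLocal 𝒜 d).res i.unop _ f.2⟩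
      map_zero' := rfl
      map_add' := fun _ _ => rfl }

instance (U : (Proj 𝒜).Opensᵒᵖ) :
    Module ((Proj 𝒜).ringCatSheaf.obj.obj U) ((twistPresheaf 𝒜 d).obj U) :=
  instModuleTwist 𝒜 d U.unop

/-- `𝒪(d)`, as a presheaf of sets, is the sheaf of functions that are locally fractions of degree `d`. -/
def twistPresheafCompForget :
    twistPresheaf 𝒜 d ⋙ forget Ab ≅ (TopCat.subsheafToTypes (twistLocal 𝒜 d)).1 :=
  NatIso.ofComponents (fun _ => Iso.refl _) (fun _ => rfl)

/-- Serre's twisting sheaf `𝒪(d)` on `Proj A`. -/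
def serreTwist : (Proj 𝒜).Modules where
  val := PresheafOfModules.ofPresheaf (twistPresheaf 𝒜 d) fun _ _ _ _ _ => rfl
  isSheaf := (TopCat.Presheaf.isSheaf_iff_isSheaf_comp (forget Ab.{u}) (twistPresheaf 𝒜 d)).mpr
    (TopCat.Presheaf.isSheaf_of_iso (twistPresheafCompForget 𝒜 d).symm
      (TopCat.subsheafToTypes (twistLocal 𝒜 d)).property)

end Twist

section Blowup

/-- The structure morphism `Proj A ⟶ Spec R` of the `Proj` of a graded `R`-algebra `A`. -/
def projToSpec {R A : Type u} [CommRing R] [CommRing A] [Algebra R A] (𝒜 : ℕ → Submodule R A)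
    [GradedAlgebra 𝒜] : Proj 𝒜 ⟶ Spec (CommRingCat.of R) :=
  Proj.toSpecZero 𝒜 ≫ Spec.map (CommRingCat.ofHom (algebraMap R (𝒜 0)))

/-- `σ : S' ⟶ S` is the blow-up of `S` along the ideal sheaf `I`, that is, `S' = Proj (⨁ Iⁱ)` over `S`:
over each affine open `U` of `S` it is the `Proj` of the Rees algebra of `I(U) ⊆ Γ(S, U)`.  (A blow-up
has no nontrivial automorphisms over its base, so the isomorphisms over the various `U` are unique
and agree on overlaps.) -/
structure IsBlowup {S S' : Scheme.{u}} (σ : S' ⟶ S) (I : S.IdealSheafData) : Prop where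
  exists_iso (U : S.affineOpens) :
    ∃ e : (σ ⁻¹ᵁ U.1).toScheme ≅ Proj (reesPiece (I.ideal U)),
      e.hom ≫ projToSpec (reesPiece (I.ideal U)) = σ ∣_ U.1 ≫ U.2.isoSpec.hom

/-- `σ : S' ⟶ S` is the blow-up of `S` at the closed point `p`. -/
def IsBlowupAtPoint {S S' : Scheme.{u}} (σ : S' ⟶ S) (p : S) (hp : IsClosed {p}) : Prop :=
  IsBlowup σ (Scheme.IdealSheafData.vanishingIdeal ⟨{p}, hp⟩)

/-- The grading of `k[x₀, x₁]` by degree. -/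
instance gradedAlgebraTwoVariables (k : Type u) [CommRing k] :
    GradedAlgebra (MvPolynomial.homogeneousSubmodule (Fin 2) k) :=
  MvPolynomial.gradedAlgebra

/-- The projective line `ℙ¹ = Proj k[x₀, x₁]`. -/
def projectiveLine (k : Type u) [CommRing k] : Scheme.{u} :=
  Proj (MvPolynomial.homogeneousSubmodule (Fin 2) k)

/-- The structure morphism `ℙ¹ ⟶ Spec k`. -/
def projectiveLineToSpec (k : Type u) [CommRing k] :
    projectiveLine k ⟶ Spec (CommRingCat.of k) :=
  projToSpec (MvPolynomial.homogeneousSubmodule (Fin 2) k)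

/-- The sheaf `𝒪(1)` on `ℙ¹`. -/
def projectiveLineTwist (k : Type u) [CommRing k] : (projectiveLine k).Modules :=
  serreTwist (MvPolynomial.homogeneousSubmodule (Fin 2) k) 1

/-- A pair of morphisms of sheaves of modules forms a short exact sequence `0 → A → B → C → 0`. -/
def IsShortExact {X : Scheme.{u}} {A B C : X.Modules} (α : A ⟶ B) (β : B ⟶ C) : Prop :=
  ∃ w : α ≫ β = 0, (ShortComplex.mk α β w).ShortExact

end Blowup

end

end BlowupTangent

open BlowupTangent

/-! Choose coordinates x₁, …, xₙ on an affine neighbourhood `U` of `p` which generate the maximal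
ideal of `p`, with dual vector fields θ_j = ∂/∂x_j. Over `U` the blow-up is covered by charts V_a
whose rings are generated over Γ(S, U) by the quotients y_{aj} = x_j / x_a, and x_a is a regular
equation of E on V_a.

Over σ⁻¹U, a section m of σ^*𝒯_S is a derivation from functions on S to functions on S', and it
amounts to its values m_j on the x_j (`evalAt`, `IsLocalCoordinates.evalAt_sum`). As x_a is regular,
m extends in at most one way to a derivation of the functions on V_a; this is the injectivity of dσ.
The extension exists exactly when the quotient rule x_a D(y_{aj}) = m_j - y_{aj} m_a can be solved
for the D(y_{aj}), that is, when m_j = y_{aj} m_a on E for all j (`IsDer.exists_extend`,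
`IsLocalCoordinates.exists_isImage`). Off E the map σ is locally an isomorphism and the cokernel
vanishes.

Hence the cokernel of dσ is the quotient of 𝒪_E^n by the line spanned by the vector (y_{aj})_j, as
in the Euler sequence. `IsEulerFrame` says that sections c₁, …, cₙ present a sheaf C on E in this
way, and `isShortExact_frameMap` shows that for every such C the map θ_j ↦ c_j completes dσ to a
short exact sequence. Both sequences of the theorem therefore reduce to finding an Euler frame. For
𝒯_E ⊗ 𝒪_E(E) it is c_j = (x_a ∂/∂x_j) ⊗ (1/x_a), which does not depend on a
(`IsCentered.exists_isEulerFrame`). For n = 2 and 𝒪(1) with homogeneous coordinates w₀, w₁ it is w₁,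
-w₀ (`isEulerFrame_lineTwist`).

The isomorphism E ≅ ℙ¹ for n = 2 comes from the graded map X_j ↦ x_j t from k[X₀, X₁] to the Rees
algebra. On a standard chart it is k[v] → Γ(E ∩ V_a), v ↦ y_{ab}. This is surjective because
functions from S are constant on E, and injective because some vector field on E ∩ V_a takes the
value 1 on y_{ab}, which makes y_{ab} transcendental in characteristic zero
(`IsCentered.bijective_lineMap`). -/

namespace BlowupTangent

noncomputable section

/-! ### Gluing sections and morphisms of sheaves of modules -/

section Toolkit

variable {X Y : Scheme.{u}}

/-- Restriction of sections of a sheaf of modules. -/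
def res (M : X.Modules) {V W : X.Opens} (h : W ≤ V) (m : Γ(M, V)) : Γ(M, W) :=
  M.presheaf.map (homOfLE h).op m

/-- Restriction of functions. -/
def resFun {V W : X.Opens} (h : W ≤ V) : Γ(X, V) →+* Γ(X, W) :=
  (X.presheaf.map (homOfLE h).op).hom

section res
variable (M N : X.Modules) {U V W : X.Opens}

theorem res_add (h : W ≤ V) (m m' : Γ(M, V)) : res M h (m + m') = res M h m + res M h m' :=
  map_add _ _ _
theorem res_zero (h : W ≤ V) : res M h (0 : Γ(M, V)) = 0 := map_zero _
theorem res_neg (h : W ≤ V) (m : Γ(M, V)) : res M h (-m) = -res M h m := map_neg _ _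
theorem res_smul (h : W ≤ V) (r : Γ(X, V)) (m : Γ(M, V)) :
    res M h (r • m) = resFun h r • res M h m := Scheme.Modules.map_smul M _ r m
theorem res_sum {ι : Type*} (s : Finset ι) (h : W ≤ V) (m : ι → Γ(M, V)) :
    res M h (∑ i ∈ s, m i) = ∑ i ∈ s, res M h (m i) := map_sum _ _ _
theorem res_res (h : V ≤ U) (h' : W ≤ V) (m : Γ(M, U)) :
    res M h' (res M h m) = res M (h'.trans h) m :=
  presheaf_map_map M.presheaf _ _ _ _
theorem res_self (h : V ≤ V) (m : Γ(M, V)) : res M h m = m := by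
  rw [res, Subsingleton.elim (homOfLE h) (𝟙 V), op_id, M.presheaf.map_id]; rfl
theorem resFun_resFun (h : V ≤ U) (h' : W ≤ V) (r : Γ(X, U)) :
    resFun h' (resFun h r) = resFun (h'.trans h) r := by
  change (X.presheaf.map _ ≫ X.presheaf.map _) r = _
  rw [← Functor.map_comp]; rfl
theorem resFun_self (h : V ≤ V) (r : Γ(X, V)) : resFun h r = r := by
  change X.presheaf.map _ r = r
  rw [Subsingleton.elim (homOfLE h) (𝟙 V), op_id, X.presheaf.map_id]; rfl

variable {M N} in
theorem app_res (φ : M ⟶ N) (h : W ≤ V) (m : Γ(M, V)) :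
    φ.app W (res M h m) = res N h (φ.app V m) :=
  ConcreteCategory.congr_hom (φ.mapPresheaf.naturality (homOfLE h).op) m

variable {M} in
theorem eq_of_locally_eq {s t : Γ(M, V)}
    (H : ∀ x ∈ V, ∃ (W : X.Opens) (h : W ≤ V), x ∈ W ∧ res M h s = res M h t) : s = t := by
  choose! W h hx e using H
  exact TopCat.Sheaf.eq_of_locally_eq' ⟨M.presheaf, M.isSheaf⟩ (fun x : V => W x.1) V
    (fun x => homOfLE (h x.1 x.2)) (fun x hxV => Opens.mem_iSup.mpr ⟨⟨x, hxV⟩, hx x hxV⟩)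
    s t (fun x => e x.1 x.2)

theorem resFun_eq_of_locally_eq {s t : Γ(X, V)}
    (H : ∀ x ∈ V, ∃ (W : X.Opens) (h : W ≤ V), x ∈ W ∧ resFun h s = resFun h t) : s = t :=
  eq_of_locally_eq (M := structureModule X) H

variable {M} in
/-- Compatible local sections glue. -/
theorem exists_glue {ι : Type*} (O : ι → X.Opens) (hO : ∀ i, O i ≤ V)
    (hV : ∀ x ∈ V, ∃ i, x ∈ O i) (m : ∀ i, Γ(M, O i))
    (hm : ∀ i j, res M (inf_le_left : O i ⊓ O j ≤ O i) (m i) =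
      res M (inf_le_right : O i ⊓ O j ≤ O j) (m j)) :
    ∃ s : Γ(M, V), ∀ i, res M (hO i) s = m i :=
  (TopCat.Sheaf.existsUnique_gluing' ⟨M.presheaf, M.isSheaf⟩ O V (fun i => homOfLE (hO i))
    (fun x hx => Opens.mem_iSup.mpr (hV x hx)) m hm).exists

variable {M} in
/-- A section is determined locally by a property with unique solutions. -/
theorem exists_of_local (P : ∀ (W : X.Opens), W ≤ V → Γ(M, W) → Prop)
    (hres : ∀ {W W' : X.Opens} (h : W ≤ V) (h' : W' ≤ W) (n : Γ(M, W)), P W h n →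
      P W' (h'.trans h) (res M h' n))
    (huniq : ∀ (W : X.Opens) (h : W ≤ V) (n n' : Γ(M, W)), P W h n → P W h n' → n = n')
    (hex : ∀ x ∈ V, ∃ (W : X.Opens) (h : W ≤ V), x ∈ W ∧ ∃ n, P W h n) :
    ∃ s : Γ(M, V), ∀ x ∈ V, ∃ (W : X.Opens) (h : W ≤ V), x ∈ W ∧ P W h (res M h s) := by
  choose! W h hx n hn using hex
  obtain ⟨s, hs⟩ := exists_glue (M := M) (V := V) (fun x : V => W x.1) (fun x => h x.1 x.2)
    (fun x hx' => ⟨⟨x, hx'⟩, hx x hx'⟩) (fun x => n x.1) (fun x y => by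
      apply huniq _ (inf_le_left.trans (h x.1 x.2))
      · exact hres _ _ _ (hn x.1 x.2)
      · exact hres (h y.1 y.2) inf_le_right _ (hn y.1 y.2))
  exact ⟨s, fun x hxV => ⟨W x, h x hxV, hx x hxV, (hs ⟨x, hxV⟩).symm ▸ hn x hxV⟩⟩

end res

/-- A morphism of sheaves of modules from compatible linear maps on sections. -/
def mkHom {M N : X.Modules} (f : ∀ V : X.Opens, Γ(M, V) →ₗ[Γ(X, V)] Γ(N, V))
    (hf : ∀ {V W : X.Opens} (h : W ≤ V) (m : Γ(M, V)), res N h (f V m) = f W (res M h m)) :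
    M ⟶ N :=
  ⟨PresheafOfModules.homMk
    { app := fun V => AddCommGrpCat.ofHom (f V.unop).toAddMonoidHom
      naturality := fun V W i => by
        ext m
        exact (hf i.unop.le m).symm }
    (fun V r m => (f V.unop).map_smul r m)⟩

theorem hom_ext_apply {M N : X.Modules} {φ ψ : M ⟶ N}
    (h : ∀ V (m : Γ(M, V)), φ.app V m = ψ.app V m) : φ = ψ := by
  ext V m; exact h V m

/-- A morphism of sheaves of modules is determined by a local relation with unique solutions. -/
theorem exists_hom_of_rel {M N : X.Modules} (P : ∀ V : X.Opens, Γ(M, V) → Γ(N, V) → Prop)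
    (hres : ∀ {V W : X.Opens} (h : W ≤ V) m n, P V m n → P W (res M h m) (res N h n))
    (huniq : ∀ V m n n', P V m n → P V m n' → n = n')
    (hadd : ∀ V m m' n n', P V m n → P V m' n' → P V (m + m') (n + n'))
    (hsmul : ∀ V (r : Γ(X, V)) m n, P V m n → P V (r • m) (r • n))
    (hex : ∀ V (m : Γ(M, V)), ∀ x ∈ V, ∃ (W : X.Opens) (h : W ≤ V), x ∈ W ∧
      ∃ n, P W (res M h m) n) :
    ∃ φ : M ⟶ N, ∀ V (m : Γ(M, V)), ∀ x ∈ V, ∃ (W : X.Opens) (h : W ≤ V), x ∈ W ∧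
      P W (res M h m) (res N h (φ.app V m)) := by
  have key : ∀ V (m : Γ(M, V)), ∃ n : Γ(N, V), ∀ x ∈ V, ∃ (W : X.Opens) (h : W ≤ V), x ∈ W ∧
      P W (res M h m) (res N h n) := fun V m =>
    exists_of_local (fun W h n => P W (res M h m) n)
      (fun h h' n hn => by rw [← res_res M h h']; exact hres h' _ _ hn)
      (fun W h n n' => huniq W _ n n') (hex V m)
  choose g hg using key
  -- Uniqueness extends to sections which satisfy `P` only locally. Additivity, linearity and
  -- naturality of `g` are each proved by exhibiting a second local solution.
  have uniq : ∀ V (m : Γ(M, V)) (n : Γ(N, V)), (∀ x ∈ V, ∃ (W : X.Opens) (h : W ≤ V), x ∈ W ∧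
      P W (res M h m) (res N h n)) → n = g V m := by
    intro V m n hn
    refine eq_of_locally_eq fun x hx => ?_
    obtain ⟨W, h, hxW, hP⟩ := hn x hx
    obtain ⟨W', h', hxW', hP'⟩ := hg V m x hx
    refine ⟨W ⊓ W', inf_le_left.trans h, ⟨hxW, hxW'⟩, huniq _ (res M (inf_le_left.trans h) m) _ _ ?_ ?_⟩
    · have := hres (inf_le_left : W ⊓ W' ≤ W) _ _ hP
      rwa [res_res, res_res] at this
    · have := hres (inf_le_right : W ⊓ W' ≤ W') _ _ hP'
      rwa [res_res, res_res] at this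
  refine ⟨mkHom (fun V => { toFun := g V, map_add' := fun m m' => ?_, map_smul' := fun r m => ?_ })
    (fun {V W} h m => ?_), hg⟩
  · refine (uniq V _ _ fun x hx => ?_).symm
    obtain ⟨W, h, hxW, hP⟩ := hg V m x hx
    obtain ⟨W', h', hxW', hP'⟩ := hg V m' x hx
    refine ⟨W ⊓ W', inf_le_left.trans h, ⟨hxW, hxW'⟩, ?_⟩
    have h1 := hres (inf_le_left : W ⊓ W' ≤ W) _ _ hP
    have h2 := hres (inf_le_right : W ⊓ W' ≤ W') _ _ hP'
    rw [res_res, res_res] at h1 h2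
    rw [res_add, res_add]
    exact hadd _ _ _ _ _ h1 h2
  · refine (uniq V _ _ fun x hx => ?_).symm
    obtain ⟨W, h, hxW, hP⟩ := hg V m x hx
    refine ⟨W, h, hxW, ?_⟩
    rw [RingHom.id_apply, res_smul, res_smul]
    exact hsmul _ _ _ _ hP
  · refine uniq W _ _ fun x hx => ?_
    obtain ⟨W', h', hxW', hP⟩ := hg V m x (h hx)
    refine ⟨W' ⊓ W, inf_le_right, ⟨hxW', hx⟩, ?_⟩
    have h1 := hres (inf_le_left : W' ⊓ W ≤ W') _ _ hP
    rw [res_res, res_res] at h1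
    rw [res_res]
    exact (res_res N h inf_le_right (g V m)).symm ▸ h1

/-- A sequence of sheaves of modules which is injective on sections, locally exact and locally
surjective is short exact. -/
theorem isShortExact_of_local {A B C : X.Modules} (α : A ⟶ B) (β : B ⟶ C)
    (hinj : ∀ V (a : Γ(A, V)), α.app V a = 0 → a = 0)
    (hzero : ∀ V (a : Γ(A, V)), β.app V (α.app V a) = 0)
    (hexact : ∀ V (b : Γ(B, V)), β.app V b = 0 → ∀ x ∈ V, ∃ (W : X.Opens) (h : W ≤ V), x ∈ W ∧
      ∃ a, α.app W a = res B h b)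
    (hsurj : ∀ V (c : Γ(C, V)), ∀ x ∈ V, ∃ (W : X.Opens) (h : W ≤ V), x ∈ W ∧
      ∃ b, β.app W b = res C h c) : IsShortExact α β := by
  have inj : ∀ V (a a' : Γ(A, V)), α.app V a = α.app V a' → a = a' := fun V a a' h =>
    sub_eq_zero.mp (hinj V _ (by rw [map_sub, h, sub_self]))
  have w : α ≫ β = 0 := hom_ext_apply fun V a => hzero V a
  have : Mono α := ⟨fun {T} g h e => hom_ext_apply fun V t => inj V _ _ <|
    congrArg (fun φ : T ⟶ B => φ.app V t) e⟩
  have : Epi β := ⟨fun {T} g h e => hom_ext_apply fun V c => eq_of_locally_eq fun x hx => by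
    obtain ⟨W, hW, hxW, b, hb⟩ := hsurj V c x hx
    refine ⟨W, hW, hxW, ?_⟩
    rw [← app_res, ← app_res, ← hb]
    exact congrArg (fun φ : B ⟶ T => φ.app W b) e⟩
  refine ⟨w, { exact := ShortComplex.exact_of_f_is_kernel _ ?_, mono_f := ‹_›, epi_g := ‹_› }⟩
  -- The relation `α a = γ t` defines the lift of `γ` through `α`: injectivity of `α` makes `a`
  -- unique, and local exactness provides it on a cover.
  have lift : ∀ {T : X.Modules} (γ : T ⟶ B), γ ≫ β = 0 → ∃ δ : T ⟶ A, δ ≫ α = γ := by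
    intro T γ hγ
    obtain ⟨δ, hδ⟩ := exists_hom_of_rel (M := T) (N := A) (fun V t a => α.app V a = γ.app V t)
      (fun h m n e => by rw [app_res, app_res, e])
      (fun V m n n' e e' => inj V _ _ (e.trans e'.symm))
      (fun V m m' n n' e e' => by rw [map_add, map_add, e, e'])
      (fun V r m n e => by rw [Scheme.Modules.Hom.app_smul, Scheme.Modules.Hom.app_smul, e])
      (fun V m x hx => by
        obtain ⟨W, h, hxW, a, ha⟩ := hexact V (γ.app V m)
          (congrArg (fun φ : T ⟶ C => φ.app V m) hγ) x hx
        exact ⟨W, h, hxW, a, ha.trans (app_res γ h m).symm⟩)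
    refine ⟨δ, hom_ext_apply fun V t => eq_of_locally_eq fun x hx => ?_⟩
    obtain ⟨W, h, hxW, e⟩ := hδ V t x hx
    refine ⟨W, h, hxW, ?_⟩
    rw [app_res, app_res] at e
    exact e
  choose l hl using @lift
  exact Limits.KernelFork.IsLimit.ofι' _ _ fun γ hγ => ⟨l γ hγ, hl γ hγ⟩

end Toolkit

/-! ### Morphisms defined over an open subset -/

section PartialHom

variable {X Y : Scheme.{u}} {M N : X.Modules} {U V W : X.Opens}

/-- The value of a morphism `M|_U ⟶ N|_U` on a section over `V ⊆ U`. -/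
def ap (φ : homOn M.val N U) (h : V ≤ U) : Γ(M, V) →ₗ[Γ(X, V)] Γ(N, V) := φ.1 ⟨V, h⟩

theorem res_ap (φ : homOn M.val N U) (h : V ≤ U) (h' : W ≤ V) (m : Γ(M, V)) :
    res N h' (ap φ h m) = ap φ (h'.trans h) (res M h' m) :=
  φ.2 ⟨V, h⟩ ⟨W, h'.trans h⟩ (homOfLE h') m

/-- A morphism `M|_U ⟶ N|_U` from compatible linear maps on sections. -/
def mkHomOn (f : ∀ V : X.Opens, V ≤ U → Γ(M, V) →ₗ[Γ(X, V)] Γ(N, V))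
    (hf : ∀ {V W : X.Opens} (h : V ≤ U) (h' : W ≤ V) (m : Γ(M, V)),
      res N h' (f V h m) = f W (h'.trans h) (res M h' m)) : homOn M.val N U :=
  ⟨fun V => f V.1 V.2, fun V _ i m => hf V.2 i.le m⟩

variable (U) in
/-- The presheaf `V ↦ N(V ∩ U)`. -/
def cutPresheaf (N : X.Modules) : TopCat.Presheaf Ab.{u} X where
  obj V := Γ(N, V.unop ⊓ U)
  map i := N.presheaf.map (homOfLE (inf_le_inf_right U i.unop.le)).op
  map_id V := N.presheaf.map_id _
  map_comp i j := by rw [← N.presheaf.map_comp]; rfl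

instance (N : X.Modules) (V : X.Opensᵒᵖ) :
    Module (X.ringCatSheaf.obj.obj V) ((cutPresheaf U N).obj V) :=
  Module.compHom Γ(N, V.unop ⊓ U) (resFun (inf_le_left : V.unop ⊓ U ≤ V.unop))

theorem cutPresheaf_map_smul (N : X.Modules) ⦃V W : X.Opensᵒᵖ⦄ (i : V ⟶ W)
    (r : X.ringCatSheaf.obj.obj V) (m : (cutPresheaf U N).obj V) :
    (cutPresheaf U N).map i (r • m) = X.ringCatSheaf.obj.map i r • (cutPresheaf U N).map i m := by
  have hr : resFun inf_le_left (resFun i.unop.le r) =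
      resFun (inf_le_inf_right U i.unop.le) (resFun inf_le_left r) :=
    (resFun_resFun _ _ _).trans (resFun_resFun _ _ _).symm
  refine (res_smul N (inf_le_inf_right U i.unop.le) (resFun inf_le_left r) m).trans ?_
  rw [← hr]; rfl

theorem cutPresheaf_isSheaf (N : X.Modules) : (cutPresheaf U N).IsSheaf := by
  rw [TopCat.Presheaf.isSheaf_iff_isSheafUniqueGluing]
  intro ι O sf hsf
  have hle : ∀ i, O i ⊓ U ≤ iSup O ⊓ U := fun i => inf_le_inf_right U (le_iSup O i)
  have hcov : ∀ x ∈ iSup O ⊓ U, ∃ i, x ∈ O i ⊓ U := fun x hx => by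
    obtain ⟨i, hi⟩ := Opens.mem_iSup.mp hx.1
    exact ⟨i, hi, hx.2⟩
  obtain ⟨s, hs⟩ := exists_glue (M := N) (fun i => O i ⊓ U) hle hcov sf (fun i j => by
    have h1 : (O i ⊓ U) ⊓ (O j ⊓ U) ≤ (O i ⊓ O j) ⊓ U :=
      le_inf (inf_le_inf inf_le_left inf_le_left) (inf_le_left.trans inf_le_right)
    have h2 := congrArg (res N h1) (hsf i j)
    exact ((res_res N _ h1 (sf i)).symm.trans h2).trans (res_res N _ h1 (sf j)))
  refine ⟨s, hs, fun s' hs' => eq_of_locally_eq (M := N) fun x hx => ?_⟩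
  obtain ⟨i, hi⟩ := hcov x hx
  exact ⟨O i ⊓ U, hle i, hi, (hs' i).trans (hs i).symm⟩

variable (U) in
/-- The sheaf of modules `V ↦ N(V ∩ U)`. -/
def cut (N : X.Modules) : X.Modules where
  val := PresheafOfModules.ofPresheaf (cutPresheaf U N) (cutPresheaf_map_smul N)
  isSheaf := cutPresheaf_isSheaf N

/-- A morphism `M|_U ⟶ N|_U` as a morphism to the sheaf `V ↦ N(V ∩ U)`. -/
def toCut (φ : homOn M.val N U) : M ⟶ cut U N :=
  mkHom (N := cut U N) (fun V =>
    { toFun := fun m => ap φ (inf_le_right : V ⊓ U ≤ U) (res M inf_le_left m)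
      map_add' := fun m m' => by rw [res_add, map_add]; rfl
      map_smul' := fun r m => by rw [res_smul, map_smul]; rfl })
    (fun {V W} h m => by
      refine (res_ap φ inf_le_right (inf_le_inf_right U h) _).trans ?_
      rw [res_res]
      exact congrArg _ (res_res M h inf_le_left m).symm)

/-- A morphism to the sheaf `V ↦ N(V ∩ U)` as a morphism `M|_U ⟶ N|_U`. -/
def ofCut (φ : M ⟶ cut U N) : homOn M.val N U :=
  mkHomOn (fun V h =>
    { toFun := fun m => res N (le_inf le_rfl h) (show Γ(N, V ⊓ U) from φ.app V m)
      map_add' := fun m m' => by rw [map_add]; exact res_add _ _ _ _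
      map_smul' := fun r m => by
        rw [Scheme.Modules.Hom.app_smul]
        refine (res_smul N _ (resFun inf_le_left r) _).trans ?_
        rw [resFun_resFun, resFun_self]; rfl })
    (fun {V W} h h' m => by
      refine (res_res N _ _ _).trans ?_
      refine Eq.trans ?_ (congrArg (res N (le_inf le_rfl (h'.trans h)))
        (app_res φ h' m).symm)
      exact (res_res N (inf_le_inf_right U h') _ _).symm)

theorem ap_ofCut (φ : M ⟶ cut U N) (h : V ≤ U) (m : Γ(M, V)) :
    ap (ofCut φ) h m = res N (le_inf le_rfl h) (show Γ(N, V ⊓ U) from φ.app V m) := rfl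

/-- The sheaf `cut U N` is j_*j^*N for the inclusion j of `U`, so morphisms to it are the same as
morphisms over `U`. This half of the bijection suffices to carry statements on global morphisms,
such as the adjunction of pullback and pushforward, over to `U`. -/
theorem ap_ofCut_toCut (φ : homOn M.val N U) (h : V ≤ U) (m : Γ(M, V)) :
    ap (ofCut (toCut φ)) h m = ap φ h m := by
  refine (res_ap φ _ _ _).trans ?_
  rw [res_res, res_self]

end PartialHom

/-! ### Pulled back sections and the adjunction with pushforward -/

section Pullback

variable {X Y : Scheme.{u}} (f : X ⟶ Y) {M : Y.Modules} {N : X.Modules}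
  {U U' : Y.Opens} {V V' : X.Opens}

theorem pullbackSection_add (h : V ≤ f ⁻¹ᵁ U) (m m' : Γ(M, U)) :
    pullbackSection f M h (m + m') = pullbackSection f M h m + pullbackSection f M h m' :=
  (congrArg (res ((Scheme.Modules.pullback f).obj M) h) (map_add _ _ _)).trans
    (res_add _ _ _ _)

theorem res_pullbackSection (h : V ≤ f ⁻¹ᵁ U) (h' : V' ≤ V) (m : Γ(M, U)) :
    res _ h' (pullbackSection f M h m) = pullbackSection f M (h'.trans h) m :=
  res_res _ h h' _

theorem pullbackSection_res (h : U' ≤ U) (h' : V ≤ f ⁻¹ᵁ U') (m : Γ(M, U)) :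
    pullbackSection f M h' (res M h m) =
      pullbackSection f M (h'.trans (f.preimage_mono h)) m := by
  have e := app_res ((Scheme.Modules.pullbackPushforwardAdjunction f).unit.app M) h m
  refine (congrArg (res ((Scheme.Modules.pullback f).obj M) h') e).trans ?_
  exact res_res ((Scheme.Modules.pullback f).obj M) (f.preimage_mono h) h' _

theorem appLE_eq_resFun (h : V ≤ f ⁻¹ᵁ U) (r : Γ(Y, U)) :
    f.appLE U V h r = resFun h (f.app U r) := rfl

theorem pullbackSection_smul (h : V ≤ f ⁻¹ᵁ U) (r : Γ(Y, U)) (m : Γ(M, U)) :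
    pullbackSection f M h (r • m) = f.appLE U V h r • pullbackSection f M h m := by
  have e := Scheme.Modules.Hom.app_smul
    ((Scheme.Modules.pullbackPushforwardAdjunction f).unit.app M) r m
  refine (congrArg (res ((Scheme.Modules.pullback f).obj M) h) e).trans ?_
  exact res_smul ((Scheme.Modules.pullback f).obj M) h (f.app U r) _

/-- The morphism is the transpose of `g` under the adjunction; composing it with the unit gives back
`g`. -/
theorem exists_hom_pullback (g : M ⟶ (Scheme.Modules.pushforward f).obj N) :
    ∃ φ : (Scheme.Modules.pullback f).obj M ⟶ N, ∀ (U : Y.Opens) (V : X.Opens)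
      (h : V ≤ f ⁻¹ᵁ U) (m : Γ(M, U)),
      φ.app V (pullbackSection f M h m) = res N h (show Γ(N, f ⁻¹ᵁ U) from g.app U m) := by
  set adj := Scheme.Modules.pullbackPushforwardAdjunction f
  refine ⟨(adj.homEquiv M N).symm g, fun U V h m => ?_⟩
  have e : adj.unit.app M ≫ (Scheme.Modules.pushforward f).map ((adj.homEquiv M N).symm g) = g :=
    (adj.homEquiv_unit (X := M) (Y := N)
      (f := (adj.homEquiv M N).symm g)).symm.trans (Equiv.apply_symm_apply _ _)
  refine (app_res _ h _).trans (congrArg (res N h) ?_)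
  exact congrArg (fun ψ : M ⟶ (Scheme.Modules.pushforward f).obj N => ψ.app U m) e

-- Pulled back sections are the values of the unit of the adjunction, and a morphism out of the
-- pullback is determined by its composite with the unit.
variable {f} in
theorem hom_pullback_ext {φ ψ : (Scheme.Modules.pullback f).obj M ⟶ N}
    (H : ∀ (U : Y.Opens) (m : Γ(M, U)), φ.app (f ⁻¹ᵁ U) (pullbackSection f M le_rfl m) =
      ψ.app (f ⁻¹ᵁ U) (pullbackSection f M le_rfl m)) : φ = ψ := by
  set adj := Scheme.Modules.pullbackPushforwardAdjunction f
  apply (adj.homEquiv M N).injective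
  rw [Adjunction.homEquiv_unit, Adjunction.homEquiv_unit]
  refine hom_ext_apply fun U m => ?_
  have := H U m
  have e : pullbackSection f M le_rfl m = (adj.unit.app M).app U m := res_self _ _ _
  rw [e] at this
  exact this

variable {f} in
theorem homOn_pullback_ext {φ ψ : homOn ((Scheme.Modules.pullback f).obj M).val N (f ⁻¹ᵁ U)}
    (H : ∀ (W : Y.Opens) (h : W ≤ U) (m : Γ(M, W)),
      ap φ (f.preimage_mono h) (pullbackSection f M le_rfl m) =
      ap ψ (f.preimage_mono h) (pullbackSection f M le_rfl m))
    (h : V ≤ f ⁻¹ᵁ U) (m : Γ((Scheme.Modules.pullback f).obj M, V)) : ap φ h m = ap ψ h m := by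
  have e : toCut φ = toCut ψ := hom_pullback_ext fun W m => by
    have e : res ((Scheme.Modules.pullback f).obj M)
        (f.preimage_mono (inf_le_left : W ⊓ U ≤ W)) (pullbackSection f M le_rfl m) =
        pullbackSection f M (le_refl (f ⁻¹ᵁ (W ⊓ U))) (res M inf_le_left m) := by
      rw [res_pullbackSection, pullbackSection_res]
    have e' := H (W ⊓ U) inf_le_right (res M inf_le_left m)
    rw [← e] at e'
    exact e'
  rw [← ap_ofCut_toCut φ, e, ap_ofCut_toCut]

theorem exists_homOn_pullback
    (g : homOn M.val ((Scheme.Modules.pushforward f).obj N) U) :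
    ∃ φ : homOn ((Scheme.Modules.pullback f).obj M).val N (f ⁻¹ᵁ U),
      ∀ (W : Y.Opens) (hW : W ≤ U) (V : X.Opens) (h : V ≤ f ⁻¹ᵁ W) (m : Γ(M, W)),
      ap φ (h.trans (f.preimage_mono hW)) (pullbackSection f M h m) =
        res N h (show Γ(N, f ⁻¹ᵁ W) from ap g hW m) := by
  -- The sheaves f_*(cut (f⁻¹U) N) and cut U (f_*N) have the same sections N(f⁻¹(V ∩ U)), so `toCut
  -- g` serves unchanged once the two scalar actions are compared.
  let g' : M ⟶ (Scheme.Modules.pushforward f).obj (cut (f ⁻¹ᵁ U) N) :=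
    mkHom (N := (Scheme.Modules.pushforward f).obj (cut (f ⁻¹ᵁ U) N))
      (fun V => 
        { toFun := (toCut g).app V
          map_add' := map_add _
          map_smul' := fun r m => by
            refine (Scheme.Modules.Hom.app_smul (toCut g) r m).trans ?_
            have e : f.app (V ⊓ U) (resFun inf_le_left r) =
                resFun (f.preimage_mono inf_le_left) (f.app V r) :=
              ConcreteCategory.congr_hom (f.naturality (homOfLE inf_le_left).op) r
            exact congrArg (fun c : Γ(X, f ⁻¹ᵁ (V ⊓ U)) =>
              c • (show Γ(N, f ⁻¹ᵁ (V ⊓ U)) from (toCut g).app V m)) e })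
      (fun h m => (app_res (toCut g) h m).symm)
  obtain ⟨φ, hφ⟩ := exists_hom_pullback f g'
  refine ⟨ofCut φ, fun W hW V h m => ?_⟩
  rw [ap_ofCut, hφ]
  refine (res_res N _ _ _).trans ?_
  have e := res_ap g hW (inf_le_left : W ⊓ U ≤ W) m
  refine Eq.trans ?_ (res_res N (f.preimage_mono (inf_le_left : W ⊓ U ≤ W))
    (h.trans (f.preimage_mono (le_inf le_rfl hW))) _)
  exact congrArg (res N (h.trans (f.preimage_mono (le_inf le_rfl hW)))) e.symm

end Pullback

/-! ### Local bases of sheaves of modules -/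

section Basis

variable {X Y : Scheme.{u}} {M N : X.Modules} {U V W : X.Opens} {ι : Type*} [Fintype ι]

/-- The value of a linear functional on `M|_U` on a section over `V ⊆ U`. -/
def apFun (φ : homOn M.val (structureModule X) U) (h : V ≤ U) : Γ(M, V) →ₗ[Γ(X, V)] Γ(X, V) :=
  φ.1 ⟨V, h⟩

theorem resFun_apFun (φ : homOn M.val (structureModule X) U) (h : V ≤ U) (h' : W ≤ V)
    (m : Γ(M, V)) : resFun h' (apFun φ h m) = apFun φ (h'.trans h) (res M h' m) :=
  res_ap φ h h' m

/-- The sections `e` over `U` freely generate `M|_U`. -/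
structure IsBasisOn (M : X.Modules) (U : X.Opens) (e : ι → Γ(M, U)) : Prop where
  indep : ∀ (V : X.Opens) (h : V ≤ U) (c : ι → Γ(X, V)), ∑ i, c i • res M h (e i) = 0 → ∀ i, c i = 0
  span : ∀ (V : X.Opens) (h : V ≤ U) (m : Γ(M, V)), ∃ c : ι → Γ(X, V), m = ∑ i, c i • res M h (e i)

/-- By independence the coordinates of a section are unique wherever they exist, so local
coordinates glue. -/
theorem isBasisOn_of_local {e : ι → Γ(M, U)}
    (indep : ∀ (V : X.Opens) (h : V ≤ U) (c : ι → Γ(X, V)),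
      ∑ i, c i • res M h (e i) = 0 → ∀ i, c i = 0)
    (span : ∀ (V : X.Opens) (h : V ≤ U) (m : Γ(M, V)), ∀ x ∈ V, ∃ (W : X.Opens) (h' : W ≤ V),
      x ∈ W ∧ ∃ c : ι → Γ(X, W), res M h' m = ∑ i, c i • res M (h'.trans h) (e i)) :
    IsBasisOn M U e := by
  refine ⟨indep, fun V h m => ?_⟩
  have hres : ∀ (W W' : X.Opens) (hW : W ≤ V) (hW' : W' ≤ W) (c : ι → Γ(X, W)),
      res M hW m = ∑ i, c i • res M (hW.trans h) (e i) →
      res M (hW'.trans hW) m = ∑ i, resFun hW' (c i) • res M ((hW'.trans hW).trans h) (e i) := by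
    intro W W' hW hW' c hc
    rw [← res_res M hW hW', hc, res_sum]
    exact Finset.sum_congr rfl fun i _ => by rw [res_smul, res_res]
  have uniq : ∀ (W : X.Opens) (hW : W ≤ V) (c c' : ι → Γ(X, W)),
      res M hW m = ∑ i, c i • res M (hW.trans h) (e i) →
      res M hW m = ∑ i, c' i • res M (hW.trans h) (e i) → c = c' := by
    intro W hW c c' hc hc'
    funext i
    refine sub_eq_zero.mp (indep W (hW.trans h) (fun i => c i - c' i) ?_ i)
    simp only [sub_smul, Finset.sum_sub_distrib]
    rw [← hc, ← hc', sub_self]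
  choose! O hO hx c hc using span V h m
  have key : ∀ i, ∃ s : Γ(X, V), ∀ x : V, resFun (hO x.1 x.2) s = c x.1 i := fun i =>
    exists_glue (M := structureModule X) (fun x : V => O x.1) (fun x => hO x.1 x.2)
      (fun x hxV => ⟨⟨x, hxV⟩, hx x hxV⟩) (fun x => c x.1 i) (fun x y => by
        have h1 := hres (O x.1) (O x.1 ⊓ O y.1) (hO x.1 x.2) inf_le_left _ (hc x.1 x.2)
        have h2 := hres (O y.1) (O x.1 ⊓ O y.1) (hO y.1 y.2) inf_le_right _ (hc y.1 y.2)
        exact congrFun (uniq _ (inf_le_left.trans (hO x.1 x.2)) _ _ h1 h2) i)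
  choose s hs using key
  refine ⟨s, eq_of_locally_eq fun x hxV => ⟨O x, hO x hxV, hx x hxV, ?_⟩⟩
  rw [hc x hxV, res_sum]
  exact Finset.sum_congr rfl fun i _ => by rw [res_smul, res_res, hs i ⟨x, hxV⟩]

theorem IsBasisOn.ext {e : ι → Γ(M, U)} (he : IsBasisOn M U e) (h : V ≤ U) {c c' : ι → Γ(X, V)}
    (H : ∑ i, c i • res M h (e i) = ∑ i, c' i • res M h (e i)) : c = c' := by
  funext i
  refine sub_eq_zero.mp (he.indep V h (fun i => c i - c' i) ?_ i)
  simp only [sub_smul, Finset.sum_sub_distrib]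
  rw [H, sub_self]

/-- The coordinates of a section in a basis. -/
def IsBasisOn.coord {e : ι → Γ(M, U)} (he : IsBasisOn M U e) (i : ι) :
    homOn M.val (structureModule X) U :=
  mkHomOn (N := structureModule X) (fun V h =>
    { toFun := fun m => (he.span V h m).choose i
      map_add' := fun m m' => by
        refine congrFun (he.ext h (c' := fun i => _ + _) ?_) i
        simp only [add_smul, Finset.sum_add_distrib]
        rw [← (he.span V h m).choose_spec, ← (he.span V h m').choose_spec,
          ← (he.span V h _).choose_spec]
      map_smul' := fun r m => by
        refine congrFun (he.ext h (c' := fun i => r * (he.span V h m).choose i) ?_) i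
        simp only [mul_smul]
        rw [← Finset.smul_sum, ← (he.span V h m).choose_spec, ← (he.span V h _).choose_spec] })
    (fun {V W} h h' m => by
      refine congrFun (he.ext (h'.trans h)
        (c := fun i => resFun h' ((he.span V h m).choose i)) ?_) i
      refine Eq.trans ?_ (he.span W (h'.trans h) (res M h' m)).choose_spec
      conv_rhs => rw [(he.span V h m).choose_spec, res_sum]
      exact Finset.sum_congr rfl fun i _ => by rw [res_smul, res_res])

theorem IsBasisOn.eq_sum {e : ι → Γ(M, U)} (he : IsBasisOn M U e) (h : V ≤ U) (m : Γ(M, V)) :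
    m = ∑ i, (apFun (he.coord i) h m) • res M h (e i) :=
  (he.span V h m).choose_spec

theorem IsBasisOn.coord_sum {e : ι → Γ(M, U)} (he : IsBasisOn M U e) (h : V ≤ U)
    (c : ι → Γ(X, V)) (i : ι) :
    (apFun (he.coord i) h (∑ j, c j • res M h (e j))) = c i :=
  congrFun (he.ext h (c := fun i => (apFun (he.coord i) h _))
    (he.eq_sum h _).symm) i

/-- A morphism `f^♯ ∘ φ` to the pushforward of the structure sheaf. -/
def homOnComap (f : X ⟶ Y) {M : Y.Modules} {U : Y.Opens}
    (φ : homOn M.val (structureModule Y) U) :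
    homOn M.val ((Scheme.Modules.pushforward f).obj (structureModule X)) U :=
  mkHomOn (N := (Scheme.Modules.pushforward f).obj (structureModule X)) (fun V h =>
    { toFun := fun m => (f.app V).hom (apFun φ h m)
      map_add' := fun m m' => by rw [map_add]; exact map_add (f.app V).hom _ _
      map_smul' := fun r m => by
        rw [map_smul]
        exact map_mul (f.app V).hom r (apFun φ h m) })
    (fun {V W} h h' m => by
      refine (ConcreteCategory.congr_hom (f.naturality (homOfLE h').op)
        (apFun φ h m)).symm.trans ?_
      exact congrArg (f.app W).hom (resFun_apFun φ h h' m))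

/-- A linear functional on `M|_U` induces a linear functional on `(f^*M)|_{f⁻¹U}`. -/
theorem exists_functional_pullback (f : X ⟶ Y) {M : Y.Modules} {U : Y.Opens}
    (φ : homOn M.val (structureModule Y) U) :
    ∃ ψ : homOn ((Scheme.Modules.pullback f).obj M).val (structureModule X) (f ⁻¹ᵁ U),
      ∀ (W : Y.Opens) (hW : W ≤ U) (V : X.Opens) (h : V ≤ f ⁻¹ᵁ W) (m : Γ(M, W)),
      (apFun ψ (h.trans (f.preimage_mono hW)) (pullbackSection f M h m)) =
        f.appLE W V h (apFun φ hW m) :=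
  exists_homOn_pullback f (homOnComap f φ)

/-- The pullback of a basis is a basis. -/
theorem IsBasisOn.pullback (f : X ⟶ Y) {M : Y.Modules} {U : Y.Opens} {e : ι → Γ(M, U)}
    (he : IsBasisOn M U e) :
    IsBasisOn ((Scheme.Modules.pullback f).obj M) (f ⁻¹ᵁ U)
      (fun i => pullbackSection f M le_rfl (e i)) := by
  -- The pulled back coordinate functionals ψ_i satisfy ψ_i(f^*e_j) = δ_{ij}, which gives
  -- independence. The endomorphism `s`, m ↦ ∑ ψ_i(m) f^*e_i, agrees with the identity `t` on
  -- sections pulled back from Y, hence everywhere, which gives spanning.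
  choose ψ hψ using fun i => exists_functional_pullback f (he.coord i)
  let s : homOn ((Scheme.Modules.pullback f).obj M).val ((Scheme.Modules.pullback f).obj M)
      (f ⁻¹ᵁ U) := mkHomOn (fun V h =>
    { toFun := fun m => ∑ i, (apFun (ψ i) h m) •
        res ((Scheme.Modules.pullback f).obj M) h (pullbackSection f M le_rfl (e i))
      map_add' := fun m m' => by
        rw [← Finset.sum_add_distrib]
        refine Finset.sum_congr rfl fun i _ => ?_
        rw [map_add]; exact add_smul _ _ _
      map_smul' := fun r m => by
        rw [RingHom.id_apply, Finset.smul_sum]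
        refine Finset.sum_congr rfl fun i _ => ?_
        rw [map_smul]; exact mul_smul _ _ _ })
    (fun {V W} h h' m => by
      refine (res_sum _ _ _ _).trans (Finset.sum_congr rfl fun i _ => ?_)
      rw [res_smul, res_res]
      exact congrArg (fun c : Γ(X, W) => c • res ((Scheme.Modules.pullback f).obj M) (h'.trans h)
        (pullbackSection f M le_rfl (e i))) (resFun_apFun (ψ i) h h' m))
  let t : homOn ((Scheme.Modules.pullback f).obj M).val ((Scheme.Modules.pullback f).obj M)
      (f ⁻¹ᵁ U) := mkHomOn (fun V h => LinearMap.id) (fun h h' m => rfl)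
  have hst : ∀ (V : X.Opens) (h : V ≤ f ⁻¹ᵁ U) m, ap s h m = ap t h m := fun V h m =>
    homOn_pullback_ext (fun W hW m => by
      change ∑ i, (apFun (ψ i) _ (pullbackSection f M le_rfl m)) • _ = 
        pullbackSection f M le_rfl m
      conv_rhs => rw [he.eq_sum hW m]
      have hsum : ∀ (c : ι → Γ(M, W)), pullbackSection f M (le_refl (f ⁻¹ᵁ W)) (∑ i, c i) =
          ∑ i, pullbackSection f M le_rfl (c i) := fun c =>
        map_sum (AddMonoidHom.mk' (pullbackSection f M (le_refl (f ⁻¹ᵁ W)))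
          (pullbackSection_add f _)) c _
      rw [hsum]
      refine Finset.sum_congr rfl fun i _ => ?_
      rw [hψ i W hW _ le_rfl m, pullbackSection_smul, pullbackSection_res, res_pullbackSection]) h m
  classical
  have hψe : ∀ (V : X.Opens) (h : V ≤ f ⁻¹ᵁ U) (i j : ι), (apFun (ψ i) h
      (res ((Scheme.Modules.pullback f).obj M) h (pullbackSection f M le_rfl (e j)))) =
      (if j = i then 1 else 0 : Γ(X, V)) := by
    intro V h i j
    rw [res_pullbackSection]
    rw [hψ i U le_rfl V h (e j)]
    have : e j = ∑ k, (if k = j then (1 : Γ(Y, U)) else 0) • res M le_rfl (e k) := by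
      simp [ite_smul, res_self]
    have h2 := he.coord_sum le_rfl (fun k => if k = j then (1 : Γ(Y, U)) else 0) i
    rw [← this] at h2
    rw [h2]
    by_cases hij : j = i
    · rw [if_pos hij.symm, if_pos hij, map_one]
    · rw [if_neg (Ne.symm hij), if_neg hij, map_zero]
  refine ⟨fun V h c hc i => ?_, fun V h m => ⟨fun i => apFun (ψ i) h m, ?_⟩⟩
  · have h1 := congrArg (apFun (ψ i) h) hc
    rw [map_sum, map_zero] at h1
    rw [← h1]
    simp only [map_smul, hψe, smul_eq_mul, mul_ite, mul_one, mul_zero, Finset.sum_ite_eq',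
      Finset.mem_univ, if_true]
  · exact (hst V h m).symm

end Basis

/-! ### Tensor products with an invertible factor -/

section Tensor

variable {X Y : Scheme.{u}} {M N : X.Modules} {U V W : X.Opens}

/-- The presheaf tensor product `V ↦ M(V) ⊗ N(V)`. -/
def presheafTensor (M N : X.Modules) : X.PresheafOfModules :=
  PresheafOfModules.Monoidal.tensorObj (R := X.presheaf) M.val N.val

/-- The canonical map from the presheaf tensor product to the tensor product. -/
def toTensor (M N : X.Modules) (V : X.Opens) :
    TensorProduct Γ(X, V) Γ(M, V) Γ(N, V) →ₗ[Γ(X, V)] Γ(tensor M N, V) :=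
  (((PresheafOfModules.sheafificationAdjunction (𝟙 X.ringCatSheaf.obj)).unit.app
    (presheafTensor M N)).app (op V)).hom

theorem res_toTensor_tmul (h : W ≤ V) (m : Γ(M, V)) (n : Γ(N, V)) :
    res (tensor M N) h (toTensor M N V (m ⊗ₜ n)) = toTensor M N W (res M h m ⊗ₜ res N h n) :=
  (PresheafOfModules.naturality_apply
    ((PresheafOfModules.sheafificationAdjunction (𝟙 X.ringCatSheaf.obj)).unit.app
    (presheafTensor M N)) (homOfLE h).op (show TensorProduct Γ(X, V) Γ(M, V) Γ(N, V) from m ⊗ₜ n)).symm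

/-- The map from a presheaf to its sheafification is locally surjective;
`toTensor_locally_injective` is the companion statement. -/
theorem exists_toTensor (t : Γ(tensor M N, V)) (x : X) (hx : x ∈ V) :
    ∃ (W : X.Opens) (h : W ≤ V), x ∈ W ∧ ∃ s, toTensor M N W s = res (tensor M N) h t := by
  have h := CategoryTheory.Presheaf.imageSieve_mem (Opens.grothendieckTopology X)
    (CategoryTheory.toSheafify (Opens.grothendieckTopology X) (presheafTensor M N).presheaf) t
  obtain ⟨W, i, hi, hxW⟩ := h x hx
  obtain ⟨s, hs⟩ := hi
  exact ⟨W, i.le, hxW, s, hs⟩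

theorem toTensor_locally_injective (s s' : TensorProduct Γ(X, V) Γ(M, V) Γ(N, V))
    (hs : toTensor M N V s = toTensor M N V s') (x : X) (hx : x ∈ V) :
    ∃ (W : X.Opens) (h : W ≤ V), x ∈ W ∧
      (presheafTensor M N).presheaf.map (homOfLE h).op s =
      (presheafTensor M N).presheaf.map (homOfLE h).op s' := by
  have h := CategoryTheory.Presheaf.equalizerSieve_mem (Opens.grothendieckTopology X)
    (CategoryTheory.toSheafify (Opens.grothendieckTopology X) (presheafTensor M N).presheaf) s s' hs
  obtain ⟨W, i, hi, hxW⟩ := h x hx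
  exact ⟨W, i.le, hxW, hi⟩

/-- Tensoring with a generator `w` of a free module of rank one. -/
def tensorGen (M : X.Modules) {N : X.Modules} (w : Γ(N, U)) (h : V ≤ U) :
    Γ(M, V) →ₗ[Γ(X, V)] Γ(tensor M N, V) :=
  toTensor M N V ∘ₗ (TensorProduct.mk Γ(X, V) Γ(M, V) Γ(N, V)).flip (res N h w)

theorem res_tensorGen (w : Γ(N, U)) (h : V ≤ U) (h' : W ≤ V) (m : Γ(M, V)) :
    res (tensor M N) h' (tensorGen M w h m) = tensorGen M w (h'.trans h) (res M h' m) := by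
  refine (res_toTensor_tmul h' m _).trans ?_
  rw [res_res]; rfl

theorem IsBasisOn.exists_tmul {w : Γ(N, U)} (hw : IsBasisOn N U fun _ : Unit => w) (h : V ≤ U)
    (s : TensorProduct Γ(X, V) Γ(M, V) Γ(N, V)) : ∃ m : Γ(M, V), s = m ⊗ₜ res N h w := by
  induction s using TensorProduct.induction_on with
  | zero => exact ⟨0, (TensorProduct.zero_tmul _ _).symm⟩
  | tmul m n =>
    obtain ⟨c, hc⟩ := hw.span V h n
    refine ⟨c () • m, ?_⟩
    rw [hc, Finset.univ_unique, Finset.sum_singleton, TensorProduct.tmul_smul,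
      TensorProduct.smul_tmul']
  | add s s' hs hs' =>
    obtain ⟨m, rfl⟩ := hs
    obtain ⟨m', rfl⟩ := hs'
    exact ⟨m + m', (TensorProduct.add_tmul _ _ _).symm⟩

theorem IsBasisOn.tmul_injective {w : Γ(N, U)} (hw : IsBasisOn N U fun _ : Unit => w) (h : V ≤ U)
    {m m' : Γ(M, V)} (hm : (m ⊗ₜ res N h w : TensorProduct Γ(X, V) Γ(M, V) Γ(N, V)) =
      m' ⊗ₜ res N h w) : m = m' := by
  have e : apFun (hw.coord ()) h (res N h w) = 1 := by
    have := hw.coord_sum h (fun _ => 1) ()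
    rwa [Finset.univ_unique, Finset.sum_singleton, one_smul] at this
  have := congrArg (TensorProduct.rid Γ(X, V) Γ(M, V) ∘
    LinearMap.lTensor Γ(M, V) (apFun (hw.coord ()) h)) hm
  simpa [e] using this

/-- Together with `IsBasisOn.tensorGen_injective`, this identifies M with M ⊗ N over `U` by m ↦ m ⊗
w. Sections of 𝒯_E ⊗ 𝒪_E(E) can then be treated as vector fields on E. -/
theorem IsBasisOn.exists_tensorGen {w : Γ(N, U)} (hw : IsBasisOn N U fun _ : Unit => w)
    (h : V ≤ U) (t : Γ(tensor M N, V)) (x : X) (hx : x ∈ V) :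
    ∃ (W : X.Opens) (h' : W ≤ V), x ∈ W ∧ ∃ m : Γ(M, W),
      tensorGen M w (h'.trans h) m = res (tensor M N) h' t := by
  obtain ⟨W, h', hxW, s, hs⟩ := exists_toTensor t x hx
  obtain ⟨m, rfl⟩ := hw.exists_tmul (h'.trans h) s
  exact ⟨W, h', hxW, m, hs⟩

theorem IsBasisOn.tensorGen_injective {w : Γ(N, U)} (hw : IsBasisOn N U fun _ : Unit => w)
    (h : V ≤ U) {m m' : Γ(M, V)} (hm : tensorGen M w h m = tensorGen M w h m') : m = m' := by
  refine eq_of_locally_eq fun x hx => ?_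
  obtain ⟨W, h', hxW, e⟩ := toTensor_locally_injective _ _ hm x hx
  refine ⟨W, h', hxW, hw.tmul_injective (h'.trans h) ?_⟩
  have e1 : ∀ m : Γ(M, V), (presheafTensor M N).presheaf.map (homOfLE h').op (m ⊗ₜ[Γ(X, V)] res N h w) =
    (res M h' m ⊗ₜ[Γ(X, W)] res N (h'.trans h) w) := fun m => by
    rw [← res_res N h h']; rfl
  exact (e1 m).symm.trans (Eq.trans e (e1 m'))

end Tensor

/-! ### Derivations along ring homomorphisms -/

section Derivations

variable {k A B C : Type*} [CommRing k] [CommRing A] [CommRing B] [CommRing C]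

/-- `D : A → B` is a derivation along the ring homomorphism `f`, trivial on the constants `φ(k)`. -/
structure IsDer (φ : k →+* A) (f : A →+* B) (D : A → B) : Prop where
  add : ∀ a b, D (a + b) = D a + D b
  mul : ∀ a b, D (a * b) = f a * D b + f b * D a
  const : ∀ c, D (φ c) = 0

namespace IsDer

variable {φ : k →+* A} {f : A →+* B} {D D' : A → B}

theorem zero (h : IsDer φ f D) : D 0 = 0 := by simpa using h.add 0 0

theorem one (h : IsDer φ f D) : D 1 = 0 := by rw [← map_one φ, h.const]

theorem neg (h : IsDer φ f D) (a : A) : D (-a) = - D a := by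
  rw [eq_neg_iff_add_eq_zero, ← h.add, neg_add_cancel, h.zero]

theorem sub (h : IsDer φ f D) (a b : A) : D (a - b) = D a - D b := by
  rw [sub_eq_add_neg, h.add, h.neg, sub_eq_add_neg]

theorem postcomp (h : IsDer φ f D) (g : B →+* C) : IsDer φ (g.comp f) (g ∘ D) where
  add a b := by simp [h.add]
  mul a b := by simp [h.mul]
  const c := by simp [h.const]

theorem precomp {ψ : k →+* C} (h : IsDer φ f D) (g : C →+* A) (hg : ∀ c, g (ψ c) = φ c) :
    IsDer ψ (f.comp g) (D ∘ g) where
  add a b := by simp [h.add]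
  mul a b := by simp [h.mul]
  const c := by simp [hg, h.const]

theorem of_sub (h : IsDer φ f D) (h' : IsDer φ f D') : IsDer φ f fun a => D a - D' a where
  add a b := by rw [h.add, h'.add]; ring
  mul a b := by rw [h.mul, h'.mul]; ring
  const c := by rw [h.const, h'.const, sub_zero]

theorem smul (h : IsDer φ f D) (b : B) : IsDer φ f fun a => b * D a where
  add a a' := by rw [h.add]; ring
  mul a a' := by rw [h.mul]; ring
  const c := by rw [h.const, mul_zero]

theorem of_sum {ι : Type*} (s : Finset ι) {D : ι → A → B} (h : ∀ i ∈ s, IsDer φ f (D i)) :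
    IsDer φ f fun a => ∑ i ∈ s, D i a where
  add a b := by
    rw [← Finset.sum_add_distrib]; exact Finset.sum_congr rfl fun i hi => (h i hi).add a b
  mul a b := by
    rw [Finset.mul_sum, Finset.mul_sum, ← Finset.sum_add_distrib]
    exact Finset.sum_congr rfl fun i hi => (h i hi).mul a b
  const c := Finset.sum_eq_zero fun i hi => (h i hi).const c

/-- The ring homomorphism `a ↦ f a + D a ε` to the dual numbers. -/
def toDual (h : IsDer φ f D) : A →+* DualNumber B where
  toFun a := TrivSqZeroExt.inl (f a) + TrivSqZeroExt.inr (D a)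
  map_one' := by ext <;> simp [h.one]
  map_zero' := by ext <;> simp [h.zero]
  map_add' a b := by ext <;> simp [h.add]
  map_mul' a b := by ext <;> simp [h.mul, mul_comm]

theorem fst_toDual (h : IsDer φ f D) (a : A) : (h.toDual a).fst = f a := by simp [toDual]
theorem snd_toDual (h : IsDer φ f D) (a : A) : (h.toDual a).snd = D a := by simp [toDual]

theorem of_dual (g : A →+* DualNumber B) (hφ : ∀ c, (g (φ c)).snd = 0)
    (hf : ∀ a, (g a).fst = f a) : IsDer φ f fun a => (g a).snd where
  add a b := by simp
  mul a b := by simp [hf, mul_comm]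
  const := hφ

/-- Derivations extend to localizations. -/
theorem exists_localization [Algebra C A] (M : Submonoid C) [IsLocalization M A]
    {ψ : k →+* C} (hψ : ∀ c, algebraMap C A (ψ c) = φ c) {D : C → B}
    (h : IsDer ψ (f.comp (algebraMap C A)) D) :
    ∃ D' : A → B, IsDer φ f D' ∧ ∀ c, D' (algebraMap C A c) = D c := by
  -- A dual number is a unit once its first component is, so the ring homomorphism `h.toDual`
  -- extends to the localization.
  have hu : ∀ y : M, IsUnit (h.toDual y) := fun y => by
    rw [TrivSqZeroExt.isUnit_iff_isUnit_fst, h.fst_toDual]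
    exact (IsLocalization.map_units A y).map f
  let g := IsLocalization.lift hu (S := A)
  have hg : ∀ c, g (algebraMap C A c) = h.toDual c := fun c => IsLocalization.lift_eq hu c
  refine ⟨_, of_dual g (fun c => ?_) (fun a => ?_), fun c => by rw [hg, h.snd_toDual]⟩
  · rw [← hψ, hg, h.snd_toDual, h.const]
  · have : ((TrivSqZeroExt.fstHom B B B : DualNumber B →ₐ[B] B) : DualNumber B →+* B).comp g = f :=
      IsLocalization.ringHom_ext M (by
        ext c
        simp only [RingHom.comp_apply, hg]
        exact h.fst_toDual c)
    exact congrArg (fun r : A →+* B => r a) this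

/-- The ring homomorphisms to the dual numbers attached to D and D' agree on the generators, hence
on the subring. -/
theorem ext_closure (h : IsDer φ f D) (h' : IsDer φ f D') {s : Set A}
    (hs : ∀ a ∈ s, D a = D' a) {a : A} (ha : a ∈ Subring.closure s) : D a = D' a := by
  have : Set.EqOn h.toDual h'.toDual (Subring.closure s) :=
    RingHom.eqOn_set_closure fun a ha => by
    ext
    · rw [h.fst_toDual, h'.fst_toDual]
    · rw [h.snd_toDual, h'.snd_toDual, hs a ha]
  rw [← h.snd_toDual, this ha, h'.snd_toDual]

theorem ext_localization [Algebra C A] (M : Submonoid C) [IsLocalization M A]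
    (h : IsDer φ f D) (h' : IsDer φ f D')
    (H : ∀ c, D (algebraMap C A c) = D' (algebraMap C A c)) (a : A) : D a = D' a := by
  have : h.toDual = h'.toDual := IsLocalization.ringHom_ext M (by
    ext c
    · simp only [RingHom.comp_apply, h.fst_toDual, h'.fst_toDual]
    · simp only [RingHom.comp_apply, h.snd_toDual, h'.snd_toDual, H])
  rw [← h.snd_toDual, this, h'.snd_toDual]

/-- A derivation along `f` descends along a surjection whose kernel it preserves. -/
theorem exists_descend {A' B' : Type*} [CommRing A'] [CommRing B'] (h : IsDer φ f D)
    (q : A →+* A') (hq : Function.Surjective q) (r : B →+* B') {f' : A' →+* B'}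
    (hf : ∀ a, f' (q a) = r (f a)) (hk : ∀ a, q a = 0 → r (D a) = 0) :
    ∃ D' : A' → B', IsDer (q.comp φ) f' D' ∧ ∀ a, D' (q a) = r (D a) := by
  have e : ∀ a, r (D (Function.surjInv hq (q a))) = r (D a) := fun a => by
    rw [← sub_eq_zero, ← map_sub, ← h.sub]
    exact hk _ (by rw [map_sub, Function.surjInv_eq hq, sub_self])
  refine ⟨fun a' => r (D (Function.surjInv hq a')), ⟨fun a b => ?_, fun a b => ?_, fun c => ?_⟩, e⟩
  · obtain ⟨a, rfl⟩ := hq a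
    obtain ⟨b, rfl⟩ := hq b
    rw [← map_add, e, e, e, h.add, map_add]
  · obtain ⟨a, rfl⟩ := hq a
    obtain ⟨b, rfl⟩ := hq b
    rw [← map_mul, e, e, e, h.mul, map_add, map_mul, map_mul, hf, hf]
  · rw [RingHom.comp_apply, e, h.const, map_zero]

end IsDer

/-- `x₁, …, xₙ` are coordinates on `A` over `k`, with dual derivations `∂₁, …, ∂ₙ`: every derivation
is determined by its values on the `xᵢ`. -/
structure IsCoordinates {k A : Type u} [CommRing k] [CommRing A] {n : ℕ} (φ : k →+* A)
    (x : Fin n → A) (δ : Fin n → A → A) : Prop where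
  der : ∀ i, IsDer φ (RingHom.id A) (δ i)
  dual : ∀ i j, δ i (x j) = if i = j then 1 else 0
  ext : ∀ (B : Type u) [CommRing B] (f : A →+* B) (D : A → B), IsDer φ f D →
    (∀ i, D (x i) = 0) → ∀ a, D a = 0

namespace IsCoordinates

variable {k A B A' : Type u} [CommRing k] [CommRing A] [CommRing B] [CommRing A'] {n : ℕ}
  {φ : k →+* A} {x : Fin n → A} {δ : Fin n → A → A}

/-- Both sides are derivations along `f` with the same values on the coordinates. -/
theorem eq_sum (h : IsCoordinates φ x δ) {f : A →+* B} {D : A → B} (hD : IsDer φ f D) (a : A) :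
    D a = ∑ i, D (x i) * f (δ i a) := by
  refine sub_eq_zero.mp (h.ext B f (fun a => D a - ∑ i, D (x i) * f (δ i a))
    (hD.of_sub (IsDer.of_sum _ fun i _ => ((h.der i).postcomp f).smul _)) (fun j => ?_) a)
  simp [h.dual]

theorem isDer_sum (h : IsCoordinates φ x δ) (f : A →+* B) (b : Fin n → B) :
    IsDer φ f fun a => ∑ i, b i * f (δ i a) :=
  IsDer.of_sum _ fun i _ => ((h.der i).postcomp f).smul _

theorem sum_apply (h : IsCoordinates φ x δ) (f : A →+* B) (b : Fin n → B) (j : Fin n) :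
    ∑ i, b i * f (δ i (x j)) = b j := by
  simp [h.dual]

theorem localization (h : IsCoordinates φ x δ) [Algebra A A'] (M : Submonoid A)
    [IsLocalization M A'] :
    ∃ δ', IsCoordinates ((algebraMap A A').comp φ) (fun i => algebraMap A A' (x i)) δ' := by
  choose δ' hδ' e using fun i => IsDer.exists_localization (f := RingHom.id A') M
    (φ := (algebraMap A A').comp φ) (ψ := φ) (fun c => rfl) ((h.der i).postcomp (algebraMap A A'))
  refine ⟨δ', hδ', fun i j => ?_, fun B _ f D hD hx a => ?_⟩
  · rw [e, Function.comp_apply, h.dual]; split <;> simp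
  · exact hD.ext_localization M (D' := fun _ => 0) ⟨by simp, by simp, by simp⟩
      (fun c => h.ext B (f.comp (algebraMap A A')) (D ∘ algebraMap A A')
        (hD.precomp _ fun c => rfl) hx c) a

end IsCoordinates

/-- A derivation `A → C` extends along `A → B` to a derivation `B → C` with prescribed values on
generators `y_j = z_j / z` of `B`, provided these values satisfy the quotient rule. -/
theorem IsDer.exists_extend {J : Type*} {φ : k →+* A} {f : A →+* B} {g : B →+* C} {D : A → C}
    (hD : IsDer φ (g.comp f) D) (hf : Function.Injective f) (z : A) (zs : J → A) (y : J → B)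
    (hy : ∀ j, f z * y j = f (zs j)) (hgen : Subring.closure (Set.range f ∪ Set.range y) = ⊤)
    (hpow : ∀ b, ∃ N a, f z ^ N * b = f a) (hz : g (f z) ∈ nonZeroDivisors C) (m : J → C)
    (hm : ∀ j, g (f z) * m j = D (zs j) - g (y j) * D z) :
    ∃ D' : B → C, IsDer (f.comp φ) g D' ∧ (∀ a, D' (f a) = D a) ∧ ∀ j, D' (y j) = m j := by
  let _ := f.toAlgebra
  let L := Localization.Away (f z)
  let L' := Localization.Away (g (f z))
  have hAL : ∀ a, algebraMap A L a = algebraMap B L (f a) := fun a =>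
    IsScalarTower.algebraMap_apply A B L a
  -- By `hpow` the rings A and B become equal after inverting z, so D extends to a derivation E from
  -- this common localization to C[1/z]. It remains to see that E maps B into C, which is a subring
  -- of C[1/z] as z is regular there.
  have : IsLocalization.Away z L := by
    have hz' : IsUnit (algebraMap B L (f z)) := IsLocalization.Away.algebraMap_isUnit (f z)
    refine (isLocalization_iff _ _).mpr ⟨?_, fun l => ?_, fun {a a'} e => ?_⟩
    · rintro ⟨_, N, rfl⟩
      rw [hAL, map_pow, map_pow]
      exact hz'.pow N
    · obtain ⟨⟨b, ⟨_, N, rfl⟩⟩, hb⟩ := IsLocalization.surj (Submonoid.powers (f z)) l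
      obtain ⟨N', a, ha⟩ := hpow b
      refine ⟨⟨a, ⟨z ^ (N + N'), N + N', rfl⟩⟩, ?_⟩
      simp only [map_pow] at hb
      simp only [hAL, map_pow]
      rw [pow_add, ← mul_assoc, hb, ← ha, map_mul, map_pow, mul_comm]
    · rw [hAL, hAL] at e
      obtain ⟨⟨_, N, rfl⟩, hc⟩ := IsLocalization.exists_of_eq (M := Submonoid.powers (f z)) e
      refine ⟨⟨z ^ N, N, rfl⟩, hf ?_⟩
      simpa using hc
  let ι := algebraMap C L'
  have hι : Function.Injective ι := IsLocalization.injective L' ((Submonoid.powers_le (P := nonZeroDivisors C)).mpr hz)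
  let G : L →+* L' := IsLocalization.Away.lift (S := L) (g := ι.comp g) (f z)
    (IsLocalization.Away.algebraMap_isUnit (g (f z)))
  have hG : ∀ b, G (algebraMap B L b) = ι (g b) := fun b => IsLocalization.Away.lift_eq _ _ b
  obtain ⟨E, hE, hEA⟩ := IsDer.exists_localization (f := G) (Submonoid.powers z)
    (φ := (algebraMap A L).comp φ) (ψ := φ) (fun _ => rfl) (D := ι ∘ D) (by
      have := hD.postcomp ι
      convert this using 1
      ext a
      exact (congrArg G (hAL a)).trans (hG (f a)))
  have hEB : IsDer (f.comp φ) (ι.comp g) (E ∘ algebraMap B L) := by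
    have := hE.precomp (ψ := f.comp φ) (algebraMap B L) (fun c => (hAL (φ c)).symm)
    convert this using 1
    ext b; exact (hG b).symm
  have hEf : ∀ a, E (algebraMap B L (f a)) = ι (D a) := fun a => by rw [← hAL]; exact hEA a
  -- Applying E to z y_j = z_j gives z E(y_j) = D(z_j) - y_j D(z), which is z m_j by `hm`; then z is
  -- cancelled.
  have hEy : ∀ j, E (algebraMap B L (y j)) = ι (m j) := fun j => by
    have h1 := hEB.mul (f z) (y j)
    rw [hy] at h1
    simp only [Function.comp_apply, RingHom.comp_apply, hEf] at h1
    have h2 : IsUnit (ι (g (f z))) := IsLocalization.Away.algebraMap_isUnit _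
    refine h2.mul_left_cancel ?_
    rw [← map_mul, hm, map_sub, map_mul, h1]
    ring
  -- By the Leibniz rule the elements of B which E maps into C form a subring, and it contains the
  -- generators.
  have hrange : ∀ b, ∃ c, E (algebraMap B L b) = ι c := fun b => by
    have hb : b ∈ Subring.closure (Set.range f ∪ Set.range y) := hgen ▸ trivial
    induction hb using Subring.closure_induction with
    | mem b hb =>
      obtain ⟨a, rfl⟩ | ⟨j, rfl⟩ := hb
      exacts [⟨_, hEf a⟩, ⟨_, hEy j⟩]
    | zero => exact ⟨0, by rw [map_zero, map_zero, hE.zero]⟩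
    | one => exact ⟨0, by rw [map_one, map_zero, hE.one]⟩
    | add a b _ _ ha hb =>
      obtain ⟨c, hc⟩ := ha
      obtain ⟨d, hd⟩ := hb
      exact ⟨c + d, by rw [map_add, hE.add, hc, hd, map_add]⟩
    | neg a _ ha =>
      obtain ⟨c, hc⟩ := ha
      exact ⟨-c, by rw [map_neg, hE.neg, hc, map_neg]⟩
    | mul a b _ _ ha hb =>
      obtain ⟨c, hc⟩ := ha
      obtain ⟨d, hd⟩ := hb
      refine ⟨g a * d + g b * c, (hEB.mul a b).trans ?_⟩
      simp only [Function.comp_apply, RingHom.comp_apply, hc, hd, map_add, map_mul]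
  choose D' hD' using hrange
  refine ⟨D', ⟨fun a b => hι ?_, fun a b => hι ?_, fun c => hι ?_⟩, fun a => hι ?_, fun j => hι ?_⟩
  · rw [map_add, ← hD', ← hD', ← hD', map_add, hE.add]
  · rw [map_add, map_mul, map_mul, ← hD', ← hD', ← hD']; exact hEB.mul a b
  · rw [← hD', map_zero]; exact hEB.const c
  · rw [← hD']; exact hEf a
  · rw [← hD', hEy]

end Derivations

/-! ### Vector fields as compatible families of derivations -/

section Tangent

variable {X Y : Scheme.{u}} {k : CommRingCat.{u}} (s : X ⟶ Spec k) {U V W : X.Opens}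

/-- The constants in the functions on `V`. -/
def consts (V : X.Opens) : k →+* Γ(X, V) := ((constToStructure s).app (op V)).hom

theorem resFun_consts (h : W ≤ V) (c : k) : resFun h (consts s V c) = consts s W c :=
  (ConcreteCategory.congr_hom ((constToStructure s).naturality (homOfLE h).op) c).symm

variable {s}

theorem derive_res (h : W ≤ V) (D : Γ(tangentSheaf s, V)) (g : Γ(X, V)) :
    derive (res _ h D) (resFun h g) = resFun h (derive D g) := by
  have h1 := D.2 ⟨V, le_rfl⟩ ⟨W, h⟩ (homOfLE h)
    (CommRingCat.KaehlerDifferential.d (f := (constToStructure s).app (op V)) g)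
  have h2 := PresheafOfModules.DifferentialsConstruction.relativeDifferentials'_map_d
    (constToStructure s) (homOfLE h).op g
  refine Eq.trans ?_ h1.symm
  exact congrArg (D.1 ⟨W, h⟩) h2.symm

theorem isDer_derive (D : Γ(tangentSheaf s, V)) :
    IsDer (consts s V) (RingHom.id Γ(X, V)) (derive D) where
  add a b := (congrArg (D.1 ⟨V, le_rfl⟩) (ModuleCat.Derivation.d_add _ a b)).trans (map_add _ _ _)
  mul a b := (congrArg (D.1 ⟨V, le_rfl⟩) (ModuleCat.Derivation.d_mul _ a b)).trans
    ((map_add _ _ _).trans (congrArg₂ (· + ·) ((D.1 ⟨V, le_rfl⟩).map_smul a _)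
      ((D.1 ⟨V, le_rfl⟩).map_smul b _)))
  const c := (congrArg (D.1 ⟨V, le_rfl⟩) (ModuleCat.Derivation.d_map _ c)).trans (map_zero _)

theorem derive_add (D D' : Γ(tangentSheaf s, V)) (g : Γ(X, V)) :
    derive (D + D') g = derive D g + derive D' g := rfl

theorem derive_zero (g : Γ(X, V)) : derive (0 : Γ(tangentSheaf s, V)) g = 0 := rfl

theorem derive_smul (r : Γ(X, V)) (D : Γ(tangentSheaf s, V)) (g : Γ(X, V)) :
    derive (r • D) g = r * derive D g := by
  have e : resFun (le_refl V) r = r := resFun_self _ r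
  exact congrArg (fun t => t * derive D g) e

theorem derive_sum {ι : Type*} (t : Finset ι) (D : ι → Γ(tangentSheaf s, V)) (g : Γ(X, V)) :
    derive (∑ i ∈ t, D i) g = ∑ i ∈ t, derive (D i) g :=
  map_sum (AddMonoidHom.mk' (fun D : Γ(tangentSheaf s, V) => derive D g)
    fun D D' => derive_add D D' g) D t

theorem tangent_ext {D D' : Γ(tangentSheaf s, V)}
    (H : ∀ (W : X.Opens) (h : W ≤ V) (g : Γ(X, W)), derive (res _ h D) g = derive (res _ h D') g) :
    D = D' := by
  apply Subtype.ext
  funext W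
  have : ModuleCat.ofHom (D.1 W) = ModuleCat.ofHom (D'.1 W) :=
    CommRingCat.KaehlerDifferential.ext (f := (constToStructure s).app (op W.1))
      (M := ModuleCat.of Γ(X, W.1) Γ(structureModule X, W.1)) fun g => H W.1 W.2 g
  exact congrArg ModuleCat.Hom.hom this

/-- Each `d W` factors through the Kähler differentials of Γ(X, W) by their universal property.
Compatibility with restriction need only be checked on exact differentials. -/
theorem exists_tangent (d : ∀ W : X.Opens, W ≤ V → Γ(X, W) → Γ(X, W))
    (hd : ∀ W h, IsDer (consts s W) (RingHom.id _) (d W h))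
    (hres : ∀ (W W' : X.Opens) (h : W ≤ V) (h' : W' ≤ W) (g : Γ(X, W)),
      resFun h' (d W h g) = d W' (h'.trans h) (resFun h' g)) :
    ∃ D : Γ(tangentSheaf s, V), ∀ W h g, derive (res _ h D) g = d W h g := by
  let der : ∀ (W : X.Opens) (h : W ≤ V),
      (ModuleCat.of Γ(X, W) Γ(structureModule X, W)).Derivation
        ((constToStructure s).app (op W)) := fun W h =>
    ModuleCat.Derivation.mk (d W h) (hd W h).add (hd W h).mul (hd W h).const
  refine ⟨⟨fun W => (der W.1 W.2).desc.hom, fun W W' i m => ?_⟩, fun W h g =>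
    ModuleCat.Derivation.desc_d (der W h) g⟩
  have key : (der W.1 W.2).desc ≫ (structureModule X).val.map i.op =
      (differentials s).map i.op ≫
        (ModuleCat.restrictScalars (X.presheaf.map i.op).hom).map (der W'.1 W'.2).desc := by
    refine CommRingCat.KaehlerDifferential.ext (f := (constToStructure s).app (op W.1)) fun g => ?_
    have h1 : (der W.1 W.2).desc (CommRingCat.KaehlerDifferential.d g) = d W.1 W.2 g :=
      ModuleCat.Derivation.desc_d (der W.1 W.2) g
    have h2 : (der W'.1 W'.2).desc (CommRingCat.KaehlerDifferential.d (resFun i.le g)) =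
        d W'.1 W'.2 (resFun i.le g) := ModuleCat.Derivation.desc_d (der W'.1 W'.2) _
    have h3 := PresheafOfModules.DifferentialsConstruction.relativeDifferentials'_map_d
      (constToStructure s) i.op g
    refine (congrArg (resFun i.le) h1).trans ?_
    refine (hres W.1 W'.1 W.2 i.le g).trans (h2.symm.trans ?_)
    exact congrArg (der W'.1 W'.2).desc h3.symm
  exact congrArg (fun φ => φ.hom m) key

theorem exists_basicOpen (hV : IsAffineOpen V) (h : W ≤ V) {x : X} (hx : x ∈ W) :
    ∃ f : Γ(X, V), X.basicOpen f ≤ W ∧ x ∈ X.basicOpen f :=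
  hV.exists_basicOpen_le ⟨x, hx⟩ (h hx)

theorem eq_of_basicOpen (hV : IsAffineOpen V) (h : W ≤ V) {a b : Γ(X, W)}
    (H : ∀ (f : Γ(X, V)) (hf : X.basicOpen f ≤ W), resFun hf a = resFun hf b) : a = b :=
  resFun_eq_of_locally_eq fun x hx => by
    obtain ⟨f, hf, hxf⟩ := exists_basicOpen hV h hx
    exact ⟨_, hf, hxf, H f hf⟩

/-- A derivation on the functions on a basic open of an affine open `V` is determined on `Γ(X, V)`. -/
theorem isDer_ext_basicOpen {B : Type*} [CommRing B] (hV : IsAffineOpen V) (f : Γ(X, V))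
    {g : Γ(X, X.basicOpen f) →+* B} {D D' : Γ(X, X.basicOpen f) → B}
    (hD : IsDer (consts s _) g D) (hD' : IsDer (consts s _) g D')
    (H : ∀ a : Γ(X, V), D (resFun (X.basicOpen_le f) a) = D' (resFun (X.basicOpen_le f) a))
    (a : Γ(X, X.basicOpen f)) : D a = D' a := by
  have := hV.isLocalization_basicOpen f
  exact hD.ext_localization (Submonoid.powers f) hD' H a

/-- A derivation on the functions on an affine open `V` extends to any basic open. -/
theorem exists_isDer_basicOpen {B : Type*} [CommRing B] (hV : IsAffineOpen V) (f : Γ(X, V))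
    {g : Γ(X, X.basicOpen f) →+* B} {D : Γ(X, V) → B}
    (hD : IsDer (consts s V) (g.comp (resFun (X.basicOpen_le f))) D) :
    ∃ D' : Γ(X, X.basicOpen f) → B, IsDer (consts s _) g D' ∧
      ∀ a : Γ(X, V), D' (resFun (X.basicOpen_le f) a) = D a := by
  have := hV.isLocalization_basicOpen f
  exact IsDer.exists_localization (Submonoid.powers f) (resFun_consts s (X.basicOpen_le f)) hD

/-- Vector fields on an open subset of an affine open `V` are determined by their values on
`Γ(X, V)`. -/
theorem tangent_ext_affine (hV : IsAffineOpen V) (h : W ≤ V) {D D' : Γ(tangentSheaf s, W)}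
    (H : ∀ g : Γ(X, V), derive D (resFun h g) = derive D' (resFun h g)) : D = D' := by
  refine tangent_ext fun W' h' g => eq_of_basicOpen hV (h'.trans h) fun f hf => ?_
  rw [← derive_res hf, ← derive_res hf, res_res, res_res]
  refine isDer_ext_basicOpen hV f (isDer_derive _) (isDer_derive _) (fun a => ?_) _
  rw [← resFun_resFun h (hf.trans h'), derive_res (hf.trans h'), derive_res (hf.trans h'), H]

/-- A derivation on the functions on an affine open defines a vector field. -/
theorem exists_tangent_affine (hV : IsAffineOpen V) {d : Γ(X, V) → Γ(X, V)}
    (hd : IsDer (consts s V) (RingHom.id _) d) :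
    ∃ D : Γ(tangentSheaf s, V), ∀ g, derive D g = d g := by
  -- Localization extends `d` to every basic open of `V`, and uniqueness of these extensions makes
  -- them compatible. On an arbitrary open W ⊆ V the derivation is then glued from the basic opens
  -- contained in W.
  choose E hE hEd using fun f : Γ(X, V) => exists_isDer_basicOpen (s := s) hV f
    (g := RingHom.id _) (hd.postcomp (resFun (X.basicOpen_le f)))
  have compat : ∀ (f f' : Γ(X, V)) (h : X.basicOpen f' ≤ X.basicOpen f) (a : Γ(X, X.basicOpen f)),
      resFun h (E f a) = E f' (resFun h a) := by
    intro f f' h a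
    refine isDer_ext_basicOpen hV f (D := resFun h ∘ E f) (D' := E f' ∘ resFun h)
      ((hE f).postcomp (resFun h)) ((hE f').precomp (resFun h) (resFun_consts s h)) (fun a => ?_) a
    simp only [Function.comp_apply, hEd, resFun_resFun]
  have key : ∀ (W : X.Opens) (h : W ≤ V) (g : Γ(X, W)), ∃ u : Γ(X, W),
      ∀ (f : Γ(X, V)) (hf : X.basicOpen f ≤ W), resFun hf u = E f (resFun hf g) := by
    intro W h g
    obtain ⟨u, hu⟩ := exists_of_local (M := structureModule X) (V := W)
      (fun O hO (u : Γ(X, O)) => ∀ (f : Γ(X, V)) (hf : X.basicOpen f ≤ O),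
        resFun hf u = E f (resFun (hf.trans hO) g))
      (fun {O O'} hO hO' u hu f hf => (resFun_resFun hO' hf _).trans (hu f (hf.trans hO')))
      (fun O hO u u' hu hu' => eq_of_basicOpen hV (hO.trans h)
        fun f hf => (hu f hf).trans (hu' f hf).symm)
      (fun x hx => by
        obtain ⟨f, hf, hxf⟩ := exists_basicOpen hV h hx
        refine ⟨_, hf, hxf, E f (resFun hf g), fun f' hf' => ?_⟩
        rw [compat, resFun_resFun])
    refine ⟨u, fun f hf => resFun_eq_of_locally_eq fun x hx => ?_⟩
    obtain ⟨O, hO, hxO, hP⟩ := hu x (hf hx)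
    obtain ⟨f', hf', hxf'⟩ := exists_basicOpen hV (W := X.basicOpen f ⊓ O)
      ((inf_le_right.trans hO).trans h) ⟨hx, hxO⟩
    refine ⟨_, hf'.trans inf_le_left, hxf', ?_⟩
    refine (resFun_resFun hf (hf'.trans inf_le_left) u).trans ?_
    rw [compat, resFun_resFun]
    exact (resFun_resFun hO (hf'.trans inf_le_right) u).symm.trans (hP f' (hf'.trans inf_le_right))
  choose dW hdW using key
  obtain ⟨D, hD⟩ := exists_tangent (s := s) dW (fun W h =>
    ⟨fun a b => eq_of_basicOpen hV h fun f hf => by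
      rw [hdW, map_add, map_add, hdW, hdW, (hE f).add],
    fun a b => eq_of_basicOpen hV h fun f hf => by
      rw [hdW, map_mul, map_add, (hE f).mul]
      simp only [RingHom.id_apply, map_mul, hdW],
    fun c => eq_of_basicOpen hV h fun f hf => by
      rw [hdW, map_zero, resFun_consts, (hE f).const]⟩)
    (fun W W' h h' g => eq_of_basicOpen hV (h'.trans h) fun f hf => by
      rw [hdW, resFun_resFun, hdW, resFun_resFun])
  refine ⟨D, fun g => eq_of_basicOpen hV le_rfl fun f hf => ?_⟩
  have := hD V le_rfl g
  rw [res_self] at this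
  rw [this, hdW, hEd]; rfl

end Tangent

/-! ### Local coordinates, the chain rule and the differential of a morphism -/

section Differential

variable {X Y : Scheme.{u}} {k : CommRingCat.{u}}

/-- Functions `x₁, …, xₙ` and vector fields `θ₁, …, θₙ` on an affine open `U` which form a system of
coordinates with the dual frame. -/
structure IsLocalCoordinates {n : ℕ} (s : X ⟶ Spec k) (U : X.Opens) (x : Fin n → Γ(X, U))
    (θ : Fin n → Γ(tangentSheaf s, U)) : Prop where
  affine : IsAffineOpen U
  coord : IsCoordinates (consts s U) x fun i => derive (θ i)

theorem exists_isLocalCoordinates {n : ℕ} {s : X ⟶ Spec k} {U : X.Opens} (hU : IsAffineOpen U)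
    {x : Fin n → Γ(X, U)} {δ : Fin n → Γ(X, U) → Γ(X, U)}
    (h : IsCoordinates (consts s U) x δ) : ∃ θ, IsLocalCoordinates s U x θ := by
  choose θ hθ using fun i => exists_tangent_affine (s := s) hU (h.der i)
  refine ⟨θ, hU, ?_⟩
  have : (fun i => derive (θ i)) = δ := funext fun i => funext (hθ i)
  rwa [this]

/-- A field D equals ∑ D(x_i) θ_i, as both sides agree on the functions on the affine open;
evaluation at x_j recovers the coefficients. -/
theorem IsLocalCoordinates.isBasisOn {n : ℕ} {s : X ⟶ Spec k} {U : X.Opens}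
    {x : Fin n → Γ(X, U)} {θ : Fin n → Γ(tangentSheaf s, U)} (h : IsLocalCoordinates s U x θ) :
    IsBasisOn (tangentSheaf s) U θ := by
  have hd : ∀ (V : X.Opens) (hV : V ≤ U) (c : Fin n → Γ(X, V)) (g : Γ(X, U)),
      derive (∑ i, c i • res _ hV (θ i)) (resFun hV g) =
        ∑ i, c i * resFun hV (derive (θ i) g) := fun V hV c g => by
    rw [derive_sum]
    exact Finset.sum_congr rfl fun i _ => by rw [derive_smul, derive_res]
  refine ⟨fun V hV c hc i => ?_, fun V hV D => ⟨fun i => derive D (resFun hV (x i)),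
    tangent_ext_affine h.affine hV fun g => ?_⟩⟩
  · have := hd V hV c (x i)
    rw [hc, derive_zero, h.coord.sum_apply] at this
    exact this.symm
  · rw [hd]
    exact h.coord.eq_sum (D := derive D ∘ resFun hV)
      ((isDer_derive D).precomp (resFun hV) (resFun_consts s hV)) g

variable (f : X ⟶ Y) {t : Y ⟶ Spec k}

theorem resFun_appLE {U : Y.Opens} {V V' : X.Opens} (h : V ≤ f ⁻¹ᵁ U) (h' : V' ≤ V) (g : Γ(Y, U)) :
    resFun h' (f.appLE U V h g) = f.appLE U V' (h'.trans h) g :=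
  resFun_resFun h h' _

theorem appLE_resFun {U U' : Y.Opens} {V : X.Opens} (h : U' ≤ U) (h' : V ≤ f ⁻¹ᵁ U')
    (g : Γ(Y, U)) :
    f.appLE U' V h' (resFun h g) = f.appLE U V (h'.trans (f.preimage_mono h)) g := by
  change (Y.presheaf.map (homOfLE h).op ≫ f.appLE U' V h') g = _
  rw [Scheme.Hom.map_appLE]

theorem appLE_consts {U : Y.Opens} {V : X.Opens} (h : V ≤ f ⁻¹ᵁ U) (c : k) :
    f.appLE U V h (consts t U c) = consts (f ≫ t) V c := by
  change ((Scheme.ΓSpecIso k).inv ≫ t.appLE ⊤ U le_top ≫ f.appLE U V h) c =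
    ((Scheme.ΓSpecIso k).inv ≫ (f ≫ t).appLE ⊤ V le_top) c
  exact congrArg (fun φ => ((Scheme.ΓSpecIso k).inv ≫ φ) c)
    (Scheme.Hom.appLE_comp_appLE f t ⊤ U V le_top h)

/-- Evaluation of vector fields on a function `g` on `U`. -/
def deriveAt {U : Y.Opens} (g : Γ(Y, U)) :
    homOn (tangentSheaf t).val (structureModule Y) U :=
  mkHomOn (M := tangentSheaf t) (N := structureModule Y) (fun V h =>
    { toFun := fun D => derive D (resFun h g)
      map_add' := fun D D' => derive_add D D' _
      map_smul' := fun r D => derive_smul r D _ })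
    (fun h h' D => by
      refine (derive_res h' D (resFun h g)).symm.trans ?_
      rw [resFun_resFun]; rfl)

/-- The evaluation `f^*𝒯_Y ⟶ 𝒪_X` of (pulled back) vector fields on a function `g` on `U`. -/
def evalAt {U : Y.Opens} (g : Γ(Y, U)) :
    homOn ((Scheme.Modules.pullback f).obj (tangentSheaf t)).val (structureModule X) (f ⁻¹ᵁ U) :=
  (exists_functional_pullback f (deriveAt (t := t) g)).choose

/-- The field θ and the function g live on different opens, so θ(g) only makes sense on their
intersection. -/
theorem evalAt_pullbackSection {U W : Y.Opens} {V : X.Opens} (g : Γ(Y, W)) (hW : V ≤ f ⁻¹ᵁ W)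
    (hU : V ≤ f ⁻¹ᵁ U) (θ : Γ(tangentSheaf t, U)) :
    apFun (evalAt f g) hW (pullbackSection f _ hU θ) =
      f.appLE (U ⊓ W) V (le_inf hU hW)
        (derive (res _ inf_le_left θ) (resFun inf_le_right g)) := by
  have h := (exists_functional_pullback f (deriveAt (t := t) g)).choose_spec (U ⊓ W) inf_le_right V
    (le_inf hU hW) (res _ inf_le_left θ)
  exact (congrArg (apFun (evalAt f g) hW) (pullbackSection_res f (inf_le_left : U ⊓ W ≤ U)
    (le_inf hU hW : V ≤ f ⁻¹ᵁ (U ⊓ W)) θ)).symm.trans h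

variable {f} in
/-- The chain rule in local coordinates. -/
theorem IsLocalCoordinates.chain_rule {n : ℕ} {U W : Y.Opens} {x : Fin n → Γ(Y, U)}
    {θ : Fin n → Γ(tangentSheaf t, U)} (hx : IsLocalCoordinates t U x θ) {V : X.Opens}
    (D : Γ(tangentSheaf (f ≫ t), V)) (hW : W ≤ U) (h : V ≤ f ⁻¹ᵁ W) (g : Γ(Y, W)) :
    derive D (f.appLE W V h g) = ∑ i, derive D (f.appLE U V (h.trans (f.preimage_mono hW)) (x i)) *
      f.appLE W V h (derive (res _ hW (θ i)) g) := by
  refine resFun_eq_of_locally_eq fun p hp => ?_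
  obtain ⟨a, ha, hpa⟩ := exists_basicOpen hx.affine hW (h hp)
  have h1 : V ⊓ f ⁻¹ᵁ (Y.basicOpen a) ≤ f ⁻¹ᵁ (Y.basicOpen a) := inf_le_right
  have h2 : V ⊓ f ⁻¹ᵁ (Y.basicOpen a) ≤ V := inf_le_left
  refine ⟨_, h2, ⟨hp, hpa⟩, ?_⟩
  -- Over a basic open of `U` both sides are derivations along f^♯, so it is enough to compare them
  -- on Γ(Y, U), where the coordinate expansion `IsCoordinates.eq_sum` applies.
  have hder : IsDer (consts t (Y.basicOpen a)) (f.appLE _ _ h1).hom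
      (derive (res _ h2 D) ∘ f.appLE _ _ h1) :=
    (isDer_derive (res _ h2 D)).precomp (f.appLE _ _ h1).hom (appLE_consts f h1)
  have key := isDer_ext_basicOpen hx.affine a hder
    (IsDer.of_sum Finset.univ fun i _ => ((isDer_derive (res _ (Y.basicOpen_le a) (θ i))).postcomp
      (f.appLE _ _ h1).hom).smul (derive (res _ h2 D) (f.appLE U _ (h1.trans
        (f.preimage_mono (Y.basicOpen_le a))) (x i)))) (fun b => by
      have := hx.coord.eq_sum (hder.precomp (resFun (Y.basicOpen_le a))
        (resFun_consts t (Y.basicOpen_le a))) b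
      refine this.trans (Finset.sum_congr rfl fun i _ => ?_)
      simp only [Function.comp_apply, RingHom.comp_apply]
      rw [appLE_resFun, derive_res]) (resFun ha g)
  simp only [Function.comp_apply] at key
  rw [appLE_resFun] at key
  rw [← derive_res, resFun_appLE, map_sum, key]
  refine Finset.sum_congr rfl fun i _ => ?_
  rw [map_mul, ← derive_res, resFun_appLE, resFun_appLE]
  refine congrArg _ ?_
  have e : derive (res _ (Y.basicOpen_le a) (θ i)) (resFun ha g) =
      resFun ha (derive (res _ hW (θ i)) g) := by
    rw [← derive_res, res_res]
  exact (congrArg (f.appLE _ _ h1) e).trans (appLE_resFun f ha h1 _)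

end Differential

section Differential

variable {X Y : Scheme.{u}} {k : CommRingCat.{u}} {f : X ⟶ Y} {t : Y ⟶ Spec k} {n : ℕ}
  {U : Y.Opens} {x : Fin n → Γ(Y, U)} {θ : Fin n → Γ(tangentSheaf t, U)} {V : X.Opens}

theorem IsLocalCoordinates.evalAt_sum (hx : IsLocalCoordinates t U x θ) (h : V ≤ f ⁻¹ᵁ U)
    (b : Fin n → Γ(X, V)) (j : Fin n) :
    apFun (evalAt f (x j)) h (∑ i, b i • pullbackSection f (tangentSheaf t) h (θ i)) = b j := by
  rw [map_sum]
  have e : ∀ i, apFun (evalAt f (x j)) h (pullbackSection f (tangentSheaf t) h (θ i)) =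
      if i = j then 1 else 0 := fun i => by
    rw [evalAt_pullbackSection f _ h h, derive_res]
    refine (appLE_resFun f _ _ _).trans ?_
    have := hx.coord.dual i j
    rw [this]
    split <;> simp
  simp only [map_smul, e, smul_eq_mul, mul_ite, mul_one, mul_zero, Finset.sum_ite_eq',
    Finset.mem_univ, if_true]

theorem IsLocalCoordinates.eq_sum_evalAt (hx : IsLocalCoordinates t U x θ) (h : V ≤ f ⁻¹ᵁ U)
    (m : Γ((Scheme.Modules.pullback f).obj (tangentSheaf t), V)) :
    m = ∑ i, apFun (evalAt f (x i)) h m • pullbackSection f (tangentSheaf t) h (θ i) := by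
  obtain ⟨c, hc⟩ := (hx.isBasisOn.pullback f).span V h m
  simp only [res_pullbackSection] at hc
  have : ∀ i, apFun (evalAt f (x i)) h m = c i := fun i => by rw [hc, hx.evalAt_sum]
  simp only [this]
  exact hc

theorem IsLocalCoordinates.evalAt_ext (hx : IsLocalCoordinates t U x θ) (h : V ≤ f ⁻¹ᵁ U)
    {m m' : Γ((Scheme.Modules.pullback f).obj (tangentSheaf t), V)}
    (H : ∀ i, apFun (evalAt f (x i)) h m = apFun (evalAt f (x i)) h m') : m = m' := by
  rw [hx.eq_sum_evalAt h m, hx.eq_sum_evalAt h m']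
  simp only [H]

variable (f t) in
/-- The pulled back vector field `m` on `V` is the image of the vector field `D` under the
differential of `f`. -/
def IsImage (V : X.Opens) (D : Γ(tangentSheaf (f ≫ t), V))
    (m : Γ((Scheme.Modules.pullback f).obj (tangentSheaf t), V)) : Prop :=
  ∀ (W : Y.Opens) (V' : X.Opens) (h : V' ≤ V) (hW : V' ≤ f ⁻¹ᵁ W) (g : Γ(Y, W)),
    apFun (evalAt f g) hW (res _ h m) = derive (res _ h D) (f.appLE W V' hW g)

/-- This is the chain rule: the derivation D ∘ f^♯ has the value D(f^♯ x_i) on x_i, hence the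
components D(f^♯ x_i) along the θ_i. -/
theorem IsLocalCoordinates.isImage (hx : IsLocalCoordinates t U x θ) (h : V ≤ f ⁻¹ᵁ U)
    (D : Γ(tangentSheaf (f ≫ t), V)) :
    IsImage f t V D (∑ i, derive D (f.appLE U V h (x i)) • pullbackSection f _ h (θ i)) := by
  intro W V' h' hW g
  have hUW : V' ≤ f ⁻¹ᵁ (U ⊓ W) := le_inf (h'.trans h) hW
  have e := hx.chain_rule (res _ h' D) (inf_le_left : U ⊓ W ≤ U) hUW (resFun inf_le_right g)
  rw [appLE_resFun] at e
  rw [e, res_sum, map_sum]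
  refine Finset.sum_congr rfl fun i _ => ?_
  rw [res_smul, map_smul, res_pullbackSection, evalAt_pullbackSection f g hW (h'.trans h),
    ← derive_res, resFun_appLE]
  rfl

/-- A section of f^*𝒯_Y is determined by its values on coordinates, so `IsImage` has at most one
solution m for each D, and coordinates provide a solution locally. The relation thus defines a
morphism, although the coordinates themselves are not global. -/
theorem exists_differential
    (hY : ∀ y : Y, ∃ (n : ℕ) (U : Y.Opens) (x : Fin n → Γ(Y, U)) (θ : Fin n → Γ(tangentSheaf t, U)),
      y ∈ U ∧ IsLocalCoordinates t U x θ) :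
    ∃ df : tangentSheaf (f ≫ t) ⟶ (Scheme.Modules.pullback f).obj (tangentSheaf t),
      ∀ V D, IsImage f t V D (df.app V D) := by
  obtain ⟨df, hdf⟩ := exists_hom_of_rel (IsImage f t)
    (fun {V V'} h D m H W V'' h' hW g => by
      rw [res_res, res_res]; exact H W V'' (h'.trans h) hW g)
    (fun V D m m' H H' => eq_of_locally_eq fun p hp => by
      obtain ⟨n, U, x, θ, hpU, hx⟩ := hY (f p)
      refine ⟨V ⊓ f ⁻¹ᵁ U, inf_le_left, ⟨hp, hpU⟩, hx.evalAt_ext inf_le_right fun i => ?_⟩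
      rw [H U _ inf_le_left inf_le_right (x i), H' U _ inf_le_left inf_le_right (x i)])
    (fun V D D' m m' H H' W V' h hW g => by
      rw [res_add, res_add, map_add, derive_add, H W V' h hW g, H' W V' h hW g])
    (fun V r D m H W V' h hW g => by
      rw [res_smul, res_smul, map_smul, derive_smul, H W V' h hW g]; rfl)
    (fun V D p hp => by
      obtain ⟨n, U, x, θ, hpU, hx⟩ := hY (f p)
      exact ⟨V ⊓ f ⁻¹ᵁ U, inf_le_left, ⟨hp, hpU⟩, _, hx.isImage inf_le_right _⟩)
  refine ⟨df, fun V D W V' h hW g => resFun_eq_of_locally_eq fun p hp => ?_⟩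
  obtain ⟨O, hO, hpO, hP⟩ := hdf V D p (h hp)
  have h1 : V' ⊓ O ≤ V' := inf_le_left
  refine ⟨V' ⊓ O, h1, ⟨hp, hpO⟩, ?_⟩
  have := hP W (V' ⊓ O) inf_le_right (h1.trans hW) g
  rw [res_res, res_res] at this
  rw [← derive_res, resFun_apFun, res_res, res_res, resFun_appLE]
  exact this

theorem isDifferential_of_isImage
    {df : tangentSheaf (f ≫ t) ⟶ (Scheme.Modules.pullback f).obj (tangentSheaf t)}
    (hdf : ∀ V D, IsImage f t V D (df.app V D)) : IsDifferential f df := by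
  intro U V h D m b θ e g
  have := hdf V D U V le_rfl h g
  rw [res_self, res_self, e, map_sum] at this
  rw [← this]
  refine Finset.sum_congr rfl fun i _ => ?_
  rw [map_smul, evalAt_pullbackSection f g h h, derive_res]
  exact congrArg (b i * ·) (appLE_resFun f inf_le_left (le_inf h h : V ≤ f ⁻¹ᵁ (U ⊓ U)) (derive (θ i) g))

/-- In local coordinates, `f^*θ` is determined by its components, and the differential of `f` sends
`D` to the vector with components `D(f^♯ xᵢ)`. -/
theorem isImage_evalAt {D : Γ(tangentSheaf (f ≫ t), V)}
    {m : Γ((Scheme.Modules.pullback f).obj (tangentSheaf t), V)} (H : IsImage f t V D m)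
    (h : V ≤ f ⁻¹ᵁ U) (g : Γ(Y, U)) :
    apFun (evalAt f g) h m = derive D (f.appLE U V h g) := by
  have := H U V le_rfl h g
  rwa [res_self, res_self] at this

end Differential

/-! ### Coordinates on smooth schemes -/

section Coordinates

variable {k A B : Type u} [CommRing k] [CommRing A] [CommRing B] {n : ℕ}

/-- In a standard smooth presentation the differentials of the variables not matched with a relation
form a basis of the Kähler differentials. These variables are the coordinates, and δ_i(a) is the
i-th component of da in this basis. -/
theorem exists_isCoordinates_of_isStandardSmooth [Nontrivial A] {φ : k →+* A}
    (h : φ.IsStandardSmoothOfRelativeDimension n) : ∃ x δ, IsCoordinates (n := n) φ x δ := by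
  let _ := φ.toAlgebra
  have h : Algebra.IsStandardSmoothOfRelativeDimension n k A := h
  have hr := Algebra.IsStandardSmoothOfRelativeDimension.rank_kaehlerDifferential (R := k) (S := A) n
  obtain ⟨ι, σ, _, _, P, hP⟩ := h
  have := Fintype.ofFinite ((Set.range P.map)ᶜ : Set ι)
  have hc : Fintype.card ((Set.range P.map)ᶜ : Set ι) = n := by
    rw [rank_eq_card_basis P.basisKaehler] at hr
    exact_mod_cast hr
  let e := Fintype.equivFinOfCardEq hc
  let b := P.basisKaehler.reindex e
  have hb : ∀ i, b i = KaehlerDifferential.D k A (P.val (e.symm i).1) := fun i => by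
    rw [Module.Basis.reindex_apply, P.basisKaehler_apply]
  refine ⟨fun i => P.val (e.symm i).1, fun i a => b.repr (KaehlerDifferential.D k A a) i,
    fun i => ⟨fun a a' => by simp, fun a a' => by simp, fun c => ?_⟩, fun i j => ?_,
    fun C _ f D hD hx a => ?_⟩
  · have : KaehlerDifferential.D k A (φ c) = 0 := Derivation.map_algebraMap _ c
    rw [this]; simp
  · rw [← hb, Module.Basis.repr_self, Finsupp.single_apply]
    simp [eq_comm]
  · let _ := f.toAlgebra
    let _ := (f.comp φ).toAlgebra
    have : IsScalarTower k A C := IsScalarTower.of_algebraMap_eq fun _ => rfl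
    let D' : Derivation k A C := Derivation.mk' ⟨⟨D, hD.add⟩, fun c a => by
        have e1 : c • a = φ c * a := Algebra.smul_def c a
        have e2 : c • D a = f (φ c) * D a := Algebra.smul_def c (D a)
        change D (c • a) = c • D a
        rw [e1, e2, hD.mul, hD.const, mul_zero, add_zero]⟩ hD.mul
    have h0 : D'.liftKaehlerDifferential = 0 := b.ext fun i => by
      rw [hb, Derivation.liftKaehlerDifferential_comp_D]
      exact hx i
    have h1 : D'.liftKaehlerDifferential (KaehlerDifferential.D k A a) = D a :=
      Derivation.liftKaehlerDifferential_comp_D _ _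
    rw [← h1, h0]; rfl

/-- Smoothness gives coordinates over Γ(Spec k, ⊤), whereas `consts` takes its constants from k
itself. -/
theorem IsCoordinates.comp_surjective {k' : Type u} [CommRing k'] {φ : k →+* A} {x : Fin n → A}
    {δ : Fin n → A → A} (h : IsCoordinates φ x δ) {e : k' →+* k} (he : Function.Surjective e) :
    IsCoordinates (φ.comp e) x δ where
  der i := ⟨(h.der i).add, (h.der i).mul, fun c => (h.der i).const (e c)⟩
  dual := h.dual
  ext B _ f D hD hx a := h.ext B f D ⟨hD.add, hD.mul, fun c => by
    obtain ⟨c, rfl⟩ := he c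
    exact hD.const c⟩ hx a

theorem IsCoordinates.translate {φ : k →+* A} {x : Fin n → A} {δ : Fin n → A → A}
    (h : IsCoordinates φ x δ) (c : Fin n → k) : IsCoordinates φ (fun i => x i - φ (c i)) δ where
  der := h.der
  dual i j := by rw [(h.der i).sub, (h.der i).const, sub_zero, h.dual]
  ext B _ f D hD hx a := h.ext B f D hD (fun i => by
    have := hx i
    rwa [hD.sub, hD.const, sub_zero] at this) a

/-- At a point with residue field `k`, coordinates which vanish there generate the maximal ideal up
to its square. -/
theorem IsCoordinates.ker_le {φ : k →+* A} {x : Fin n → A} {δ : Fin n → A → A}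
    (h : IsCoordinates φ x δ) (q : A →+* k) (hq : ∀ c, q (φ c) = c) (hx : ∀ i, q (x i) = 0) :
    RingHom.ker q ≤ Ideal.span (Set.range x) ⊔ RingHom.ker q • RingHom.ker q := by
  set J := Ideal.span (Set.range x) ⊔ RingHom.ker q • RingHom.ker q
  intro a ha
  -- With 𝔪 the kernel of `q`, the Leibniz rule for a ↦ a - a(p) fails by -(a - a(p))(b - b(p)),
  -- which lies in 𝔪² ⊆ J. The resulting derivation to A/J kills the coordinates, so it is zero,
  -- while it sends a ∈ 𝔪 to the class of a.
  have hD : IsDer φ (Ideal.Quotient.mk J) fun a => Ideal.Quotient.mk J (a - φ (q a)) := by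
    refine ⟨fun a b => ?_, fun a b => ?_, fun c => by rw [hq, sub_self, map_zero]⟩
    · rw [← map_add, map_add, map_add]; congr 1; ring
    · rw [← map_mul, ← map_mul, ← map_add, ← sub_eq_zero, ← map_sub, Ideal.Quotient.eq_zero_iff_mem]
      have hm : ∀ a, a - φ (q a) ∈ RingHom.ker q := fun a => by
        rw [RingHom.mem_ker, map_sub, hq, sub_self]
      have e : a * b - φ (q (a * b)) - (a * (b - φ (q b)) + b * (a - φ (q a))) =
          -((a - φ (q a)) * (b - φ (q b))) := by rw [map_mul, map_mul]; ring
      rw [e, neg_mem_iff]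
      exact Submodule.mem_sup_right (Submodule.smul_mem_smul (hm a) (hm b))
  have := h.ext _ _ _ hD (fun i => by
    rw [hx, map_zero, sub_zero, Ideal.Quotient.eq_zero_iff_mem]
    exact Submodule.mem_sup_left (Ideal.subset_span ⟨i, rfl⟩)) a
  rw [(RingHom.mem_ker).mp ha, map_zero, sub_zero, Ideal.Quotient.eq_zero_iff_mem] at this
  exact this

end Coordinates

section Neighborhoods

variable {X : Scheme.{u}} {k : CommRingCat.{u}} {s : X ⟶ Spec k} {n : ℕ}

theorem IsLocalCoordinates.basicOpen {U : X.Opens} {x : Fin n → Γ(X, U)}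
    {θ : Fin n → Γ(tangentSheaf s, U)} (h : IsLocalCoordinates s U x θ) (f : Γ(X, U)) :
    ∃ θ', IsLocalCoordinates s (X.basicOpen f) (fun i => resFun (X.basicOpen_le f) (x i)) θ' := by
  have := h.affine.isLocalization_basicOpen f
  obtain ⟨δ, hδ⟩ := h.coord.localization (A' := Γ(X, X.basicOpen f)) (Submonoid.powers f)
  have e : (algebraMap Γ(X, U) Γ(X, X.basicOpen f)).comp (consts s U) = consts s _ :=
    RingHom.ext fun c => resFun_consts s (X.basicOpen_le f) c
  rw [e] at hδ
  exact exists_isLocalCoordinates (h.affine.basicOpen f) hδ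

theorem exists_coordinate_neighborhood [Subsingleton (Spec k)] [SmoothOfRelativeDimension n s]
    (p : X) (O : X.Opens) (hp : p ∈ O) : ∃ (U : X.Opens) (x : Fin n → Γ(X, U))
      (θ : Fin n → Γ(tangentSheaf s, U)), p ∈ U ∧ U ≤ O ∧ IsLocalCoordinates s U x θ := by
  obtain ⟨U₀, -, V, hV, hpV, e, hs⟩ :=
    SmoothOfRelativeDimension.exists_isStandardSmoothOfRelativeDimension (n := n) (f := s) p
  -- The base has a single point, so the affine open of the base supplied by smoothness is all of
  -- it.
  obtain rfl : U₀ = ⊤ := eq_top_iff.mpr fun z _ => Subsingleton.elim (s p) z ▸ e hpV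
  have : Nonempty V := ⟨⟨p, hpV⟩⟩
  obtain ⟨x, δ, h⟩ := exists_isCoordinates_of_isStandardSmooth hs
  have hsurj : Function.Surjective (Scheme.ΓSpecIso k).inv.hom :=
    (ConcreteCategory.bijective_of_isIso (Scheme.ΓSpecIso k).inv).2
  obtain ⟨θ, h⟩ := exists_isLocalCoordinates (s := s) hV (h.comp_surjective hsurj)
  obtain ⟨f, hf, hpf⟩ := exists_basicOpen hV (W := V ⊓ O) inf_le_left ⟨hpV, hp⟩
  obtain ⟨θ', h'⟩ := h.basicOpen f
  exact ⟨_, _, θ', hpf, hf.trans inf_le_right, h'⟩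

end Neighborhoods

/-! ### Values at a closed point and centred coordinates -/

section Point

variable {X : Scheme.{u}} {k : Type u} [Field k] {s : X ⟶ Spec (CommRingCat.of k)} {n : ℕ}
  {p : X} {U : X.Opens}

theorem mem_primeIdealOf_iff (hU : IsAffineOpen U) (hp : p ∈ U) (g : Γ(X, U)) :
    g ∈ (hU.primeIdealOf ⟨p, hp⟩).asIdeal ↔ p ∉ X.basicOpen g := by
  have h1 : hU.fromSpec (hU.primeIdealOf ⟨p, hp⟩) = p := hU.fromSpec_primeIdealOf ⟨p, hp⟩
  have h2 : hU.primeIdealOf ⟨p, hp⟩ ∈ hU.fromSpec ⁻¹ᵁ X.basicOpen g ↔ p ∈ X.basicOpen g :=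
    iff_of_eq (congrArg (· ∈ X.basicOpen g) h1)
  rw [← h2, hU.fromSpec_preimage_basicOpen]
  exact not_not.symm

theorem ideal_vanishingIdeal_eq (hU : IsAffineOpen U) (hc : IsClosed {p}) (hp : p ∈ U) :
    (Scheme.IdealSheafData.vanishingIdeal ⟨{p}, hc⟩).ideal ⟨U, hU⟩ =
      (hU.primeIdealOf ⟨p, hp⟩).asIdeal := by
  have e : hU.fromSpec ⁻¹' {p} = {hU.primeIdealOf ⟨p, hp⟩} := by
    ext z
    have h1 : hU.fromSpec (hU.primeIdealOf ⟨p, hp⟩) = p := hU.fromSpec_primeIdealOf ⟨p, hp⟩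
    refine ⟨fun hz => hU.fromSpec.isOpenEmbedding.injective (Eq.trans hz h1.symm), ?_⟩
    rintro rfl
    exact h1
  exact (congrArg (PrimeSpectrum.vanishingIdeal (R := Γ(X, U))) e).trans
    (PrimeSpectrum.vanishingIdeal_singleton _)

theorem ideal_vanishingIdeal_eq_top (hU : IsAffineOpen U) (hc : IsClosed {p}) (hp : p ∉ U) :
    (Scheme.IdealSheafData.vanishingIdeal ⟨{p}, hc⟩).ideal ⟨U, hU⟩ = ⊤ := by
  have e : hU.fromSpec ⁻¹' {p} = ∅ := by
    ext z
    refine iff_of_false (fun hz => hp ?_) id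
    have h1 : hU.fromSpec z ∈ Set.range hU.fromSpec := ⟨z, rfl⟩
    rw [hU.range_fromSpec] at h1
    rwa [← show hU.fromSpec z = p from hz]
  exact (congrArg (PrimeSpectrum.vanishingIdeal (R := Γ(X, U))) e).trans
    PrimeSpectrum.vanishingIdeal_empty

/-- The value of functions on `U` at the `k`-point `p`. -/
structure IsValue (s : X ⟶ Spec (CommRingCat.of k)) (p : X) (U : X.Opens) (q : Γ(X, U) →+* k) :
    Prop where
  const : ∀ c, q (consts s U c) = c
  eq_zero : ∀ g, q g = 0 ↔ p ∉ X.basicOpen g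

/-- By the Nullstellensatz the quotient of Γ(X, U) by the maximal ideal of p is finite over k, hence
equal to k because k is algebraically closed. -/
theorem exists_isValue [IsAlgClosed k] [LocallyOfFiniteType s] (hU : IsAffineOpen U)
    (hc : IsClosed {p}) (hp : p ∈ U) : ∃ q, IsValue s p U q := by
  let m := (hU.primeIdealOf ⟨p, hp⟩).asIdeal
  have : m.IsMaximal := hU.primeIdealOf_isMaximal_of_isClosed ⟨p, hp⟩ hc
  let _ : Field (Γ(X, U) ⧸ m) := Ideal.Quotient.field m
  let _ : Algebra k Γ(X, U) := (consts s U).toAlgebra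
  have hft : (s.appLE ⊤ U le_top).hom.FiniteType :=
    s.finiteType_appLE (isAffineOpen_top _) hU le_top
  have hft' : (consts s U).FiniteType := by
    refine hft.comp (RingHom.FiniteType.of_surjective _ ?_)
    exact (ConcreteCategory.bijective_of_isIso (Scheme.ΓSpecIso (CommRingCat.of k)).inv).2
  have : Algebra.FiniteType k Γ(X, U) := hft'
  have : Algebra.FiniteType k (Γ(X, U) ⧸ m) :=
    Algebra.FiniteType.of_surjective (Ideal.Quotient.mkₐ k m) Ideal.Quotient.mk_surjective
  have : Module.Finite k (Γ(X, U) ⧸ m) := finite_of_finite_type_of_isJacobsonRing _ _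
  have hb : Function.Bijective (algebraMap k (Γ(X, U) ⧸ m)) :=
    IsAlgClosed.algebraMap_bijective_of_isIntegral
  let e := RingEquiv.ofBijective _ hb
  refine ⟨(e.symm : Γ(X, U) ⧸ m →+* k).comp (Ideal.Quotient.mk m), fun c => ?_, fun g => ?_⟩
  · exact e.symm_apply_apply c
  · rw [← mem_primeIdealOf_iff hU hp]
    change e.symm (Ideal.Quotient.mk m g) = 0 ↔ _
    rw [map_eq_zero_iff _ e.symm.injective, Ideal.Quotient.eq_zero_iff_mem]

theorem IsValue.mem_ker {q : Γ(X, U) →+* k} (h : IsValue s p U q) (hU : IsAffineOpen U)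
    (hp : p ∈ U) : RingHom.ker q = (hU.primeIdealOf ⟨p, hp⟩).asIdeal := by
  ext g
  rw [RingHom.mem_ker, h.eq_zero, mem_primeIdealOf_iff]

theorem IsValue.resFun {U' : X.Opens} {q : Γ(X, U) →+* k} {q' : Γ(X, U') →+* k}
    (h : IsValue s p U q) (h' : IsValue s p U' q') (hle : U' ≤ U) (g : Γ(X, U)) :
    q' (resFun hle g) = q g := by
  have h1 : q (g - consts s U (q g)) = 0 := by rw [map_sub, h.const, sub_self]
  have h2 : q' (BlowupTangent.resFun hle (g - consts s U (q g))) = 0 := by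
    rw [h'.eq_zero]
    rw [h.eq_zero] at h1
    refine fun h3 => h1 ?_
    have e := Scheme.basicOpen_res X (g - consts s U (q g)) (homOfLE hle).op
    exact (e.le h3).2
  rw [map_sub, map_sub, resFun_consts, h'.const, sub_eq_zero] at h2
  exact h2

/-- Coordinates at the `k`-point `p` which generate the maximal ideal of `p`. -/
structure IsCentered (s : X ⟶ Spec (CommRingCat.of k)) (p : X) (U : X.Opens)
    (x : Fin n → Γ(X, U)) (θ : Fin n → Γ(tangentSheaf s, U)) (q : Γ(X, U) →+* k) : Prop where
  coordinates : IsLocalCoordinates s U x θ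
  mem : p ∈ U
  value : IsValue s p U q
  ker : RingHom.ker q = Ideal.span (Set.range x)

/-- Translating coordinates so that they vanish at p gives 𝔪 = (x) + 𝔪² by `IsCoordinates.ker_le`.
Nakayama's lemma then yields r with r(p) = 1 and r𝔪 ⊆ (x), and on the basic open of r the translated
coordinates generate 𝔪. -/
theorem exists_isCentered [IsAlgClosed k] [LocallyOfFiniteType s] [SmoothOfRelativeDimension n s]
    (hc : IsClosed {p}) : ∃ (U : X.Opens) (x : Fin n → Γ(X, U)) (θ : Fin n → Γ(tangentSheaf s, U))
      (q : Γ(X, U) →+* k), IsCentered s p U x θ q := by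
  obtain ⟨U, x, θ, hp, -, h⟩ := exists_coordinate_neighborhood (s := s) (n := n) p ⊤ trivial
  obtain ⟨q, hq⟩ := exists_isValue (s := s) h.affine hc hp
  have hx := h.coord.translate fun i => q (x i)
  set x₀ := fun i => x i - consts s U (q (x i))
  have hx₀ : ∀ i, q (x₀ i) = 0 := fun i => by rw [map_sub, hq.const, sub_self]
  have hle := hx.ker_le q hq.const hx₀
  let _ : Algebra k Γ(X, U) := (consts s U).toAlgebra
  have hft : (s.appLE ⊤ U le_top).hom.FiniteType :=
    s.finiteType_appLE (isAffineOpen_top _) h.affine le_top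
  have hft' : (consts s U).FiniteType := by
    refine hft.comp (RingHom.FiniteType.of_surjective _ ?_)
    exact (ConcreteCategory.bijective_of_isIso (Scheme.ΓSpecIso (CommRingCat.of k)).inv).2
  have : Algebra.FiniteType k Γ(X, U) := hft'
  have := Algebra.FiniteType.isNoetherianRing k Γ(X, U)
  obtain ⟨r, hr, hrm⟩ := Submodule.exists_sub_one_mem_and_smul_le_of_fg_of_le_sup
    ((isNoetherianRing_iff_ideal_fg _).mp this (RingHom.ker q)) le_rfl hle
  have hqr : q r = 1 := by
    rw [RingHom.mem_ker, map_sub, map_one, sub_eq_zero] at hr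
    exact hr
  have hpr : p ∈ X.basicOpen r := by
    by_contra hpr
    rw [← hq.eq_zero, hqr] at hpr
    exact one_ne_zero hpr
  obtain ⟨θ₀, hθ₀⟩ := exists_isLocalCoordinates h.affine hx
  obtain ⟨θ', hθ'⟩ := hθ₀.basicOpen r
  obtain ⟨q', hq'⟩ := exists_isValue (s := s) (h.affine.basicOpen r) hc hpr
  have hres := hq.resFun hq' (X.basicOpen_le r)
  refine ⟨_, _, θ', q', hθ', hpr, hq', le_antisymm (fun g hg => ?_) ?_⟩
  · have := h.affine.isLocalization_basicOpen r
    obtain ⟨⟨a, ⟨_, N, rfl⟩⟩, ha⟩ := IsLocalization.surj (Submonoid.powers r) g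
    have ha : g * BlowupTangent.resFun (X.basicOpen_le r) (r ^ N) =
      BlowupTangent.resFun (X.basicOpen_le r) a := ha
    have hqa : q a = 0 := by
      rw [← hres, ← ha, map_mul, (RingHom.mem_ker).mp hg, zero_mul]
    have h1 : r * a ∈ Ideal.span (Set.range x₀) := hrm ⟨a, hqa, rfl⟩
    have h2 := Ideal.mem_map_of_mem (BlowupTangent.resFun (X.basicOpen_le r)) h1
    rw [Ideal.map_span, ← Set.range_comp, map_mul, ← ha, mul_left_comm, ← map_mul,
      ← pow_succ', map_pow] at h2
    have hu : IsUnit (BlowupTangent.resFun (X.basicOpen_le r) r ^ (N + 1)) :=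
      (RingedSpace.isUnit_res_basicOpen _ r).pow _
    exact (Ideal.mul_unit_mem_iff_mem _ hu).mp h2
  · rw [Ideal.span_le]
    rintro _ ⟨i, rfl⟩
    exact (hres (x₀ i)).trans (hx₀ i)

end Point

/-! ### The affine charts of a blow-up -/

section Chart

/-- `f : A → B` is the chart `B = A[z_j / z_a]` of the blow-up of `A` along the ideal generated by the
`z_j`, with `y_j = z_j / z_a`. -/
structure IsChart {A B J : Type*} [CommRing A] [CommRing B] (f : A →+* B) (z : J → A) (a : J)
    (y : J → B) : Prop where
  injective : Function.Injective f
  mul : ∀ j, f (z a) * y j = f (z j)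
  closure : Subring.closure (Set.range f ∪ Set.range y) = ⊤
  pow : ∀ b, ∃ N c, f (z a) ^ N * b = f c
  regular : f (z a) ∈ nonZeroDivisors B

/-- Every b is c / z_a^N with c in the N-th power of the ideal. Such a c is a sum of products of N
elements of the ideal, and each of these is z_a times an element of the ring generated by A and the
y_j, so b lies in that ring. -/
theorem exists_isChart {A B J : Type*} [CommRing A] [CommRing B] [IsDomain B] {f : A →+* B}
    (hf : Function.Injective f) {z : J → A} {a : J} (ha : z a ≠ 0)
    (hmul : ∀ j, ∃ b, f (z a) * b = f (z j))
    (hpow : ∀ b, ∃ N, ∃ c ∈ Ideal.span (Set.range z) ^ N, f (z a) ^ N * b = f c) :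
    ∃ y, IsChart f z a y := by
  choose y hy using hmul
  have h0 : f (z a) ≠ 0 := fun h => ha (hf (h.trans (map_zero f).symm))
  let T := Subring.closure (Set.range f ∪ Set.range y)
  have hfT : ∀ c, f c ∈ T := fun c => Subring.subset_closure (Or.inl ⟨c, rfl⟩)
  have h1 : ∀ c ∈ Ideal.span (Set.range z), ∃ t ∈ T, f (z a) * t = f c := fun c hc => by
    induction hc using Submodule.span_induction with
    | mem c hc =>
      obtain ⟨j, rfl⟩ := hc
      exact ⟨y j, Subring.subset_closure (Or.inr ⟨j, rfl⟩), hy j⟩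
    | zero => exact ⟨0, T.zero_mem, by simp⟩
    | add c d _ _ hc hd =>
      obtain ⟨t, ht, e⟩ := hc
      obtain ⟨t', ht', e'⟩ := hd
      exact ⟨t + t', T.add_mem ht ht', by rw [mul_add, e, e', map_add]⟩
    | smul r c _ hc =>
      obtain ⟨t, ht, e⟩ := hc
      exact ⟨f r * t, T.mul_mem (hfT r) ht, by rw [mul_left_comm, e, smul_eq_mul, map_mul]⟩
  have h2 : ∀ N, ∀ c ∈ Ideal.span (Set.range z) ^ N, ∃ t ∈ T, f (z a) ^ N * t = f c := fun N => by
    induction N with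
    | zero => exact fun c _ => ⟨f c, hfT c, by simp⟩
    | succ N ih =>
      intro c hc
      rw [pow_succ] at hc
      induction hc using Submodule.mul_induction_on' with
      | mem_mul_mem c hc d hd =>
        obtain ⟨t, ht, e⟩ := ih c hc
        obtain ⟨t', ht', e'⟩ := h1 d hd
        exact ⟨t * t', T.mul_mem ht ht', by rw [map_mul, ← e, ← e']; ring⟩
      | add c _ d _ hc hd =>
        obtain ⟨t, ht, e⟩ := hc
        obtain ⟨t', ht', e'⟩ := hd
        exact ⟨t + t', T.add_mem ht ht', by rw [mul_add, e, e', map_add]⟩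
  refine ⟨y, hf, hy, eq_top_iff.mpr fun b _ => ?_, fun b => ?_, mem_nonZeroDivisors_of_ne_zero h0⟩
  · obtain ⟨N, c, hc, e⟩ := hpow b
    obtain ⟨t, ht, e'⟩ := h2 N c hc
    rwa [← mul_left_cancel₀ (pow_ne_zero N h0) (e'.trans e.symm)]
  · obtain ⟨N, c, -, e⟩ := hpow b
    exact ⟨N, c, e⟩

end Chart

section ReesChart

open Polynomial HomogeneousLocalization

variable {A : Type u} [CommRing A] (I : Ideal A)

/-- The element `c t` of the Rees algebra. -/
def reesGen (c : I) : reesAlgebra I :=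
  ⟨monomial 1 c.1, reesAlgebra.monomial_mem.mpr (by rw [pow_one]; exact c.2)⟩

theorem reesGen_mem (c : I) : reesGen I c ∈ reesPiece I 1 := fun _ hj =>
  coeff_monomial_of_ne _ hj

/-- The structure map of the degree zero part of a localization of the Rees algebra. -/
def reesAwayMap (c : I) : A →+* Away (reesPiece I) (reesGen I c) :=
  (fromZeroRingHom (reesPiece I) _).comp (algebraMap A (reesPiece I 0))

theorem val_reesAwayMap (c : I) (r : A) : (reesAwayMap I c r).val =
    algebraMap (reesAlgebra I) (Localization.Away (reesGen I c)) (algebraMap A (reesAlgebra I) r) :=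
  Localization.mk_one_eq_algebraMap _

theorem reesGen_pow_mul (c : I) (N : ℕ) (b : reesAlgebra I) (hb : b ∈ reesPiece I (N • 1)) :
    reesGen I c ^ N * algebraMap A _ (b.1.coeff N) = algebraMap A (reesAlgebra I) (c.1 ^ N) * b := by
  apply Subtype.ext
  ext i
  change ((monomial 1 c.1) ^ N * C (b.1.coeff N)).coeff i = (C (c.1 ^ N) * b.1).coeff i
  rw [monomial_pow, one_mul, coeff_mul_C, coeff_C_mul, coeff_monomial]
  split_ifs with h
  · rw [h]
  · rw [hb i (by simpa using Ne.symm h)]; simp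

variable {I}

theorem reesGen_ne_zero {c : I} (hc : c.1 ≠ 0) : reesGen I c ≠ 0 := fun h =>
  hc ((coeff_monomial_same 1 c.1).symm.trans (congrArg (fun p : reesAlgebra I => p.1.coeff 1) h))

theorem isDomain_reesAway [IsDomain A] {c : I} (hc : c.1 ≠ 0) :
    IsDomain (Away (reesPiece I) (reesGen I c)) := by
  have := IsLocalization.isDomain_localization (M := Submonoid.powers (reesGen I c))
    ((Submonoid.powers_le (P := nonZeroDivisors _)).mpr
      (mem_nonZeroDivisors_of_ne_zero (reesGen_ne_zero hc)))
  let v : Away (reesPiece I) (reesGen I c) →+* Localization.Away (reesGen I c) :=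
    ⟨⟨⟨val, val_one⟩, val_mul⟩, val_zero, val_add⟩
  exact Function.Injective.isDomain v (fun _ _ h => val_injective _ h)

theorem reesAwayMap_injective [IsDomain A] {c : I} (hc : c.1 ≠ 0) :
    Function.Injective (reesAwayMap I c) := by
  intro r r' h
  have h1 := congrArg HomogeneousLocalization.val h
  rw [val_reesAwayMap, val_reesAwayMap] at h1
  have h2 := IsLocalization.injective (Localization.Away (reesGen I c))
    ((Submonoid.powers_le (P := nonZeroDivisors _)).mpr
      (mem_nonZeroDivisors_of_ne_zero (reesGen_ne_zero hc))) h1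
  exact C_injective (congrArg Subtype.val h2)

/-- For b = b_N t^N homogeneous one has (ct)^N b_N = c^N b. The fraction b / (ct)^N is thereby
identified with b_N / c^N. -/
theorem reesAwayMap_mul_mk (c : I) (N : ℕ) (b : reesAlgebra I) (hb : b ∈ reesPiece I (N • 1)) :
    reesAwayMap I c (c.1 ^ N) * Away.mk (reesPiece I) (reesGen_mem I c) N b hb =
      reesAwayMap I c (b.1.coeff N) := by
  apply val_injective
  rw [val_mul, val_reesAwayMap, val_reesAwayMap, Away.val_mk, ← Localization.mk_one_eq_algebraMap, Localization.mk_mul,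
    ← Localization.mk_one_eq_algebraMap, Localization.mk_eq_mk_iff, Localization.r_iff_exists]
  refine ⟨1, ?_⟩
  have := reesGen_pow_mul I c N b hb
  simpa using this.symm

/-- The degree zero part of the Rees algebra localized at z_a t embeds in a localization of a
domain, and its elements are the fractions b_N / z_a^N with b_N ∈ I^N, so `exists_isChart` applies.
-/
theorem exists_isChart_of_equiv [IsDomain A] {B J : Type*} [CommRing B] {f : A →+* B} {z : J → A}
    (hI : I = Ideal.span (Set.range z)) {a : J} (ha : z a ≠ 0) (hz : z a ∈ I)
    (ψ : B ≃+* Away (reesPiece I) (reesGen I ⟨z a, hz⟩))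
    (hψ : ∀ r, ψ (f r) = reesAwayMap I ⟨z a, hz⟩ r) : ∃ y, IsChart f z a y := by
  have hc : (⟨z a, hz⟩ : I).1 ≠ 0 := ha
  have := isDomain_reesAway hc
  have : IsDomain B := Function.Injective.isDomain
    (ψ : B →+* Away (reesPiece I) (reesGen I ⟨z a, hz⟩)) (fun _ _ h => ψ.injective h)
  have hf : Function.Injective f := fun r r' h => reesAwayMap_injective hc (by
    rw [← hψ, ← hψ, h])
  refine exists_isChart hf ha (fun j => ?_) fun b => ?_
  · have hj : z j ∈ I := hI ▸ Ideal.subset_span ⟨j, rfl⟩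
    refine ⟨ψ.symm (Away.mk (reesPiece I) (reesGen_mem I _) 1 (reesGen I ⟨z j, hj⟩)
      (reesGen_mem I _)), ψ.injective ?_⟩
    have := reesAwayMap_mul_mk ⟨z a, hz⟩ 1 (reesGen I ⟨z j, hj⟩) (reesGen_mem I _)
    rw [map_mul, ψ.apply_symm_apply, hψ, hψ]
    rw [pow_one (z a)] at this
    refine this.trans (congrArg _ ?_)
    exact coeff_monomial_same 1 (z j)
  · obtain ⟨N, r, hr, e⟩ := Away.mk_surjective _ (reesGen_mem I ⟨z a, hz⟩) (ψ b)
    refine ⟨N, r.1.coeff N, hI ▸ r.2 N, ψ.injective ?_⟩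
    rw [← map_pow, map_mul, ← e, hψ, hψ]
    exact reesAwayMap_mul_mk ⟨z a, hz⟩ N r hr

/-- For N > 0 every element of I^N t^N is a sum of multiples of elements ct with c ∈ I, and these
are combinations of the z_j t. Consequently the opens D₊(z_j t) cover `Proj`. -/
theorem irrelevant_le_span {J : Type*} {z : J → A} (hI : I = Ideal.span (Set.range z))
    (hz : ∀ j, z j ∈ I) : (HomogeneousIdeal.irrelevant (reesPiece I)).toIdeal ≤
      Ideal.span (Set.range fun j => reesGen I ⟨z j, hz j⟩) := by
  set K := Ideal.span (Set.range fun j => reesGen I ⟨z j, hz j⟩)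
  have h1 : ∀ c ∈ Ideal.span (Set.range z), ∀ h : c ∈ I, reesGen I ⟨c, h⟩ ∈ K := fun c hc => by
    induction hc using Submodule.span_induction with
    | mem c hc =>
      obtain ⟨j, rfl⟩ := hc
      exact fun _ => Ideal.subset_span ⟨j, rfl⟩
    | zero =>
      intro h
      have : reesGen I ⟨0, h⟩ = 0 := Subtype.ext (monomial_zero_right 1)
      rw [this]; exact K.zero_mem
    | add c d hc hd h1 h2 =>
      intro h
      have : reesGen I ⟨c + d, h⟩ = reesGen I ⟨c, hI ▸ hc⟩ + reesGen I ⟨d, hI ▸ hd⟩ :=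
        Subtype.ext (map_add _ _ _)
      rw [this]; exact K.add_mem (h1 _) (h2 _)
    | smul r c hc h1 =>
      intro h
      have : reesGen I ⟨r • c, h⟩ = algebraMap A (reesAlgebra I) r * reesGen I ⟨c, hI ▸ hc⟩ :=
        Subtype.ext (C_mul_monomial (a := r) (b := c) (n := 1)).symm
      rw [this]; exact K.mul_mem_left _ (h1 _)
  have h2 : ∀ N, ∀ c ∈ I ^ (N + 1), ∀ h,
      (⟨monomial (N + 1) c, h⟩ : reesAlgebra I) ∈ K := fun N c hc => by
    rw [pow_succ] at hc
    induction hc using Submodule.mul_induction_on' with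
    | mem_mul_mem c hc d hd =>
      intro h
      have : (⟨monomial (N + 1) (c * d), h⟩ : reesAlgebra I) =
          ⟨monomial N c, reesAlgebra.monomial_mem.mpr hc⟩ * reesGen I ⟨d, hd⟩ :=
        Subtype.ext (monomial_mul_monomial N 1 c d).symm
      rw [this]; exact K.mul_mem_left _ (h1 d (hI ▸ hd) _)
    | add c hc d hd h1 h2 =>
      intro h
      rw [← pow_succ] at hc hd
      have : (⟨monomial (N + 1) (c + d), h⟩ : reesAlgebra I) =
          ⟨monomial (N + 1) c, reesAlgebra.monomial_mem.mpr hc⟩ +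
          ⟨monomial (N + 1) d, reesAlgebra.monomial_mem.mpr hd⟩ :=
        Subtype.ext (map_add _ _ _)
      rw [this]; exact K.add_mem (h1 _) (h2 _)
  intro r hr
  have h0 : r.1.coeff 0 = 0 := by
    have := (HomogeneousIdeal.mem_irrelevant_iff (reesPiece I) r).mp hr
    have h3 := reesDecompose_coeff I r 0
    rw [← h3]
    exact congrArg (fun p : reesAlgebra I => p.1.coeff 0) this
  have e : r = ∑ i ∈ r.1.support, ⟨monomial i (r.1.coeff i), reesAlgebra.monomial_mem.mpr (r.2 i)⟩ := by
    apply Subtype.ext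
    refine r.1.as_sum_support.trans ?_
    exact (map_sum (reesAlgebra I).val (fun i => (⟨monomial i (r.1.coeff i),
      reesAlgebra.monomial_mem.mpr (r.2 i)⟩ : reesAlgebra I)) _).symm
  rw [e]
  refine K.sum_mem fun i hi => ?_
  obtain _ | i := i
  · exact absurd h0 (mem_support_iff.mp hi)
  · exact h2 i _ (r.2 (i + 1)) _

end ReesChart

section BlowupChart

theorem fromSpec_appLE_top {X : Scheme.{u}} {U : X.Opens} (hU : IsAffineOpen U) (h) :
    hU.fromSpec.appLE U ⊤ h = (Scheme.ΓSpecIso Γ(X, U)).inv := by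
  rw [Scheme.Hom.appLE, hU.fromSpec_app_self, Category.assoc, ← Functor.map_comp]
  exact (congrArg _ ((Spec Γ(X, U)).presheaf.map_id _)).trans (Category.comp_id _)

theorem SpecMap_fromSpec_appLE_top {X : Scheme.{u}} {C : CommRingCat.{u}} {U : X.Opens}
    (hU : IsAffineOpen U) (φ : Γ(X, U) ⟶ C) {g : Spec C ⟶ X} (hg : g = Spec.map φ ≫ hU.fromSpec)
    (h) : g.appLE U ⊤ h = φ ≫ (Scheme.ΓSpecIso C).inv := by
  subst hg
  rw [← Scheme.Hom.appLE_comp_appLE (Spec.map φ) hU.fromSpec U ⊤ ⊤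
    (by rw [hU.fromSpec_preimage_self]) le_top, fromSpec_appLE_top]
  have h4 : (Spec.map φ).appLE ⊤ ⊤ le_top = (Spec.map φ).appTop := by
    rw [Scheme.Hom.appTop, Scheme.Hom.app_eq_appLE]; rfl
  rw [h4, Scheme.ΓSpecIso_inv_naturality]

theorem exists_sections_equiv {X Y : Scheme.{u}} {C : CommRingCat.{u}} (j : Spec C ⟶ X)
    [IsOpenImmersion j] (f : X ⟶ Y) {U : Y.Opens} (hU : IsAffineOpen U) (φ : Γ(Y, U) ⟶ C)
    (h : j ≫ f = Spec.map φ ≫ hU.fromSpec) {V : X.Opens} (hV : V = j.opensRange) :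
    ∃ (hle : V ≤ f ⁻¹ᵁ U) (ψ : Γ(X, V) ≃+* C), ∀ a, ψ (f.appLE U V hle a) = φ a := by
  rw [← Scheme.Hom.image_top_eq_opensRange] at hV
  subst hV
  have hle : j ''ᵁ ⊤ ≤ f ⁻¹ᵁ U := by
    rintro _ ⟨y, -, rfl⟩
    have h1 : f (j y) = hU.fromSpec (Spec.map φ y) := congrArg (fun g : Spec C ⟶ Y => g y) h
    have h2 : hU.fromSpec (Spec.map φ y) ∈ Set.range hU.fromSpec := ⟨_, rfl⟩
    rw [hU.range_fromSpec, ← h1] at h2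
    exact h2
  refine ⟨hle, (j.appIso ⊤ ≪≫ Scheme.ΓSpecIso C).commRingCatIsoToRingEquiv, fun a => ?_⟩
  have e : f.appLE U (j ''ᵁ ⊤) hle ≫ (j.appIso ⊤).hom ≫ (Scheme.ΓSpecIso C).hom = φ := by
    rw [Scheme.Hom.appIso_hom', Scheme.Hom.appLE_comp_appLE_assoc]
    rw [SpecMap_fromSpec_appLE_top hU φ h, Category.assoc, Iso.inv_hom_id, Category.comp_id]
  exact ConcreteCategory.congr_hom e a

variable {S S' : Scheme.{u}} {σ : S' ⟶ S} {U : S.Opens} {I : Ideal Γ(S, U)}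

/-- The chart of the blow-up where the ideal is generated by `c`. -/
def chartOpen (e : (σ ⁻¹ᵁ U).toScheme ≅ Proj (reesPiece I)) (c : I) : S'.Opens :=
  (σ ⁻¹ᵁ U).ι ''ᵁ (e.hom ⁻¹ᵁ Proj.basicOpen (reesPiece I) (reesGen I c))

theorem exists_isChart_chartOpen [IsDomain Γ(S, U)] (hU : IsAffineOpen U)
    (e : (σ ⁻¹ᵁ U).toScheme ≅ Proj (reesPiece I))
    (he : e.hom ≫ projToSpec (reesPiece I) = σ ∣_ U ≫ hU.isoSpec.hom)
    {J : Type*} {z : J → Γ(S, U)} (hI : I = Ideal.span (Set.range z)) {a : J} (ha : z a ≠ 0)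
    (hz : z a ∈ I) : IsAffineOpen (chartOpen e ⟨z a, hz⟩) ∧
      ∃ (hle : chartOpen e ⟨z a, hz⟩ ≤ σ ⁻¹ᵁ U) (y : J → Γ(S', chartOpen e ⟨z a, hz⟩)),
        IsChart (σ.appLE U _ hle).hom z a y := by
  -- The chart is the image of the spectrum of the degree zero localization under the open immersion
  -- `j`, over the map Γ(S, U) → that localization.
  let aw := Proj.awayι (reesPiece I) (reesGen I ⟨z a, hz⟩) (reesGen_mem I _) one_pos
  let j := aw ≫ e.inv ≫ (σ ⁻¹ᵁ U).ι
  have hV : chartOpen e ⟨z a, hz⟩ = j.opensRange := by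
    rw [Scheme.Hom.opensRange_comp, Proj.opensRange_awayι, Scheme.Hom.comp_image]
    have h : ∀ W : (Proj (reesPiece I)).Opens, e.hom ⁻¹ᵁ W = e.inv ''ᵁ W := fun W => by
      apply Opens.ext
      ext w
      constructor
      · intro hw
        exact ⟨e.hom w, hw, congrArg (fun g : (σ ⁻¹ᵁ U).toScheme ⟶ _ => g w) e.hom_inv_id⟩
      · rintro ⟨v, hv, rfl⟩
        have : e.hom (e.inv v) = v :=
          congrArg (fun g : Proj (reesPiece I) ⟶ _ => g v) e.inv_hom_id
        exact (iff_of_eq (congrArg (· ∈ W) this)).mpr hv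
    exact congrArg _ (h _)
  refine ⟨hV ▸ isAffineOpen_opensRange j, ?_⟩
  have hj : j ≫ σ = Spec.map (CommRingCat.ofHom (reesAwayMap I ⟨z a, hz⟩)) ≫ hU.fromSpec := by
    have h1 : e.inv ≫ σ ∣_ U = projToSpec (reesPiece I) ≫ hU.isoSpec.inv := by
      rw [Iso.inv_comp_eq, ← Category.assoc, he, Category.assoc, Iso.hom_inv_id, Category.comp_id]
    simp only [j, aw, Category.assoc]
    rw [← morphismRestrict_ι, reassoc_of% h1, hU.isoSpec_inv_ι, projToSpec, Category.assoc,
      Proj.awayι_toSpecZero_assoc, ← Spec.map_comp_assoc]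
    rfl
  obtain ⟨hle, ψ, hψ⟩ := exists_sections_equiv j σ hU _ hj hV
  exact ⟨hle, exists_isChart_of_equiv hI ha hz ψ hψ⟩

theorem exists_mem_chartOpen (e : (σ ⁻¹ᵁ U).toScheme ≅ Proj (reesPiece I)) {J : Type*}
    {z : J → Γ(S, U)} (hI : I = Ideal.span (Set.range z)) (hz : ∀ j, z j ∈ I) {x : S'}
    (hx : σ x ∈ U) : ∃ a, z a ≠ 0 ∧ x ∈ chartOpen e ⟨z a, hz a⟩ := by
  have h := Proj.iSup_basicOpen_eq_top (reesPiece I) _ (irrelevant_le_span hI hz)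
  obtain ⟨a, ha⟩ := Opens.mem_iSup.mp (h.ge (Opens.mem_top (e.hom ⟨x, hx⟩)))
  refine ⟨a, fun h0 => ?_, ⟨⟨x, hx⟩, ha, rfl⟩⟩
  have : reesGen I ⟨z a, hz a⟩ = 0 := by
    apply Subtype.ext
    change Polynomial.monomial 1 (z a) = 0
    rw [h0, Polynomial.monomial_zero_right]
  rw [this, Proj.basicOpen_zero] at ha
  exact ha

end BlowupChart

/-! ### The exceptional divisor as a fibre, and its local equations -/

section Fiber

variable {S S' : Scheme.{u}} (σ : S' ⟶ S) {p : S} {U : S.Opens}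

theorem appLE_congr_hom {X Y : Scheme.{u}} {g g' : X ⟶ Y} (h : g = g') {U : Y.Opens} {V : X.Opens}
    (h') : g.appLE U V h' = g'.appLE U V (h ▸ h') := by
  subst h; rfl

theorem SpecMap_evaluation_fromSpec (hU : IsAffineOpen U) (hp : p ∈ U) :
    S.fromSpecResidueField p = Spec.map (S.evaluation U p hp) ≫ hU.fromSpec := by
  rw [Scheme.fromSpecResidueField, ← hU.fromSpecStalk_eq_fromSpecStalk hp,
    IsAffineOpen.fromSpecStalk, ← Spec.map_comp_assoc]
  rfl

theorem evaluation_surjective (hU : IsAffineOpen U) (hc : IsClosed {p}) (hp : p ∈ U) :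
    Function.Surjective (S.evaluation U p hp) := by
  have := isClosed_singleton_iff_isClosedImmersion.mp hc
  let g := S.fromSpecResidueField p
  have hle : ⊤ ≤ g ⁻¹ᵁ U := fun x _ => by
    have h : g x = p := Scheme.fromSpecResidueField_apply _ _
    exact (iff_of_eq (congrArg (· ∈ U) h)).mpr hp
  have h1 : Function.Surjective (g.appLE U ⊤ hle) := by
    have h2 := Scheme.Hom.app_surjective g U hU
    intro b
    have h3 : g ⁻¹ᵁ U ≤ ⊤ := le_top
    obtain ⟨a, ha⟩ := h2 (resFun h3 b)
    refine ⟨a, ?_⟩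
    change resFun hle (g.app U a) = b
    rw [ha, resFun_resFun, resFun_self]
  have e := SpecMap_fromSpec_appLE_top hU _ (SpecMap_evaluation_fromSpec hU hp) hle
  intro b
  obtain ⟨a, ha⟩ := h1 ((Scheme.ΓSpecIso _).inv b)
  refine ⟨a, (ConcreteCategory.bijective_of_isIso (Scheme.ΓSpecIso (S.residueField p)).inv).1 ?_⟩
  rw [← ha]
  exact (ConcreteCategory.congr_hom e a).symm

theorem isClosedImmersion_fiberι (hc : IsClosed {p}) : IsClosedImmersion (σ.fiberι p) := by
  have := isClosed_singleton_iff_isClosedImmersion.mp hc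
  exact inferInstanceAs (IsClosedImmersion (Limits.pullback.fst σ (S.fromSpecResidueField p)))

variable {σ}

theorem apply_fiberι (e : σ.fiber p) : σ (σ.fiberι p e) = p := by
  have : σ.fiberι p e ∈ Set.range (σ.fiberι p) := ⟨e, rfl⟩
  rw [σ.range_fiberι] at this
  exact this

theorem fiberι_app_surjective (hc : IsClosed {p}) {V : S'.Opens} (hV : IsAffineOpen V) :
    Function.Surjective ((σ.fiberι p).app V) := by
  have := isClosedImmersion_fiberι σ hc
  exact Scheme.Hom.app_surjective _ V hV

/-- Functions vanishing at `p` pull back to zero on the fiber over `p`. -/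
theorem fiberι_app_appLE_eq_zero (hU : IsAffineOpen U) (hp : p ∈ U) {V : S'.Opens}
    (h : V ≤ σ ⁻¹ᵁ U) {a : Γ(S, U)} (ha : p ∉ S.basicOpen a) :
    (σ.fiberι p).app V (σ.appLE U V h a) = 0 := by
  have hle : ⊤ ≤ S.fromSpecResidueField p ⁻¹ᵁ U := fun x _ => by
    have h : S.fromSpecResidueField p x = p := Scheme.fromSpecResidueField_apply _ _
    exact (iff_of_eq (congrArg (· ∈ U) h)).mpr hp
  have e0 := Scheme.Hom.appLE_comp_appLE (σ.fiberι p) σ U V (σ.fiberι p ⁻¹ᵁ V) h le_rfl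
  have e1 := Scheme.Hom.appLE_comp_appLE (σ.fiberToSpecResidueField p) (S.fromSpecResidueField p)
    U ⊤ (σ.fiberι p ⁻¹ᵁ V) hle le_top
  rw [appLE_congr_hom (σ.fiber_fac p), ← e1] at e0
  rw [Scheme.Hom.app_eq_appLE]
  refine (ConcreteCategory.congr_hom e0 a).trans ?_
  have e3 := SpecMap_fromSpec_appLE_top hU _ (SpecMap_evaluation_fromSpec hU hp) hle
  rw [e3]
  have e4 : S.evaluation U p hp a = 0 := by
    rw [Scheme.evaluation_eq_zero_iff_notMem_basicOpen]; exact ha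
  simp only [CommRingCat.comp_apply, e4, map_zero]

/-- Let K be the ideal generated on V by the functions vanishing at p. The closed subscheme of V cut
out by K lies over the reduced point p, so it factors through the fibre, and a function which
vanishes on the fibre vanishes on it, that is, lies in K. -/
theorem mem_map_of_fiberι_app_eq_zero (hU : IsAffineOpen U) (hc : IsClosed {p}) (hp : p ∈ U)
    {V : S'.Opens} (hV : IsAffineOpen V) (h : V ≤ σ ⁻¹ᵁ U) {b : Γ(S', V)}
    (hb : (σ.fiberι p).app V b = 0) :
    b ∈ Ideal.map (σ.appLE U V h).hom (RingHom.ker (S.evaluation U p hp).hom) := by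
  let K := Ideal.map (σ.appLE U V h).hom (RingHom.ker (S.evaluation U p hp).hom)
  let mk : Γ(S', V) ⟶ CommRingCat.of (Γ(S', V) ⧸ K) := CommRingCat.ofHom (Ideal.Quotient.mk K)
  have hK : RingHom.ker (S.evaluation U p hp).hom ≤
      RingHom.ker (mk.hom.comp (σ.appLE U V h).hom) := fun a ha =>
    Ideal.Quotient.eq_zero_iff_mem.mpr (Ideal.mem_map_of_mem _ ha)
  let φ : S.residueField p ⟶ CommRingCat.of (Γ(S', V) ⧸ K) := CommRingCat.ofHom
    (RingHom.liftOfSurjective (S.evaluation U p hp).hom (evaluation_surjective hU hc hp) ⟨_, hK⟩)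
  have hφ : S.evaluation U p hp ≫ φ = σ.appLE U V h ≫ mk := by
    ext a
    exact RingHom.liftOfSurjective_comp_apply (S.evaluation U p hp).hom
      (evaluation_surjective hU hc hp) ⟨_, hK⟩ a
  let w := Spec.map mk ≫ hV.fromSpec
  have hw : w ≫ σ = Spec.map φ ≫ S.fromSpecResidueField p := by
    rw [SpecMap_evaluation_fromSpec hU hp, ← Spec.map_comp_assoc, hφ, Spec.map_comp_assoc,
      hU.SpecMap_appLE_fromSpec σ hV h, Category.assoc]
  let l : Spec _ ⟶ σ.fiber p := Limits.pullback.lift w (Spec.map φ) hw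
  have hl : l ≫ σ.fiberι p = w := Limits.pullback.lift_fst _ _ _
  have hle : ⊤ ≤ w ⁻¹ᵁ V := fun x _ => by
    have : w x ∈ Set.range hV.fromSpec := ⟨Spec.map mk x, rfl⟩
    rwa [hV.range_fromSpec] at this
  have e := SpecMap_fromSpec_appLE_top hV mk (g := w) rfl hle
  have hle' : ⊤ ≤ l ⁻¹ᵁ (σ.fiberι p ⁻¹ᵁ V) := by
    rw [← hl] at hle; exact hle
  have e1 := Scheme.Hom.appLE_comp_appLE l (σ.fiberι p) V (σ.fiberι p ⁻¹ᵁ V) ⊤ le_rfl hle'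
  rw [appLE_congr_hom hl, e, ← Scheme.Hom.app_eq_appLE] at e1
  have e3 := ConcreteCategory.congr_hom e1 b
  rw [CommRingCat.comp_apply, CommRingCat.comp_apply, hb, map_zero] at e3
  have e4 : mk b = 0 :=
    (ConcreteCategory.bijective_of_isIso (Scheme.ΓSpecIso _).inv).1 (e3.symm.trans (map_zero _).symm)
  exact Ideal.Quotient.eq_zero_iff_mem.mp e4

end Fiber

section LocalEquation

variable {X Z : Scheme.{u}}

/-- The subscheme `i : Z ⟶ X` is defined on the affine open `V` by the regular function `w`. -/
structure IsLocalEquation (i : Z ⟶ X) (V : X.Opens) (w : Γ(X, V)) : Prop where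
  affine : IsAffineOpen V
  regular : w ∈ nonZeroDivisors Γ(X, V)
  ker : ∀ V' (h : V' ≤ V), IsAffineOpen V' → ∀ g, i.app V' g = 0 ↔ resFun h w ∣ g

variable {i : Z ⟶ X} {V : X.Opens} {w : Γ(X, V)}

theorem resFun_mul_left_cancel (hV : IsAffineOpen V) (hw : w ∈ nonZeroDivisors Γ(X, V))
    {V' : X.Opens} (h : V' ≤ V) {a b : Γ(X, V')} (e : resFun h w * a = resFun h w * b) : a = b := by
  refine eq_of_basicOpen hV h fun f hf => ?_
  have := hV.isLocalization_basicOpen f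
  have h1 : resFun (X.basicOpen_le f) w ∈ nonZeroDivisors Γ(X, X.basicOpen f) :=
    IsLocalization.map_nonZeroDivisors_le (Submonoid.powers f) _ ⟨w, hw, rfl⟩
  refine (mul_cancel_left_mem_nonZeroDivisors h1).mp ?_
  have := congrArg (resFun hf) e
  rwa [map_mul, map_mul, resFun_resFun] at this

theorem IsLocalEquation.mul_left_cancel (hw : IsLocalEquation i V w) {V' : X.Opens} (h : V' ≤ V)
    {a b : Γ(X, V')} (e : resFun h w * a = resFun h w * b) : a = b :=
  resFun_mul_left_cancel hw.affine hw.regular h e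

/-- The definition gives divisibility on affine opens only. Quotients by a regular function are
unique, so they glue over any open. -/
theorem IsLocalEquation.exists_eq_mul (hw : IsLocalEquation i V w) {V' : X.Opens} (h : V' ≤ V)
    {g : Γ(X, V')} (hg : i.app V' g = 0) : ∃ g', g = resFun h w * g' := by
  obtain ⟨(g' : Γ(X, V')), hg'⟩ := exists_of_local (M := structureModule X) (V := V')
    (fun O hO (u : Γ(X, O)) => resFun hO g = resFun (hO.trans h) w * u)
    (fun {O O'} hO hO' (u : Γ(X, O)) hu =>
      ((resFun_resFun hO hO' g).symm.trans (congrArg (resFun hO') hu)).trans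
        ((map_mul (resFun hO') _ u).trans
          (congrArg (· * resFun hO' u) (resFun_resFun _ hO' w))))
    (fun O hO u u' hu hu' => hw.mul_left_cancel (hO.trans h) (hu.symm.trans hu'))
    (fun x hx => by
      obtain ⟨f, hf, hxf⟩ := exists_basicOpen hw.affine h hx
      refine ⟨_, hf, hxf, ?_⟩
      have h1 : i.app (X.basicOpen f) (resFun hf g) = 0 := by
        have := congrArg (resFun (i.preimage_mono hf)) hg
        rw [map_zero] at this
        rw [← this]
        exact ConcreteCategory.congr_hom (i.naturality (homOfLE hf).op) g
      obtain ⟨u, hu⟩ := (hw.ker _ (X.basicOpen_le f) (hw.affine.basicOpen f) _).mp h1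
      exact ⟨u, hu⟩)
  refine ⟨g', resFun_eq_of_locally_eq fun x hx => ?_⟩
  obtain ⟨O, hO, hxO, hP⟩ := hg' x hx
  refine ⟨O, hO, hxO, ?_⟩
  exact hP.trans (((map_mul (resFun hO) (resFun h w) (g' : Γ(X, V'))).trans
    (congrArg (· * resFun hO g') (resFun_resFun h hO w))).symm)

theorem IsLocalEquation.app_mul_eq_zero (hw : IsLocalEquation i V w) {V' : X.Opens} (h : V' ≤ V)
    (g : Γ(X, V')) : i.app V' (resFun h w * g) = 0 := by
  have h1 : i.app V w = 0 := (hw.ker V le_rfl hw.affine w).mpr ⟨1, by rw [resFun_self, mul_one]⟩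
  have h2 : i.app V' (resFun h w) = 0 := by
    have := congrArg (resFun (i.preimage_mono h)) h1
    rw [map_zero] at this
    rw [← this]
    exact ConcreteCategory.congr_hom (i.naturality (homOfLE h).op) w
  rw [map_mul, h2, zero_mul]

end LocalEquation

section Charts

variable {S S' : Scheme.{u}} {k : Type u} [Field k] {s : S ⟶ Spec (CommRingCat.of k)}
  {σ : S' ⟶ S} {p : S} {U : S.Opens} {n : ℕ} {x : Fin n → Γ(S, U)}
  {θ : Fin n → Γ(tangentSheaf s, U)} {q : Γ(S, U) →+* k}

/-- The ideal of the fibre is generated by the x_j, and x_j = x_a y_j on the chart. -/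
theorem IsCentered.isLocalEquation (hx : IsCentered s p U x θ q) (hc : IsClosed {p})
    {V : S'.Opens} (hV : IsAffineOpen V) (h : V ≤ σ ⁻¹ᵁ U) {a : Fin n} {y : Fin n → Γ(S', V)}
    (hy : IsChart (σ.appLE U V h).hom x a y) :
    IsLocalEquation (σ.fiberι p) V (σ.appLE U V h (x a)) := by
  have hU := hx.coordinates.affine
  refine ⟨hV, hy.regular, fun V' h' hV' g => ⟨?_, ?_⟩⟩
  · intro hg
    have h1 := mem_map_of_fiberι_app_eq_zero hU hc hx.mem hV' (h'.trans h) hg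
    have h2 : RingHom.ker (S.evaluation U p hx.mem).hom = Ideal.span (Set.range x) := by
      rw [← hx.ker]
      ext g
      rw [RingHom.mem_ker, RingHom.mem_ker, hx.value.eq_zero]
      exact Scheme.evaluation_eq_zero_iff_notMem_basicOpen _ _ _ _
    rw [h2, Ideal.map_span, ← Set.range_comp] at h1
    have h3 : Ideal.span (Set.range ((σ.appLE U V' (h'.trans h)).hom ∘ x)) ≤
        Ideal.span {resFun h' (σ.appLE U V h (x a))} := by
      rw [Ideal.span_le]
      rintro _ ⟨j, rfl⟩
      have h4 := congrArg (resFun h') (hy.mul j)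
      rw [map_mul] at h4
      refine Ideal.mem_span_singleton.mpr ⟨_, Eq.trans ?_ h4.symm⟩
      exact (resFun_appLE σ h h' (x j)).symm
    exact Ideal.mem_span_singleton.mp (h3 h1)
  · rintro ⟨g, rfl⟩
    rw [resFun_appLE, map_mul, fiberι_app_appLE_eq_zero hU hx.mem, zero_mul]
    rw [← hx.value.eq_zero, ← RingHom.mem_ker, hx.ker]
    exact Ideal.subset_span ⟨a, rfl⟩

/-- The standard charts `V₁, …, Vₙ` of the blow-up of a point `p` with coordinates `x₁, …, xₙ`,
with the functions `y_{aj} = x_j / x_a` on `V_a`. -/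
structure IsChartCover (σ : S' ⟶ S) (p : S) (U : S.Opens) (x : Fin n → Γ(S, U))
    (V : Fin n → S'.Opens) (y : ∀ a, Fin n → Γ(S', V a)) : Prop where
  cover : ∀ z, σ z ∈ U → ∃ a, z ∈ V a
  le : ∀ a, V a ≤ σ ⁻¹ᵁ U
  chart : ∀ a, IsChart (σ.appLE U (V a) (le a)).hom x a (y a)
  equation : ∀ a, IsLocalEquation (σ.fiberι p) (V a) (σ.appLE U (V a) (le a) (x a))

theorem IsCentered.ideal_eq (hx : IsCentered s p U x θ q) (hc : IsClosed {p}) :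
    (Scheme.IdealSheafData.vanishingIdeal ⟨{p}, hc⟩).ideal ⟨U, hx.coordinates.affine⟩ =
      Ideal.span (Set.range x) := by
  rw [ideal_vanishingIdeal_eq hx.coordinates.affine hc hx.mem, ← hx.ker,
    hx.value.mem_ker hx.coordinates.affine hx.mem]

/-- A derivation takes the value 1 on x_a, and 1 ≠ 0 in Γ(S, U). -/
theorem IsCentered.ne_zero [IsIntegral S] (hx : IsCentered s p U x θ q) (a : Fin n) : x a ≠ 0 := by
  have : Nonempty U := ⟨⟨p, hx.mem⟩⟩
  intro h
  have h1 := hx.coordinates.coord.dual a a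
  rw [h, if_pos rfl, (hx.coordinates.coord.der a).zero] at h1
  exact zero_ne_one h1

theorem IsCentered.exists_isChartCover [IsIntegral S] (hx : IsCentered s p U x θ q)
    (hc : IsClosed {p}) {I : Ideal Γ(S, U)} (hI : I = Ideal.span (Set.range x))
    (hxI : ∀ a, x a ∈ I) (e : (σ ⁻¹ᵁ U).toScheme ≅ Proj (reesPiece I))
    (he : e.hom ≫ projToSpec (reesPiece I) = σ ∣_ U ≫ hx.coordinates.affine.isoSpec.hom) :
    ∃ y, IsChartCover σ p U x (fun a => chartOpen e ⟨x a, hxI a⟩) y := by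
  have : Nonempty U := ⟨⟨p, hx.mem⟩⟩
  choose hV hle y hy using fun a => exists_isChart_chartOpen hx.coordinates.affine e he hI
    (hx.ne_zero a) (hxI a)
  refine ⟨y, fun z hz => ?_, hle, hy, fun a => hx.isLocalEquation hc (hV a) (hle a) (hy a)⟩
  obtain ⟨a, -, ha⟩ := exists_mem_chartOpen e hI hxI hz
  exact ⟨a, ha⟩

/-- Away from the centre, the blow-up is locally an isomorphism. -/
theorem exists_isChart_of_notMem [IsIntegral S] (hc : IsClosed {p}) (hσ : IsBlowupAtPoint σ p hc)
    (hU : IsAffineOpen U) (hp : p ∉ U) {z : S'} (hz : σ z ∈ U) :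
    ∃ (V : S'.Opens) (hle : V ≤ σ ⁻¹ᵁ U), z ∈ V ∧ IsAffineOpen V ∧
      ∃ y : Unit → Γ(S', V), IsChart (σ.appLE U V hle).hom (fun _ => 1) () y := by
  obtain ⟨e, he⟩ := hσ.exists_iso ⟨U, hU⟩
  -- Away from p the ideal is the unit ideal. Taking 1 as its only generator, the general theory of
  -- charts covers this case as well.
  have hI : (Scheme.IdealSheafData.vanishingIdeal ⟨{p}, hc⟩).ideal ⟨U, hU⟩ =
      Ideal.span (Set.range fun _ : Unit => (1 : Γ(S, U))) := by
    rw [ideal_vanishingIdeal_eq_top hU hc hp, Set.range_const, Ideal.span_singleton_one]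
  have : Nonempty U := ⟨⟨σ z, hz⟩⟩
  have hz1 : ∀ _ : Unit, (1 : Γ(S, U)) ∈
      (Scheme.IdealSheafData.vanishingIdeal ⟨{p}, hc⟩).ideal ⟨U, hU⟩ := fun j => by
    rw [hI]; exact Ideal.subset_span ⟨(), rfl⟩
  obtain ⟨a, -, ha⟩ := exists_mem_chartOpen e hI hz1 hz
  obtain ⟨hV, hle, y, hy⟩ := exists_isChart_chartOpen hU e he hI (a := ()) one_ne_zero (hz1 ())
  exact ⟨_, hle, ha, hV, y, hy⟩

end Charts

/-! ### Lifting pulled back vector fields to a chart -/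

section ChartDerivations

/-- Since D kills z_a and z_j, the Leibniz rule for z_a y_j = z_j leaves z_a D(y_j) = 0, and z_a can
be cancelled. -/
theorem IsChart.der_eq_zero {k A B C J : Type*} [CommRing k] [CommRing A] [CommRing B]
    [CommRing C] {f : A →+* B} {z : J → A} {a : J} {y : J → B} (h : IsChart f z a y)
    {φ : k →+* B} {g : B →+* C} {D : B → C} (hD : IsDer φ g D) (h0 : ∀ r, D (f r) = 0)
    (hg : ∀ c, g (f (z a)) * c = 0 → c = 0) (b : B) : D b = 0 := by
  have hb : b ∈ Subring.closure (Set.range f ∪ Set.range y) := h.closure ▸ Subring.mem_top b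
  refine hD.ext_closure (D' := fun _ => 0) ⟨by simp, by simp, by simp⟩ ?_ hb
  rintro _ (⟨r, rfl⟩ | ⟨j, rfl⟩)
  · exact h0 r
  · refine hg _ ?_
    have := hD.mul (f (z a)) (y j)
    rw [h.mul, h0, h0, mul_zero, add_zero] at this
    exact this.symm

end ChartDerivations

section Lift

variable {X Y : Scheme.{u}} {k : CommRingCat.{u}} {f : X ⟶ Y} {t : Y ⟶ Spec k} {n : ℕ}
  {U : Y.Opens} {x : Fin n → Γ(Y, U)} {θ : Fin n → Γ(tangentSheaf t, U)} {V V' : X.Opens}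

theorem IsLocalCoordinates.evalAt_eq_sum (hx : IsLocalCoordinates t U x θ) (h : V ≤ f ⁻¹ᵁ U)
    (m : Γ((Scheme.Modules.pullback f).obj (tangentSheaf t), V)) (g : Γ(Y, U)) :
    apFun (evalAt f g) h m =
      ∑ i, apFun (evalAt f (x i)) h m * (f.appLE U V h).hom (derive (θ i) g) := by
  conv_lhs => rw [hx.eq_sum_evalAt h m, map_sum]
  refine Finset.sum_congr rfl fun i _ => ?_
  rw [map_smul, evalAt_pullbackSection f g h h, derive_res]
  exact congrArg (_ * ·) (appLE_resFun f inf_le_left (le_inf h h : V ≤ f ⁻¹ᵁ (U ⊓ U)) (derive (θ i) g))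

theorem IsLocalCoordinates.isDer_evalAt (hx : IsLocalCoordinates t U x θ) (h : V ≤ f ⁻¹ᵁ U)
    (m : Γ((Scheme.Modules.pullback f).obj (tangentSheaf t), V)) :
    IsDer (consts t U) (f.appLE U V h).hom fun g => apFun (evalAt f g) h m := by
  have := hx.coord.isDer_sum (f.appLE U V h).hom fun i => apFun (evalAt f (x i)) h m
  simpa only [← hx.evalAt_eq_sum h m] using this

variable {J : Type*} {z : J → Γ(Y, U)} {a : J} {y : J → Γ(X, V)}

/-- This is the injectivity of the differential on a chart: a zero image means that D kills all
functions coming from Y. -/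
theorem eq_zero_of_isImage_zero (hV : IsAffineOpen V) (h : V ≤ f ⁻¹ᵁ U) (hy : IsChart (f.appLE U V h).hom z a y) (h' : V' ≤ V)
    {D : Γ(tangentSheaf (f ≫ t), V')} (hD : IsImage f t V' D 0) : D = 0 := by
  refine tangent_ext_affine hV h' fun g => ?_
  have h1 : IsDer (consts (f ≫ t) V) (resFun h') (derive D ∘ resFun h') :=
    (isDer_derive D).precomp (resFun h') (resFun_consts (f ≫ t) h')
  refine hy.der_eq_zero h1 (fun r => ?_) (fun c hc => ?_) g
  · have := isImage_evalAt hD (h'.trans h) r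
    rw [map_zero, ← resFun_appLE f h h'] at this
    exact this.symm
  · exact resFun_mul_left_cancel hV hy.regular h' (hc.trans (mul_zero _).symm)

/-- A pulled back vector field on a basic open of a chart of the blow-up comes from a vector field
if the quotient rule defines its values on the coordinates of the chart. -/
theorem IsLocalCoordinates.exists_isImage (hx : IsLocalCoordinates t U x θ)
    (hV : IsAffineOpen V) (h : V ≤ f ⁻¹ᵁ U) (hy : IsChart (f.appLE U V h).hom z a y) (r : Γ(X, V))
    (m : Γ((Scheme.Modules.pullback f).obj (tangentSheaf t), X.basicOpen r))
    (v : J → Γ(X, X.basicOpen r))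
    (hv : ∀ j, f.appLE U _ ((X.basicOpen_le r).trans h) (z a) * v j =
      apFun (evalAt f (z j)) ((X.basicOpen_le r).trans h) m - resFun (X.basicOpen_le r) (y j) *
        apFun (evalAt f (z a)) ((X.basicOpen_le r).trans h) m) :
    ∃ D, IsImage f t _ D m := by
  have hle := X.basicOpen_le r
  have hD : IsDer (consts t U) ((resFun hle).comp (f.appLE U V h).hom)
      fun g => apFun (evalAt f g) (hle.trans h) m := by
    have := hx.isDer_evalAt (hle.trans h) m
    convert this using 1
    exact RingHom.ext fun g => resFun_appLE f h hle g
  obtain ⟨D', hD', hDf, -⟩ := hD.exists_extend hy.injective (z a) z y hy.mul hy.closure hy.pow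
    (C := Γ(X, X.basicOpen r)) (by
      have := hV.isLocalization_basicOpen r
      exact IsLocalization.map_nonZeroDivisors_le (Submonoid.powers r) _ ⟨_, hy.regular, rfl⟩) v
    (fun j => by rw [← hv, ← resFun_appLE f h hle])
  have e : (f.appLE U V h).hom.comp (consts t U) = consts (f ≫ t) V :=
    RingHom.ext fun c => appLE_consts f h c
  rw [e] at hD'
  obtain ⟨D'', hD'', hDD⟩ := exists_isDer_basicOpen (s := f ≫ t) hV r (g := RingHom.id _) hD'
  obtain ⟨D, hDd⟩ := exists_tangent_affine (s := f ≫ t) (hV.basicOpen r) hD''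
  have hI := hx.isImage (hle.trans h) D
  refine ⟨D, ?_⟩
  convert hI
  refine hx.evalAt_ext (hle.trans h) fun i => ?_
  rw [isImage_evalAt hI, hDd, ← resFun_appLE f h hle, hDD]
  exact (hDf (x i)).symm

end Lift

/-! ### Euler frames and the map to the cokernel -/

section EulerFrame

/-- Sections `c₁, …, cₙ` which generate `C` with the relations generated by the Euler relation
`∑ y_{aj} c_j = 0` on the preimages of the `V_a`. -/
structure IsEulerFrame {X Z : Scheme.{u}} (i : Z ⟶ X) {n : ℕ} (V : Fin n → X.Opens)
    (y : ∀ a, Fin n → Γ(X, V a)) (C : Z.Modules) (c : Fin n → Γ(C, ⊤)) : Prop where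
  relation : ∀ a W (h : W ≤ i ⁻¹ᵁ V a),
    ∑ j, i.appLE (V a) W h (y a j) • res C (le_top : W ≤ ⊤) (c j) = 0
  indep : ∀ a W (h : W ≤ i ⁻¹ᵁ V a) (b : Fin n → Γ(Z, W)),
    ∑ j, b j • res C (le_top : W ≤ ⊤) (c j) = 0 → ∀ j, b j = i.appLE (V a) W h (y a j) * b a
  span : ∀ W (m : Γ(C, W)), ∀ z ∈ W, ∃ (O : Z.Opens) (h : O ≤ W), z ∈ O ∧
    ∃ b : Fin n → Γ(Z, O), res C h m = ∑ j, b j • res C (le_top : O ≤ ⊤) (c j)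

variable {X Y Z : Scheme.{u}} {k : CommRingCat.{u}} (f : X ⟶ Y) (t : Y ⟶ Spec k) {n : ℕ}
  {U : Y.Opens} (x : Fin n → Γ(Y, U)) (i : Z ⟶ X) (hZ : ⊤ ≤ i ⁻¹ᵁ (f ⁻¹ᵁ U)) {C : Z.Modules}
  (c : Fin n → Γ(C, ⊤))

variable {f i} in
theorem preimage_le_preimage_inf (hZ : ⊤ ≤ i ⁻¹ᵁ (f ⁻¹ᵁ U)) (V : X.Opens) :
    i ⁻¹ᵁ V ≤ i ⁻¹ᵁ (V ⊓ f ⁻¹ᵁ U) := fun _ hz => ⟨hz, hZ trivial⟩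

/-- The value of `frameMap` on a section `m` over `V`. -/
def frameSum (V : X.Opens) (m : Γ((Scheme.Modules.pullback f).obj (tangentSheaf t), V)) :
    Γ(C, i ⁻¹ᵁ V) :=
  -- The x_j exist only over `U`; since Z lies over `U`, nothing is lost by restricting m to V ∩
  -- f⁻¹U.
  ∑ j, i.appLE (V ⊓ f ⁻¹ᵁ U) (i ⁻¹ᵁ V) (preimage_le_preimage_inf hZ V)
    (apFun (evalAt f (x j)) inf_le_right (res _ inf_le_left m)) •
      res C (le_top : i ⁻¹ᵁ V ≤ ⊤) (c j)

theorem frameSum_add (V : X.Opens)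
    (m m' : Γ((Scheme.Modules.pullback f).obj (tangentSheaf t), V)) :
    frameSum f t x i hZ c V (m + m') = frameSum f t x i hZ c V m + frameSum f t x i hZ c V m' := by
  simp only [frameSum, res_add, map_add, add_smul, Finset.sum_add_distrib]

theorem frameSum_smul (V : X.Opens) (r : Γ(X, V))
    (m : Γ((Scheme.Modules.pullback f).obj (tangentSheaf t), V)) :
    frameSum f t x i hZ c V (r • m) = i.app V r • frameSum f t x i hZ c V m := by
  have e : i.appLE (V ⊓ f ⁻¹ᵁ U) (i ⁻¹ᵁ V) (preimage_le_preimage_inf hZ V)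
      (resFun inf_le_left r) = i.app V r :=
    (appLE_resFun i inf_le_left _ r).trans (by rw [Scheme.Hom.app_eq_appLE])
  simp only [frameSum, res_smul, map_smul, smul_eq_mul, map_mul, mul_smul, ← Finset.smul_sum, e]

theorem res_frameSum {V W : X.Opens} (h : W ≤ V)
    (m : Γ((Scheme.Modules.pullback f).obj (tangentSheaf t), V)) :
    res C (i.preimage_mono h) (frameSum f t x i hZ c V m) =
      frameSum f t x i hZ c W (res _ h m) := by
  refine (res_sum _ _ _ _).trans (Finset.sum_congr rfl fun j _ => ?_)
  rw [res_smul, res_res, resFun_appLE, ← appLE_resFun i (inf_le_inf_right _ h)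
    (preimage_le_preimage_inf hZ W), resFun_apFun, res_res, res_res]

/-- The morphism `f^*𝒯_Y ⟶ i_*C` which sends `∂/∂x_j` to `c_j`. -/
def frameMap : (Scheme.Modules.pullback f).obj (tangentSheaf t) ⟶
    (Scheme.Modules.pushforward i).obj C :=
  mkHom (fun V =>
    { toFun := frameSum f t x i hZ c V
      map_add' := frameSum_add f t x i hZ c V
      map_smul' := frameSum_smul f t x i hZ c V })
    (fun h m => res_frameSum f t x i hZ c h m)

variable {f x i c} {V : X.Opens}

theorem frameSum_eq (h : V ≤ f ⁻¹ᵁ U)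
    (m : Γ((Scheme.Modules.pullback f).obj (tangentSheaf t), V)) :
    frameSum f t x i hZ c V m =
      ∑ j, i.app V (apFun (evalAt f (x j)) h m) • res C (le_top : i ⁻¹ᵁ V ≤ ⊤) (c j) := by
  refine Finset.sum_congr rfl fun j _ => congrArg
    (fun r : Γ(Z, i ⁻¹ᵁ V) => r • res C (le_top : i ⁻¹ᵁ V ≤ ⊤) (c j)) ?_
  rw [← resFun_apFun (evalAt f (x j)) h inf_le_left, appLE_resFun i inf_le_left,
    Scheme.Hom.app_eq_appLE]

theorem frameMap_app (m : Γ((Scheme.Modules.pullback f).obj (tangentSheaf t), V)) :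
    (frameMap f t x i hZ c).app V m = frameSum f t x i hZ c V m := rfl

end EulerFrame

/-! ### Exactness for an arbitrary Euler frame -/

section Exactness

variable {S S' : Scheme.{u}} {k : Type u} [Field k] {s : S ⟶ Spec (CommRingCat.of k)}
  {σ : S' ⟶ S} {p : S} {U : S.Opens} {n : ℕ} {x : Fin n → Γ(S, U)}
  {θ : Fin n → Γ(tangentSheaf s, U)} {q : Γ(S, U) →+* k} {V : Fin n → S'.Opens}
  {y : ∀ a, Fin n → Γ(S', V a)}

theorem top_le_preimage_fiberι (σ : S' ⟶ S) (hp : p ∈ U) :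
    (⊤ : (σ.fiber p).Opens) ≤ σ.fiberι p ⁻¹ᵁ (σ ⁻¹ᵁ U) := fun e _ =>
  (iff_of_eq (congrArg (· ∈ U) (apply_fiberι e))).mpr hp

theorem eq_of_preimage_fiberι {C : (σ.fiber p).Modules} {W : S'.Opens}
    (hW : ∀ z ∈ W, σ z ≠ p) (m m' : Γ(C, σ.fiberι p ⁻¹ᵁ W)) : m = m' :=
  eq_of_locally_eq fun e he => absurd (apply_fiberι e) (hW _ he)

theorem exists_open_of_ne (hc : IsClosed {p}) {W : S'.Opens} {z : S'} (hz : z ∈ W) (hp : σ z ≠ p) :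
    ∃ W' ≤ W, z ∈ W' ∧ ∀ z' ∈ W', σ z' ≠ p :=
  ⟨W ⊓ σ ⁻¹ᵁ ⟨{p}ᶜ, hc.isOpen_compl⟩, inf_le_left, ⟨hz, hp⟩, fun _ h => h.2⟩

theorem exists_coordinates_of_ne [IsIntegral S] [SmoothOfRelativeDimension n s] (hc : IsClosed {p})
    (hσ : IsBlowupAtPoint σ p hc) {z : S'} (hz : σ z ≠ p) :
    ∃ (U : S.Opens) (x : Fin n → Γ(S, U)) (θ : Fin n → Γ(tangentSheaf s, U)) (W : S'.Opens)
      (h : W ≤ σ ⁻¹ᵁ U) (y : Unit → Γ(S', W)), IsLocalCoordinates s U x θ ∧ z ∈ W ∧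
      IsAffineOpen W ∧ IsChart (σ.appLE U W h).hom (fun _ => 1) () y := by
  obtain ⟨U, x, θ, hzU, hU, hx⟩ := exists_coordinate_neighborhood (s := s) (n := n) (σ z)
    ⟨{p}ᶜ, hc.isOpen_compl⟩ hz
  obtain ⟨W, h, hzW, hW, y, hy⟩ := exists_isChart_of_notMem hc hσ hx.affine
    (fun hp => hU hp rfl) hzU
  exact ⟨U, x, θ, W, h, y, hx, hzW, hW, hy⟩

/-- From x_j = x_a y_{aj} follows D(x_j) = y_{aj} D(x_a) + x_a D(y_{aj}), where the last term
vanishes on E. So the sum ∑ D(x_j) c_j is D(x_a) times the Euler relation. -/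
theorem frameSum_eq_zero_of_isImage (hp : p ∈ U) (hV : IsChartCover σ p U x V y)
    {C : (σ.fiber p).Modules} {c : Fin n → Γ(C, ⊤)} (hC : IsEulerFrame (σ.fiberι p) V y C c)
    {W : S'.Opens} {D : Γ(tangentSheaf (σ ≫ s), W)}
    {m : Γ((Scheme.Modules.pullback σ).obj (tangentSheaf s), W)} (hm : IsImage σ s W D m) :
    frameSum σ s x (σ.fiberι p) (top_le_preimage_fiberι σ hp) c W m = 0 := by
  refine eq_of_locally_eq fun e he => ?_
  obtain ⟨a, ha⟩ := hV.cover (σ.fiberι p e) (top_le_preimage_fiberι σ hp trivial)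
  have hWa : W ⊓ V a ≤ V a := inf_le_right
  have hWW : W ⊓ V a ≤ W := inf_le_left
  refine ⟨σ.fiberι p ⁻¹ᵁ (W ⊓ V a), (σ.fiberι p).preimage_mono hWW, ⟨he, ha⟩, ?_⟩
  have h0 : W ⊓ V a ≤ σ ⁻¹ᵁ U := hWa.trans (hV.le a)
  have h1 := fun j => hm U _ hWW h0 (x j)
  have h2 : ∀ j, (σ.fiberι p).app _ (derive (res _ hWW D) (σ.appLE U (W ⊓ V a) h0 (x j))) =
      (σ.fiberι p).app _ (derive (res _ hWW D) (σ.appLE U (W ⊓ V a) h0 (x a))) *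
        (σ.fiberι p).appLE (V a) (σ.fiberι p ⁻¹ᵁ (W ⊓ V a)) ((σ.fiberι p).preimage_mono hWa) (y a j) := fun j => by
    have h3 := congrArg (resFun hWa) ((hV.chart a).mul j)
    rw [map_mul] at h3
    have h4 : ∀ j, resFun hWa ((σ.appLE U (V a) (hV.le a)).hom (x j)) =
      σ.appLE U (W ⊓ V a) h0 (x j) := fun j => resFun_appLE σ (hV.le a) hWa (x j)
    have h5 := (hV.equation a).app_mul_eq_zero hWa
      (derive (res _ hWW D) (resFun hWa (y a j)))
    have h6 : (σ.fiberι p).app (W ⊓ V a) (resFun hWa (y a j)) =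
        (σ.fiberι p).appLE (V a) (σ.fiberι p ⁻¹ᵁ (W ⊓ V a)) ((σ.fiberι p).preimage_mono hWa) (y a j) := by
      rw [Scheme.Hom.app_eq_appLE, appLE_resFun]
    rw [← h4 j, ← h3, (isDer_derive _).mul, RingHom.id_apply, RingHom.id_apply, map_add]
    rw [← h6, ← h4 a, map_mul ((σ.fiberι p).app (W ⊓ V a)).hom (resFun hWa (y a j)), mul_comm ((σ.fiberι p).app _ _)]
    exact (congrArg (· + _) h5).trans (zero_add _)
  rw [res_frameSum σ s x _ _ c hWW, frameSum_eq s (top_le_preimage_fiberι σ hp) h0, res_zero]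
  refine (Finset.sum_congr rfl fun j _ => ?_).trans (Finset.smul_sum.symm.trans
    ((congrArg _ (hC.relation a _ ((σ.fiberι p).preimage_mono hWa))).trans (smul_zero
      ((σ.fiberι p).app _ (derive (res _ hWW D) (σ.appLE U (W ⊓ V a) h0 (x a)))))))
  rw [h1, h2, mul_smul]

/-- At a point of E, a pulled back field m maps to zero if and only if m_j - y_{aj} m_a is divisible
by x_a for every j, which is the condition for lifting m along the quotient rule. At other points
the target vanishes locally and the chart is the trivial one. -/
theorem isShortExact_frameMap [IsIntegral S] [SmoothOfRelativeDimension n s] (hc : IsClosed {p})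
    (hσ : IsBlowupAtPoint σ p hc) (hx : IsCentered s p U x θ q) (hV : IsChartCover σ p U x V y)
    {dσ : tangentSheaf (σ ≫ s) ⟶ (Scheme.Modules.pullback σ).obj (tangentSheaf s)}
    (hd : ∀ W D, IsImage σ s W D (dσ.app W D)) {C : (σ.fiber p).Modules} {c : Fin n → Γ(C, ⊤)}
    (hC : IsEulerFrame (σ.fiberι p) V y C c) :
    IsShortExact dσ (frameMap σ s x (σ.fiberι p) (top_le_preimage_fiberι σ hx.mem) c) := by
  have huniq : ∀ W (m m' : Γ((Scheme.Modules.pullback σ).obj (tangentSheaf s), W)) D,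
      IsImage σ s W D m → IsImage σ s W D m' → m = m' := fun W m m' D h h' =>
    eq_of_locally_eq fun z hz => by
      obtain ⟨U, x, θ, hzU, -, hx⟩ := exists_coordinate_neighborhood (s := s) (n := n) (σ z) ⊤ trivial
      refine ⟨W ⊓ σ ⁻¹ᵁ U, inf_le_left, ⟨hz, hzU⟩, hx.evalAt_ext inf_le_right fun i => ?_⟩
      rw [h U _ inf_le_left inf_le_right (x i), h' U _ inf_le_left inf_le_right (x i)]
  refine isShortExact_of_local _ _ (fun W D hD => ?_) (fun W D => ?_) (fun W m hm z hz => ?_)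
    (fun W m z hz => ?_)
  · refine eq_of_locally_eq fun z hz => ?_
    -- The charts along E and the trivial charts off E are handled by the same argument.
    have key : ∀ (U : S.Opens) (V : S'.Opens) (h : V ≤ σ ⁻¹ᵁ U) (J : Type) (zs : J → Γ(S, U)) (a : J)
        (y : J → Γ(S', V)), z ∈ V → IsAffineOpen V → IsChart (σ.appLE U V h).hom zs a y →
        ∃ (O : S'.Opens) (hO : O ≤ W), z ∈ O ∧ res _ hO D = res _ hO 0 :=
      fun U V h J zs a y hzV hV hy => by
        refine ⟨W ⊓ V, inf_le_left, ⟨hz, hzV⟩, ?_⟩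
        rw [res_zero]
        refine eq_zero_of_isImage_zero hV h hy inf_le_right ?_
        have := hd (W ⊓ V) (res _ inf_le_left D)
        rwa [app_res, hD, res_zero] at this
    by_cases hp : σ z = p
    · obtain ⟨a, ha⟩ := hV.cover z (hp ▸ hx.mem)
      exact key U (V a) (hV.le a) _ x a (y a) ha (hV.equation a).affine (hV.chart a)
    · obtain ⟨U', x', θ', W', h', y', -, hzW', hW', hy'⟩ :=
        exists_coordinates_of_ne (n := n) (s := s) hc hσ hp
      exact key U' W' h' _ _ () y' hzW' hW' hy'
  · exact frameSum_eq_zero_of_isImage hx.mem hV hC (hd W D)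
  · have hm0 : ∀ (O : S'.Opens) (hO : O ≤ W),
        frameSum σ s x (σ.fiberι p) (top_le_preimage_fiberι σ hx.mem) c O (res _ hO m) = 0 :=
      fun O hO => by
        rw [← res_frameSum, ← frameMap_app, hm]
        exact res_zero C ((σ.fiberι p).preimage_mono hO)
    by_cases hp : σ z = p
    · obtain ⟨a, ha⟩ := hV.cover z (hp ▸ hx.mem)
      obtain ⟨r, hr, hzr⟩ := exists_basicOpen (hV.equation a).affine (W := W ⊓ V a)
        inf_le_right ⟨hz, ha⟩
      have hrW : S'.basicOpen r ≤ W := hr.trans inf_le_left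
      have hrV := S'.basicOpen_le r
      have h0 := hm0 _ hrW
      rw [frameSum_eq s _ (hrV.trans (hV.le a))] at h0
      -- Independence of the frame modulo the Euler relation says m_j = y_{aj} m_a on E; dividing
      -- the difference by x_a yields the value v_j required of D(y_{aj}).
      have h1 := hC.indep a _ ((σ.fiberι p).preimage_mono hrV) _ h0
      have h2 : ∀ j, ∃ v, apFun (evalAt σ (x j)) (hrV.trans (hV.le a)) (res _ hrW m) -
          resFun hrV (y a j) * apFun (evalAt σ (x a)) (hrV.trans (hV.le a)) (res _ hrW m) =
          resFun hrV (σ.appLE U (V a) (hV.le a) (x a)) * v := fun j =>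
        (hV.equation a).exists_eq_mul hrV (by
          rw [map_sub, map_mul, h1 j, sub_eq_zero]
          refine congrArg (· * _) ?_
          rw [Scheme.Hom.app_eq_appLE, appLE_resFun])
      choose v hv using h2
      obtain ⟨D, hD⟩ := hx.coordinates.exists_isImage (hV.equation a).affine (hV.le a) (hV.chart a)
        r (res _ hrW m) v (fun j => by rw [hv, resFun_appLE])
      exact ⟨_, hrW, hzr, D, huniq _ _ _ D (hd _ D) hD⟩
    · obtain ⟨U', x', θ', W', h', y', hx', hzW', hW', hy'⟩ :=
        exists_coordinates_of_ne (n := n) (s := s) hc hσ hp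
      obtain ⟨r, hr, hzr⟩ := exists_basicOpen hW' (W := W ⊓ W') inf_le_right ⟨hz, hzW'⟩
      have hrW : S'.basicOpen r ≤ W := hr.trans inf_le_left
      -- Here the chart has z = 1, on which m takes the value 0, so v = 0 solves the quotient rule.
      have h0 := (hx'.isDer_evalAt ((S'.basicOpen_le r).trans h') (res _ hrW m)).one
      obtain ⟨D, hD⟩ := hx'.exists_isImage hW' h' hy' r (res _ hrW m) (fun _ => 0)
        (fun j => by rw [h0]; ring)
      exact ⟨_, hrW, hzr, D, huniq _ _ _ D (hd _ D) hD⟩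
  · by_cases hp : σ z = p
    · have hzr : z ∈ Set.range (σ.fiberι p) := by rw [σ.range_fiberι]; exact hp
      obtain ⟨e, rfl⟩ := hzr
      obtain ⟨O, hO, heO, b, hb⟩ := hC.span _ m e hz
      obtain ⟨O', hO', hOO'⟩ := (σ.fiberι p).isEmbedding.isInducing.isOpen_iff.mp O.isOpen
      obtain ⟨a, ha⟩ := hV.cover (σ.fiberι p e) (top_le_preimage_fiberι σ hx.mem trivial)
      have heO' : σ.fiberι p e ∈ O' := by
        have : e ∈ (σ.fiberι p) ⁻¹' O' := hOO' ▸ heO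
        exact this
      -- The open O of E is induced by an open O' of S'. Inside a basic open contained in O', E is a
      -- closed subscheme of an affine scheme, so the coefficients b_j extend.
      obtain ⟨r, hr, hzr⟩ := exists_basicOpen (hV.equation a).affine (W := (W ⊓ V a) ⊓ ⟨O', hO'⟩)
        (inf_le_left.trans inf_le_right) ⟨⟨hz, ha⟩, heO'⟩
      have hrW : S'.basicOpen r ≤ W := (hr.trans inf_le_left).trans inf_le_left
      have hrU := (S'.basicOpen_le r).trans (hV.le a)
      have hrO : σ.fiberι p ⁻¹ᵁ S'.basicOpen r ≤ O := fun e' he' => by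
        have h1 : e' ∈ (σ.fiberι p) ⁻¹' O' := (hr he').2
        rw [hOO'] at h1
        exact h1
      choose b' hb' using fun j => fiberι_app_surjective (σ := σ) hc
        ((hV.equation a).affine.basicOpen r) (resFun hrO (b j))
      refine ⟨_, hrW, hzr, ∑ j, b' j • pullbackSection σ _ hrU (θ j), ?_⟩
      rw [frameMap_app, frameSum_eq s _ hrU]
      simp only [hx.coordinates.evalAt_sum, hb']
      refine Eq.trans ?_ (res_res C hO hrO m)
      rw [hb, res_sum]
      exact Finset.sum_congr rfl fun j _ => by rw [res_smul, res_res]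
    · obtain ⟨W', hW', hzW', hp'⟩ := exists_open_of_ne hc hz hp
      exact ⟨W', hW', hzW', 0, eq_of_preimage_fiberι hp' _ _⟩

end Exactness

/-! ### The sheaf 𝒪(E) in terms of a local equation -/

section Divisor

variable {X Z : Scheme.{u}} {i : Z ⟶ X} {V W : X.Opens} {w : Γ(X, V)}

/-- A function in the ideal of `Z`, as a section of the ideal sheaf. -/
def idealSection (g : Γ(X, V)) (hg : i.app V g = 0) : (idealPresheaf i).presheaf.obj (op V) :=
  ⟨g, hg⟩

/-- The value of a section of `𝒪_X(Z)` on a function in the ideal of `Z`. -/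
def divisorValue (φ : Γ(divisorSheaf i, V)) (g : Γ(X, V)) (hg : i.app V g = 0) : Γ(X, V) :=
  evalHom (M := idealPresheaf i) (N := structureModule X) φ (idealSection g hg)

theorem app_resFun_eq_zero {g : Γ(X, V)} (hg : i.app V g = 0) (h : W ≤ V) :
    i.app W (resFun h g) = 0 := by
  have := congrArg (resFun (i.preimage_mono h)) hg
  rw [map_zero] at this
  rw [← this]
  exact ConcreteCategory.congr_hom (i.naturality (homOfLE h).op) g

theorem divisorValue_res (h : W ≤ V) (φ : Γ(divisorSheaf i, V)) (g : Γ(X, V))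
    (hg : i.app V g = 0) :
    divisorValue (res _ h φ) (resFun h g) (app_resFun_eq_zero hg h) =
      resFun h (divisorValue φ g hg) := by
  exact ((show homOn (idealPresheaf i) (structureModule X) V from φ).2 ⟨V, le_rfl⟩ ⟨W, h⟩
    (homOfLE h) (idealSection g hg)).symm

theorem divisorValue_smul (r : Γ(X, V)) (φ : Γ(divisorSheaf i, V)) (g : Γ(X, V))
    (hg : i.app V g = 0) : divisorValue (r • φ) g hg = r * divisorValue φ g hg :=
  congrArg (· * divisorValue φ g hg) (resFun_self le_rfl r)

theorem divisorValue_mul (φ : Γ(divisorSheaf i, V)) (r g : Γ(X, V))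
    (hg : i.app V g = 0) (hrg : i.app V (r * g) = 0) :
    divisorValue φ (r * g) hrg = r * divisorValue φ g hg :=
  map_smul ((show homOn (idealPresheaf i) (structureModule X) V from φ).1 ⟨V, le_rfl⟩) r
    (idealSection g hg)

theorem IsLocalEquation.app_resFun (hw : IsLocalEquation i V w) (h : W ≤ V) :
    i.app W (resFun h w) = 0 := by
  simpa using hw.app_mul_eq_zero h 1

/-- Every function in the ideal is a multiple of w, so a linear functional on the ideal is
determined by its value on w. -/
theorem IsLocalEquation.divisor_ext (hw : IsLocalEquation i V w) (h : W ≤ V)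
    {φ ψ : Γ(divisorSheaf i, W)} (H : divisorValue φ (resFun h w) (hw.app_resFun h) =
      divisorValue ψ (resFun h w) (hw.app_resFun h)) : φ = ψ := by
  refine Subtype.ext (funext fun W' => LinearMap.ext fun g => ?_)
  obtain ⟨W', hW'⟩ := W'
  obtain ⟨(g : Γ(X, W')), (hg : i.app W' g = 0)⟩ := g
  change divisorValue (res _ hW' φ) g hg = divisorValue (res _ hW' ψ) g hg
  obtain ⟨g', rfl⟩ := hw.exists_eq_mul (hW'.trans h) hg
  have key : ∀ φ : Γ(divisorSheaf i, W), divisorValue (res _ hW' φ) _ hg =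
      g' * resFun hW' (divisorValue φ (resFun h w) (hw.app_resFun h)) := fun φ => by
    rw [← divisorValue_res]
    simp only [mul_comm _ g', resFun_resFun]
    exact divisorValue_mul _ _ _ _ _
  rw [key, key, H]

/-- The section `1 / w` of `𝒪_X(Z)`, for a local equation `w` of `Z`. -/
theorem IsLocalEquation.exists_divisorSection (hw : IsLocalEquation i V w) :
    ∃ ω : Γ(divisorSheaf i, V), ∀ h, divisorValue ω w h = 1 := by
  choose d hd using fun (W : X.Opens) (h : W ≤ V) (g : Γ(X, W)) (hg : i.app W g = 0) =>
    hw.exists_eq_mul h hg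
  let ω : homOn (idealPresheaf i) (structureModule X) V :=
    ⟨fun W =>
      { toFun := fun g => d W.1 W.2 g.1 g.2
        map_add' := fun g g' => hw.mul_left_cancel W.2 (by
          refine (hd _ _ _ _).symm.trans (Eq.trans ?_
            (mul_add (resFun W.2 w : Γ(X, W.1)) (d _ W.2 _ g.2) (d _ W.2 _ g'.2)).symm)
          exact congrArg₂ (· + ·) (hd _ W.2 _ g.2) (hd _ W.2 _ g'.2))
        map_smul' := fun r g => hw.mul_left_cancel W.2 (by
          refine (hd _ _ _ _).symm.trans ?_
          refine (congrArg (r * ·) (hd _ W.2 _ g.2)).trans (mul_left_comm _ _ _)) },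
      fun W W' j g => hw.mul_left_cancel W'.2 (by
        refine Eq.trans ?_ (hd _ _ _ _)
        refine Eq.trans ?_ (congrArg (resFun j.le) (hd _ W.2 _ g.2)).symm
        rw [map_mul, resFun_resFun]
        rfl)⟩
  refine ⟨ω, fun h => hw.mul_left_cancel le_rfl ?_⟩
  refine (hd V le_rfl w h).symm.trans ?_
  rw [resFun_self, mul_one]

/-- A functional φ on the ideal equals φ(w) times the functional 1/w. -/
theorem IsLocalEquation.isBasisOn (hw : IsLocalEquation i V w) {ω : Γ(divisorSheaf i, V)}
    (hω : ∀ h, divisorValue ω w h = 1) : IsBasisOn (divisorSheaf i) V fun _ : Unit => ω := by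
  have key : ∀ (W : X.Opens) (h : W ≤ V) (r : Γ(X, W)),
      divisorValue (r • res _ h ω) (resFun h w) (hw.app_resFun h) = r := fun W h r => by
    have h1 : i.app V w = 0 := by
      have := hw.app_resFun le_rfl
      rwa [resFun_self] at this
    rw [divisorValue_smul, divisorValue_res h ω w h1, hω, map_one, mul_one]
  refine ⟨fun W h c hc j => ?_, fun W h m => ⟨fun _ => divisorValue m _ (hw.app_resFun h), ?_⟩⟩
  · rw [Fintype.sum_unique] at hc
    have h1 := key W h (c default)
    rw [hc] at h1
    exact h1.symm
  · rw [Fintype.sum_unique]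
    exact hw.divisor_ext h (key W h _).symm

end Divisor

/-! ### Vector fields on the exceptional divisor -/

section ExceptionalFields

variable {S S' : Scheme.{u}} {k : Type u} [Field k] {s : S ⟶ Spec (CommRingCat.of k)}
  {σ : S' ⟶ S} {p : S} {U : S.Opens} {n : ℕ} {x : Fin n → Γ(S, U)}
  {θ : Fin n → Γ(tangentSheaf s, U)} {q : Γ(S, U) →+* k} {V : Fin n → S'.Opens}
  {y : ∀ a, Fin n → Γ(S', V a)}

theorem IsChartCover.self (hV : IsChartCover σ p U x V y) (a : Fin n) : y a a = 1 :=
  (mul_cancel_left_mem_nonZeroDivisors (hV.chart a).regular).mp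
    (((hV.chart a).mul a).trans (mul_one _).symm)

/-- This is (x_b / x_a)(x_j / x_b) = x_j / x_a, verified after multiplication by the regular
function x_a. -/
theorem IsChartCover.mul_eq (hV : IsChartCover σ p U x V y) (a b j : Fin n) {W : S'.Opens}
    (ha : W ≤ V a) (hb : W ≤ V b) :
    resFun ha (y a b) * resFun hb (y b j) = resFun ha (y a j) := by
  refine (hV.equation a).mul_left_cancel ha ?_
  have h1 := fun j => congrArg (resFun ha) ((hV.chart a).mul j)
  have h2 := congrArg (resFun hb) ((hV.chart b).mul j)
  simp only [map_mul] at h1 h2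
  rw [← mul_assoc]
  refine (congrArg (· * _) (h1 b)).trans ?_
  refine Eq.trans ?_ (h1 j).symm
  have h3 : ∀ j, resFun ha ((σ.appLE U (V a) (hV.le a)).hom (x j)) =
      resFun hb ((σ.appLE U (V b) (hV.le b)).hom (x j)) := fun j =>
    (resFun_appLE σ (hV.le a) ha (x j)).trans (resFun_appLE σ (hV.le b) hb (x j)).symm
  rw [h3, h3]
  exact h2

theorem IsChartCover.appLE_mul_eq (hV : IsChartCover σ p U x V y) (a b j : Fin n)
    {W : (σ.fiber p).Opens} (ha : W ≤ σ.fiberι p ⁻¹ᵁ V a) (hb : W ≤ σ.fiberι p ⁻¹ᵁ V b) :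
    (σ.fiberι p).appLE (V a) W ha (y a b) * (σ.fiberι p).appLE (V b) W hb (y b j) =
      (σ.fiberι p).appLE (V a) W ha (y a j) := by
  have hab : W ≤ σ.fiberι p ⁻¹ᵁ (V a ⊓ V b) := le_inf ha hb
  have h := congrArg ((σ.fiberι p).appLE (V a ⊓ V b) W hab)
    (hV.mul_eq a b j inf_le_left inf_le_right)
  rw [map_mul] at h
  rwa [appLE_resFun, appLE_resFun, appLE_resFun] at h

/-- The function r - r(p) vanishes at p, hence on E: functions pulled back from S are constant
there. -/
theorem IsCentered.fiberι_appLE_appLE (hx : IsCentered s p U x θ q) {V : S'.Opens}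
    (h : V ≤ σ ⁻¹ᵁ U) (r : Γ(S, U)) :
    (σ.fiberι p).app V (σ.appLE U V h r) =
      consts (σ.fiberι p ≫ σ ≫ s) (σ.fiberι p ⁻¹ᵁ V) (q r) := by
  rw [← appLE_consts (σ.fiberι p) (t := σ ≫ s) (U := V) le_rfl, ← appLE_consts σ (t := s) h,
    ← Scheme.Hom.app_eq_appLE, ← sub_eq_zero, ← map_sub, ← map_sub]
  refine fiberι_app_appLE_eq_zero hx.coordinates.affine hx.mem h ?_
  rw [← hx.value.eq_zero, map_sub, hx.value.const, sub_self]

theorem isAffineOpen_preimage_fiberι (hc : IsClosed {p}) {V : S'.Opens} (hV : IsAffineOpen V) :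
    IsAffineOpen (σ.fiberι p ⁻¹ᵁ V) := by
  have := isClosedImmersion_fiberι σ hc
  exact hV.preimage _

/-- A vector field on the exceptional divisor is determined by its values on the coordinates of a
chart. -/
theorem IsCentered.tangent_ext (hx : IsCentered s p U x θ q) (hc : IsClosed {p})
    (hV : IsChartCover σ p U x V y) (a : Fin n) {W : (σ.fiber p).Opens}
    (h : W ≤ σ.fiberι p ⁻¹ᵁ V a) {D D' : Γ(tangentSheaf (σ.fiberι p ≫ σ ≫ s), W)}
    (H : ∀ j, derive D ((σ.fiberι p).appLE (V a) W h (y a j)) =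
      derive D' ((σ.fiberι p).appLE (V a) W h (y a j))) : D = D' := by
  refine tangent_ext_affine (isAffineOpen_preimage_fiberι hc (hV.equation a).affine) h fun g => ?_
  obtain ⟨b, rfl⟩ := fiberι_app_surjective hc (hV.equation a).affine g
  have hD : ∀ D : Γ(tangentSheaf (σ.fiberι p ≫ σ ≫ s), W),
      IsDer (consts (σ ≫ s) (V a)) ((resFun h).comp ((σ.fiberι p).app (V a)).hom)
        (derive D ∘ ((resFun h).comp ((σ.fiberι p).app (V a)).hom)) := fun D =>
    (isDer_derive D).precomp _ fun c => appLE_consts (σ.fiberι p) (t := σ ≫ s) h c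
  have hb : b ∈ Subring.closure (Set.range (σ.appLE U (V a) (hV.le a)).hom ∪ Set.range (y a)) :=
    (hV.chart a).closure ▸ Subring.mem_top b
  refine (hD D).ext_closure (hD D') ?_ hb
  rintro _ (⟨r, rfl⟩ | ⟨j, rfl⟩)
  · have h1 : resFun h ((σ.fiberι p).app (V a) (σ.appLE U (V a) (hV.le a) r)) =
        consts (σ.fiberι p ≫ σ ≫ s) W (q r) := by
      rw [hx.fiberι_appLE_appLE, resFun_consts]
    exact (congrArg (derive D) h1).trans (((isDer_derive D).const _).trans
      (((isDer_derive D').const _).symm.trans (congrArg (derive D') h1).symm))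
  · exact H j

/-- The vector fields `x_a ∂/∂x_i` on the exceptional divisor. -/
theorem IsCentered.exists_exceptionalField (hx : IsCentered s p U x θ q) (hc : IsClosed {p})
    (hV : IsChartCover σ p U x V y) (a i : Fin n) :
    ∃ D : Γ(tangentSheaf (σ.fiberι p ≫ σ ≫ s), σ.fiberι p ⁻¹ᵁ V a), ∀ j,
      derive D ((σ.fiberι p).app (V a) (y a j)) =
        (if j = i then 1 else 0) - (σ.fiberι p).app (V a) (y a j) * if a = i then 1 else 0 := by
  let f := (σ.appLE U (V a) (hV.le a)).hom
  have hx0 := (hx.coordinates.coord.der i).postcomp f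
  -- The factor x_a cancels the denominator in the quotient rule for y_j = x_j / x_a, so x_a ∂/∂x_i
  -- extends to the chart although ∂/∂x_i need not.
  obtain ⟨E, hE, hEf, hEy⟩ := (hx0.smul (f (x a))).exists_extend (f := f) (g := RingHom.id _)
    (hV.chart a).injective (x a) x (y a) (hV.chart a).mul (hV.chart a).closure (hV.chart a).pow
    (hV.chart a).regular (fun j => (if j = i then 1 else 0) - y a j * if a = i then 1 else 0)
    (fun j => by
      have h1 := fun j => hx.coordinates.coord.dual i j
      simp only [Function.comp_apply, h1, RingHom.id_apply]
      simp only [eq_comm (a := i)]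
      have h3 : ∀ P : Prop, [Decidable P] → f (if P then 1 else 0) = if P then 1 else 0 :=
        fun P _ => by split_ifs <;> simp
      rw [h3, h3]
      ring)
  -- The extended derivation sends x_a to a multiple of x_a, so it preserves the ideal of E and
  -- descends to E.
  obtain ⟨E', hE', hEE⟩ := hE.exists_descend ((σ.fiberι p).app (V a)).hom
    (fiberι_app_surjective hc (hV.equation a).affine) ((σ.fiberι p).app (V a)).hom
    (f' := RingHom.id _) (fun _ => rfl) (fun b hb => by
      obtain ⟨b', rfl⟩ := (hV.equation a).exists_eq_mul le_rfl hb
      rw [resFun_self]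
      have h1 := hE.mul (f (x a)) b'
      rw [hEf] at h1
      have h2 := fun g => (hV.equation a).app_mul_eq_zero le_rfl g
      simp only [resFun_self] at h2
      refine (congrArg _ h1).trans ?_
      rw [RingHom.id_apply, RingHom.id_apply, mul_left_comm, ← mul_add]
      exact h2 _)
  have e : ((σ.fiberι p).app (V a)).hom.comp (f.comp (consts s U)) =
      consts (σ.fiberι p ≫ σ ≫ s) (σ.fiberι p ⁻¹ᵁ V a) := RingHom.ext fun c => by
    refine (congrArg _ (appLE_consts σ (t := s) (hV.le a) c)).trans ?_
    rw [Scheme.Hom.app_eq_appLE]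
    exact appLE_consts (σ.fiberι p) (t := σ ≫ s) le_rfl c
  rw [e] at hE'
  obtain ⟨D, hD⟩ := exists_tangent_affine (s := σ.fiberι p ≫ σ ≫ s)
    (isAffineOpen_preimage_fiberι hc (hV.equation a).affine) hE'
  refine ⟨D, fun j => (hD _).trans ((hEE (y a j)).trans ?_)⟩
  rw [hEy, map_sub, map_mul]
  split_ifs <;> simp

end ExceptionalFields

/-! ### The Euler frame of 𝒯_E ⊗ 𝒪_E(E) -/

section TensorFrame

open TensorProduct in
theorem tensorGen_eq {X : Scheme.{u}} {M N : X.Modules} {U U' V : X.Opens} {w : Γ(N, U)}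
    {w' : Γ(N, U')} (h : V ≤ U) (h' : V ≤ U') {r : Γ(X, V)} (e : res N h w = r • res N h' w')
    (m : Γ(M, V)) : tensorGen M w h m = tensorGen M w' h' (r • m) := by
  change toTensor M N V (m ⊗ₜ res N h w) = toTensor M N V ((r • m) ⊗ₜ res N h' w')
  rw [e, TensorProduct.smul_tmul]

variable {S S' : Scheme.{u}} {k : Type u} [Field k] {s : S ⟶ Spec (CommRingCat.of k)}
  {σ : S' ⟶ S} {p : S} {U : S.Opens} {n : ℕ} {x : Fin n → Γ(S, U)}
  {θ : Fin n → Γ(tangentSheaf s, U)} {q : Γ(S, U) →+* k} {V : Fin n → S'.Opens}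
  {y : ∀ a, Fin n → Γ(S', V a)}

/-- This is 1/x_a = (x_b / x_a)(1/x_b); both functionals take the value y_{ab} on the local equation
x_b. -/
theorem IsChartCover.divisorSection_eq (hV : IsChartCover σ p U x V y)
    {ω : ∀ a, Γ(divisorSheaf (σ.fiberι p), V a)}
    (hω : ∀ a h, divisorValue (ω a) (σ.appLE U (V a) (hV.le a) (x a)) h = 1) (a b : Fin n)
    {W : S'.Opens} (ha : W ≤ V a) (hb : W ≤ V b) :
    res _ ha (ω a) = resFun ha (y a b) • res _ hb (ω b) := by
  have h0 : ∀ a, (σ.fiberι p).app (V a) (σ.appLE U (V a) (hV.le a) (x a)) = 0 := fun a => by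
    have := (hV.equation a).app_resFun le_rfl
    rwa [resFun_self] at this
  have h1 : ∀ a (ha : W ≤ V a) hg, divisorValue (res _ ha (ω a))
      (resFun ha (σ.appLE U (V a) (hV.le a) (x a))) hg = 1 := fun a ha _ =>
    (divisorValue_res ha (ω a) _ (h0 a)).trans (by rw [hω, map_one])
  have h2 : resFun hb (σ.appLE U (V b) (hV.le b) (x b)) =
      resFun ha (y a b) * resFun ha (σ.appLE U (V a) (hV.le a) (x a)) := by
    have := congrArg (resFun ha) ((hV.chart a).mul b)
    rw [map_mul] at this
    rw [mul_comm]
    refine Eq.trans ?_ this.symm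
    exact (resFun_appLE σ (hV.le b) hb (x b)).trans (resFun_appLE σ (hV.le a) ha (x b)).symm
  refine (hV.equation b).divisor_ext hb ?_
  rw [divisorValue_smul, h1 b hb, mul_one]
  have h3 := (hV.equation b).app_resFun hb
  simp only [h2] at h3 ⊢
  rw [divisorValue_mul (res _ ha (ω a)) _ _ ((hV.equation a).app_resFun ha), h1 a ha, mul_one]

/-- This is x_b ∂/∂x_i = (x_b / x_a) · x_a ∂/∂x_i. On the coordinate y_{bj} it follows from the
Leibniz rule applied to y_{aj} = y_{ab} y_{bj}. -/
theorem IsCentered.exceptionalField_eq (hx : IsCentered s p U x θ q) (hc : IsClosed {p})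
    (hV : IsChartCover σ p U x V y)
    {δ : ∀ a, Fin n → Γ(tangentSheaf (σ.fiberι p ≫ σ ≫ s), σ.fiberι p ⁻¹ᵁ V a)}
    (hδ : ∀ a i {W : (σ.fiber p).Opens} (h : W ≤ σ.fiberι p ⁻¹ᵁ V a) j,
      derive (res _ h (δ a i)) ((σ.fiberι p).appLE (V a) W h (y a j)) =
      (if j = i then 1 else 0) - (σ.fiberι p).appLE (V a) W h (y a j) * if a = i then 1 else 0)
    (a b i : Fin n) {W : (σ.fiber p).Opens} (ha : W ≤ σ.fiberι p ⁻¹ᵁ V a)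
    (hb : W ≤ σ.fiberι p ⁻¹ᵁ V b) :
    res _ hb (δ b i) = (σ.fiberι p).appLE (V a) W ha (y a b) • res _ ha (δ a i) := by
  refine hx.tangent_ext hc hV b hb fun j => ?_
  rw [hδ, derive_smul]
  have h1 := (isDer_derive (res _ ha (δ a i))).mul ((σ.fiberι p).appLE (V a) W ha (y a b))
    ((σ.fiberι p).appLE (V b) W hb (y b j))
  rw [hV.appLE_mul_eq a b j ha hb, RingHom.id_apply, RingHom.id_apply, hδ, hδ,
    ← hV.appLE_mul_eq a b j ha hb] at h1
  linear_combination h1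

/-- The Euler frame of `𝒯_E ⊗ 𝒪_E(E)`. -/
theorem IsCentered.exists_isEulerFrame (hx : IsCentered s p U x θ q) (hc : IsClosed {p})
    (hV : IsChartCover σ p U x V y) :
    ∃ c, IsEulerFrame (σ.fiberι p) V y (tensor (tangentSheaf (σ.fiberι p ≫ σ ≫ s))
      ((Scheme.Modules.pullback (σ.fiberι p)).obj (divisorSheaf (σ.fiberι p)))) c := by
  choose ω hω using fun a => (hV.equation a).exists_divisorSection
  have hw := fun a => ((hV.equation a).isBasisOn (hω a)).pullback (σ.fiberι p)
  choose δ hδ0 using fun a i => hx.exists_exceptionalField hc hV a i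
  have hδ : ∀ a i {W : (σ.fiber p).Opens} (h : W ≤ σ.fiberι p ⁻¹ᵁ V a) j,
      derive (res _ h (δ a i)) ((σ.fiberι p).appLE (V a) W h (y a j)) =
      (if j = i then 1 else 0) - (σ.fiberι p).appLE (V a) W h (y a j) *
        if a = i then 1 else 0 := fun a i W h j => by
    rw [appLE_eq_resFun, derive_res, hδ0, map_sub, map_mul]
    split_ifs <;> simp
  have hself : ∀ a {W : (σ.fiber p).Opens} (h : W ≤ σ.fiberι p ⁻¹ᵁ V a),
      (σ.fiberι p).appLE (V a) W h (y a a) = 1 := fun a W h => by rw [hV.self, map_one]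
  -- The field ∑ b_i x_a ∂/∂x_i sends y_{aj} to b_j - y_{aj} b_a. It vanishes precisely when b is
  -- b_a times the vector (y_{aj})_j, and a given field D is recovered with b_j = D(y_{aj}), for
  -- which b_a = D(1) = 0. This contains all three properties of an Euler frame.
  have hsum : ∀ a {W : (σ.fiber p).Opens} (h : W ≤ σ.fiberι p ⁻¹ᵁ V a)
      (b : Fin n → Γ(σ.fiber p, W)) j, derive (∑ i, b i • res _ h (δ a i))
        ((σ.fiberι p).appLE (V a) W h (y a j)) =
        b j - (σ.fiberι p).appLE (V a) W h (y a j) * b a := fun a W h b j => by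
    rw [derive_sum]
    simp only [derive_smul, hδ]
    simp [mul_sub, Finset.sum_sub_distrib, mul_comm]
  -- On E ∩ V_a put c_i = (x_a ∂/∂x_i) ⊗ (1/x_a). Between charts one factor is multiplied by y_{ab}
  -- and the other divided by it, so these sections glue.
  obtain ⟨c, hcδ⟩ : ∃ c : Fin n → Γ(tensor (tangentSheaf (σ.fiberι p ≫ σ ≫ s))
      ((Scheme.Modules.pullback (σ.fiberι p)).obj (divisorSheaf (σ.fiberι p))), ⊤),
      ∀ a i (W : (σ.fiber p).Opens) (h : W ≤ σ.fiberι p ⁻¹ᵁ V a),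
      res _ (le_top : W ≤ ⊤) (c i) = tensorGen _ (pullbackSection (σ.fiberι p) _ le_rfl (ω a)) h
        (res _ h (δ a i)) := by
    choose c hcδ using fun i => exists_glue (V := ⊤)
      (M := tensor (tangentSheaf (σ.fiberι p ≫ σ ≫ s))
        ((Scheme.Modules.pullback (σ.fiberι p)).obj (divisorSheaf (σ.fiberι p))))
      (fun a => σ.fiberι p ⁻¹ᵁ V a) (fun _ => le_top)
      (fun e _ => hV.cover (σ.fiberι p e) (top_le_preimage_fiberι σ hx.mem trivial))
      (fun a => tensorGen _ (pullbackSection (σ.fiberι p) _ le_rfl (ω a)) le_rfl (δ a i))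
      (fun a b => by
        rw [res_tensorGen, res_tensorGen, hx.exceptionalField_eq hc hV hδ a b i inf_le_left
          inf_le_right]
        refine tensorGen_eq _ _ ?_ _
        have hab : (σ.fiberι p ⁻¹ᵁ V a) ⊓ (σ.fiberι p ⁻¹ᵁ V b) ≤
          σ.fiberι p ⁻¹ᵁ (V a ⊓ V b) := le_rfl
        have h1 := congrArg (pullbackSection (σ.fiberι p) _ hab)
          (hV.divisorSection_eq hω a b inf_le_left inf_le_right)
        rw [pullbackSection_smul, pullbackSection_res, pullbackSection_res, appLE_resFun] at h1
        rwa [res_pullbackSection, res_pullbackSection])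
    refine ⟨c, fun a i W h => ?_⟩
    rw [← res_res _ le_top h, hcδ, res_tensorGen]
  refine ⟨c, fun a W h => ?_, fun a W h b hb j => ?_, fun W m z hz => ?_⟩
  · simp only [hcδ a _ W h, ← map_smul, ← map_sum]
    refine (congrArg _ (hx.tangent_ext hc hV a h (D' := 0) fun j => ?_)).trans (map_zero _)
    rw [hsum, hself, mul_one, sub_self, derive_zero]
  · simp only [hcδ a _ W h, ← map_smul, ← map_sum] at hb
    have h1 := (hw a).tensorGen_injective h (hb.trans (map_zero _).symm)
    have h2 := hsum a h b j
    rw [h1, derive_zero] at h2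
    exact sub_eq_zero.mp h2.symm
  · obtain ⟨a, ha⟩ := hV.cover (σ.fiberι p z) (top_le_preimage_fiberι σ hx.mem trivial)
    have hWa : W ⊓ σ.fiberι p ⁻¹ᵁ V a ≤ σ.fiberι p ⁻¹ᵁ V a := inf_le_right
    have hWW : W ⊓ σ.fiberι p ⁻¹ᵁ V a ≤ W := inf_le_left
    obtain ⟨O, hO, hzO, D, hD⟩ := (hw a).exists_tensorGen hWa
      (res _ hWW m) z ⟨hz, ha⟩
    refine ⟨O, hO.trans hWW, hzO,
      fun j => derive D ((σ.fiberι p).appLE (V a) O (hO.trans hWa) (y a j)), ?_⟩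
    rw [res_res] at hD
    rw [← hD]
    simp only [hcδ a _ O (hO.trans hWa), ← map_smul, ← map_sum]
    refine congrArg _ (hx.tangent_ext hc hV a (hO.trans hWa) fun j => ?_)
    rw [hsum, hself, (isDer_derive D).one, mul_zero, sub_zero]

end TensorFrame

/-! ### The morphism from `Proj` of the Rees algebra to the projective line -/

section ProjSections

variable {R A : Type u} [CommRing R] [CommRing A] [Algebra R A] (𝒜 : ℕ → Submodule R A)
  [GradedAlgebra 𝒜]

/-- The structure map of the degree zero part of a homogeneous localization. -/
def awayConst (f : A) : R →+* HomogeneousLocalization.Away 𝒜 f :=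
  (HomogeneousLocalization.fromZeroRingHom 𝒜 _).comp (algebraMap R (𝒜 0))

theorem awayι_projToSpec {f : A} {m : ℕ} (hf : f ∈ 𝒜 m) (hm : 0 < m) :
    Proj.awayι 𝒜 f hf hm ≫ projToSpec 𝒜 = Spec.map (CommRingCat.ofHom (awayConst 𝒜 f)) := by
  rw [projToSpec, Proj.awayι_toSpecZero_assoc, ← Spec.map_comp]
  rfl

theorem basicOpen_ι_projToSpec {f : A} {m : ℕ} (hf : f ∈ 𝒜 m) (hm : 0 < m) :
    (Proj.basicOpen 𝒜 f).ι ≫ projToSpec 𝒜 =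
      Proj.basicOpenToSpec 𝒜 f ≫ Spec.map (CommRingCat.ofHom (awayConst 𝒜 f)) := by
  rw [← awayι_projToSpec 𝒜 hf hm, Proj.awayι, Category.assoc, ← Proj.basicOpenIsoSpec_hom 𝒜 f hf hm,
    Iso.hom_inv_id_assoc]

theorem ι_appLE_top {X : Scheme.{u}} (B : X.Opens) (h) :
    B.ι.appLE B ⊤ h = B.topIso.inv := by
  rw [Scheme.Opens.ι_appLE]
  rfl

theorem appLE_top_top {X Y : Scheme.{u}} (g : X ⟶ Y) (h) : g.appLE ⊤ ⊤ h = g.app ⊤ := by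
  rw [Scheme.Hom.app_eq_appLE]
  rfl

theorem appLE_of_ι_comp {X Y : Scheme.{u}} {C : CommRingCat.{u}} {B : X.Opens}
    {g : X ⟶ Y} {j : B.toScheme ⟶ Spec C} {U : Y.Opens} (hU : IsAffineOpen U)
    {φ : Γ(Y, U) ⟶ C} {t : C ⟶ Γ(X, B)} (h : B.ι ≫ g = j ≫ Spec.map φ ≫ hU.fromSpec)
    (hj : j.app ⊤ = (Scheme.ΓSpecIso C).hom ≫ t ≫ B.topIso.inv) (hB : B ≤ g ⁻¹ᵁ U) :
    g.appLE U B hB = φ ≫ t := by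
  have hι : (⊤ : B.toScheme.Opens) ≤ B.ι ⁻¹ᵁ B := (Scheme.Opens.ι_preimage_self B).ge
  have hle' : (⊤ : (Spec C).Opens) ≤ (Spec.map φ ≫ hU.fromSpec) ⁻¹ᵁ U := by
    rw [Scheme.Hom.comp_preimage, hU.fromSpec_preimage_self]
    exact le_rfl
  have hj' : (⊤ : B.toScheme.Opens) ≤ j ⁻¹ᵁ ⊤ := le_top
  have h2 := appLE_congr_hom h (hι.trans (B.ι.preimage_mono hB))
  rw [← Scheme.Hom.appLE_comp_appLE B.ι g U B ⊤ hB hι,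
    ← Scheme.Hom.appLE_comp_appLE j _ U ⊤ ⊤ hle' hj',
    SpecMap_fromSpec_appLE_top hU φ rfl, ι_appLE_top, appLE_top_top, hj, Category.assoc,
    Iso.inv_hom_id_assoc, ← Category.assoc, Iso.comp_inv_eq] at h2
  rw [h2, Category.assoc, Category.assoc, Iso.inv_hom_id, Category.comp_id]

theorem projToSpec_fromSpec_appLE {X : Scheme.{u}} {U : X.Opens} (hU : IsAffineOpen U)
    {A : Type u} [CommRing A] [Algebra Γ(X, U) A] (𝒜 : ℕ → Submodule Γ(X, U) A)
    [GradedAlgebra 𝒜] {f : A} {m : ℕ} (hf : f ∈ 𝒜 m) (hm : 0 < m) (h) :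
    (projToSpec 𝒜 ≫ hU.fromSpec).appLE U (Proj.basicOpen 𝒜 f) h =
      CommRingCat.ofHom (awayConst 𝒜 f) ≫ Proj.awayToSection 𝒜 f := by
  refine appLE_of_ι_comp hU ?_ (Proj.basicOpenToSpec_app_top 𝒜 f) h
  have h1 := basicOpen_ι_projToSpec 𝒜 hf hm
  exact (Category.assoc _ _ _).symm.trans ((congrArg (· ≫ hU.fromSpec) h1).trans
    (Category.assoc _ _ _))

end ProjSections

section PolynomialToRees

variable {k A : Type u} [CommRing k] [CommRing A] {I : Ideal A} 

open MvPolynomial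

/-- The graded homomorphism from a polynomial ring to the Rees algebra defined by elements of
the ideal. -/
def polynomialToRees (φ : k →+* A) (z : Fin 2 → I) :
    GradedRingHom (homogeneousSubmodule (Fin 2) k) (reesPiece I) where
  toRingHom := eval₂Hom ((algebraMap A (reesAlgebra I)).comp φ) fun j => reesGen I (z j)
  map_mem {d F} hF := by
    change eval₂ _ _ F ∈ _
    rw [eval₂_eq']
    refine sum_mem fun m hm => ?_
    have h1 : ∑ j, m j = d := by
      have := (mem_homogeneousSubmodule d F).mp hF (mem_support_iff.mp hm)
      rw [← this, Finsupp.weight_apply, Finsupp.sum_fintype _ _ (by simp)]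
      simp
    have h2 : ∏ j, reesGen I (z j) ^ m j ∈ reesPiece I d := by
      rw [← h1]
      refine SetLike.prod_mem_graded (A := reesPiece I) _ _ fun j _ => ?_
      have := SetLike.pow_mem_graded (A := reesPiece I) (m j) (reesGen_mem I (z j))
      rwa [smul_eq_mul, mul_one] at this
    have h3 := (reesPiece I d).smul_mem (φ (coeff m F)) h2
    rwa [Algebra.smul_def] at h3

theorem polynomialToRees_X (φ : k →+* A) (z : Fin 2 → I) (j : Fin 2) :
    polynomialToRees φ z (X j) = reesGen I (z j) := eval₂_X _ _ _

theorem polynomialToRees_C (φ : k →+* A) (z : Fin 2 → I) (c : k) :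
    polynomialToRees φ z (C c) = algebraMap A (reesAlgebra I) (φ c) := eval₂_C _ _ _

/-- The irrelevant ideal is generated by the z_j t, which are the images of the X_j. This makes the
induced morphism of `Proj` defined everywhere. -/
theorem irrelevant_le_map_polynomialToRees (φ : k →+* A) {z : Fin 2 → A} (hz : ∀ j, z j ∈ I)
    (hI : I = Ideal.span (Set.range z)) :
    HomogeneousIdeal.irrelevant (reesPiece I) ≤
      (HomogeneousIdeal.irrelevant (homogeneousSubmodule (Fin 2) k)).map
        (polynomialToRees φ fun j => ⟨z j, hz j⟩) := by
  refine (irrelevant_le_span hI hz).trans (Ideal.span_le.mpr ?_)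
  rintro _ ⟨j, rfl⟩
  refine (iff_of_eq (congrArg (· ∈ _) (polynomialToRees_X φ (fun j => ⟨z j, hz j⟩) j))).mp
    (Ideal.mem_map_of_mem _ ?_)
  have := HomogeneousIdeal.mem_irrelevant_of_mem (homogeneousSubmodule (Fin 2) k) one_pos
    ((mem_homogeneousSubmodule 1 _).mpr (isHomogeneous_X k j))
  exact this

end PolynomialToRees

section ProjMap

variable {k A : Type u} [CommRing k] [CommRing A] {I : Ideal A}

open MvPolynomial

theorem awayMap_comp_awayConst (φ : k →+* A) (z : Fin 2 → I) (f : MvPolynomial (Fin 2) k) :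
    (HomogeneousLocalization.Away.map (polynomialToRees φ z) f).comp
      (awayConst (homogeneousSubmodule (Fin 2) k) f) =
      (awayConst (reesPiece I) (polynomialToRees φ z f)).comp φ := by
  refine RingHom.ext fun c => HomogeneousLocalization.val_injective _ ?_
  refine Eq.trans (b := Localization.mk (polynomialToRees φ z (C c)) 1) ?_ ?_
  · change Localization.mk _ _ = _
    refine congrArg₂ Localization.mk rfl (Subtype.ext ?_)
    exact map_one _
  · rw [polynomialToRees_C]
    rfl

theorem projMap_projToSpec (φ : k →+* A) {z : Fin 2 → A} (hz : ∀ j, z j ∈ I)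
    (hI : I = Ideal.span (Set.range z)) :
    Proj.map (polynomialToRees φ fun j => ⟨z j, hz j⟩)
      (irrelevant_le_map_polynomialToRees φ hz hI) ≫ projectiveLineToSpec k =
      projToSpec (reesPiece I) ≫ Spec.map (CommRingCat.ofHom φ) := by
  let g := polynomialToRees φ fun j => (⟨z j, hz j⟩ : I)
  refine (Proj.mapAffineOpenCover g (irrelevant_le_map_polynomialToRees φ hz hI)).openCover.hom_ext
    _ _ fun s => ?_
  have h1 := awayι_projToSpec (homogeneousSubmodule (Fin 2) k) s.2.2 s.1.2
  have h2 := awayι_projToSpec (reesPiece I) (f := g s.2.1) (g.map_mem s.2.2) s.1.2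
  have h3 : Proj.awayι (reesPiece I) (g s.2.1) (g.map_mem s.2.2) s.1.2 ≫
      Proj.map g (irrelevant_le_map_polynomialToRees φ hz hI) ≫ projectiveLineToSpec k =
      Proj.awayι (reesPiece I) (g s.2.1) (g.map_mem s.2.2) s.1.2 ≫
        projToSpec (reesPiece I) ≫ Spec.map (CommRingCat.ofHom φ) := by
    refine (Proj.awayι_comp_map_assoc g (irrelevant_le_map_polynomialToRees φ hz hI) s.1.2 s.2.1
      s.2.2 _).trans ?_
    refine (congrArg (_ ≫ ·) h1).trans (Eq.trans ?_ ((congrArg (· ≫ _) h2).symm.trans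
      (Category.assoc _ _ _)))
    rw [← Spec.map_comp, ← Spec.map_comp]
    exact congrArg (fun r => Spec.map (CommRingCat.ofHom r)) (awayMap_comp_awayConst φ _ s.2.1)
  exact h3

end ProjMap

section LineMap

open MvPolynomial

/-- The standard chart of the projective line where `X_a` is invertible. -/
def lineChart (k : Type u) [CommRing k] (a : Fin 2) : (projectiveLine k).Opens :=
  Proj.basicOpen (homogeneousSubmodule (Fin 2) k) (X a)

/-- The function `X_b / X_a` on the standard chart of the projective line. -/
def lineCoord (k : Type u) [CommRing k] (a b : Fin 2) : Γ(projectiveLine k, lineChart k a) :=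
  Proj.awayToSection (homogeneousSubmodule (Fin 2) k) (X a)
    (HomogeneousLocalization.Away.mk _ ((mem_homogeneousSubmodule 1 _).mpr (isHomogeneous_X k a)) 1
      (X b) ((mem_homogeneousSubmodule 1 _).mpr (isHomogeneous_X k b)))

variable {k A : Type u} [CommRing k] [CommRing A] {I : Ideal A} (φ : k →+* A) {z : Fin 2 → A}
  (hz : ∀ j, z j ∈ I) (hI : I = Ideal.span (Set.range z))

/-- The morphism from the `Proj` of the Rees algebra of `(z₀, z₁)` to the projective line. -/
def reesToLine : Proj (reesPiece I) ⟶ projectiveLine k :=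
  Proj.map (polynomialToRees φ fun j => ⟨z j, hz j⟩) (irrelevant_le_map_polynomialToRees φ hz hI)

theorem reesToLine_toSpec : reesToLine φ hz hI ≫ projectiveLineToSpec k =
    projToSpec (reesPiece I) ≫ Spec.map (CommRingCat.ofHom φ) := projMap_projToSpec φ hz hI

theorem reesToLine_preimage (a : Fin 2) : reesToLine φ hz hI ⁻¹ᵁ lineChart k a =
    Proj.basicOpen (reesPiece I) (reesGen I ⟨z a, hz a⟩) := by
  refine (Proj.map_preimage_basicOpen _ _ _).trans ?_
  rw [polynomialToRees_X]

/-- The image of X_a is kept as a variable `c` so that the dependence of the open D₊(c) on it is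
removed by substitution. -/
theorem reesToLine_appLE (a b : Fin 2) {c : reesAlgebra I}
    (hc : polynomialToRees φ (fun j => (⟨z j, hz j⟩ : I)) (X a) = c) (hc1 : c ∈ reesPiece I 1) (h) :
    (reesToLine φ hz hI).appLE (lineChart k a) (Proj.basicOpen (reesPiece I) c) h
      (lineCoord k a b) = Proj.awayToSection (reesPiece I) c
        (HomogeneousLocalization.Away.mk _ hc1 1 (reesGen I ⟨z b, hz b⟩) (reesGen_mem I _)) := by
  subst hc
  refine (ConcreteCategory.congr_hom (Proj.awayToSection_comp_appLE
    (polynomialToRees φ fun j => (⟨z j, hz j⟩ : I)) (irrelevant_le_map_polynomialToRees φ hz hI)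
    ((mem_homogeneousSubmodule 1 _).mpr (isHomogeneous_X k a))) _).trans ?_
  refine congrArg (Proj.awayToSection (reesPiece I) _) ?_
  refine (HomogeneousLocalization.Away.map_mk _ _ _ _ _ _).trans ?_
  congr 1
  exact polynomialToRees_X φ _ b

end LineMap

/-! ### The morphism from the exceptional divisor to the projective line -/

section AffineConstants

variable {S : Scheme.{u}} {k : Type u} [Field k] {s : S ⟶ Spec (CommRingCat.of k)}
  {U : S.Opens}

theorem isoSpec_hom_consts (hU : IsAffineOpen U) :
    hU.isoSpec.hom ≫ Spec.map (CommRingCat.ofHom (consts s U)) = U.ι ≫ s := by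
  have h1 : hU.fromSpec ≫ s = Spec.map (CommRingCat.ofHom (consts s U)) := by
    have h2 := (isAffineOpen_top (Spec (CommRingCat.of k))).SpecMap_appLE_fromSpec s hU le_top
    rw [← h2]
    have h3 : CommRingCat.ofHom (consts s U) =
      (Scheme.ΓSpecIso (CommRingCat.of k)).inv ≫ s.appLE ⊤ U le_top := rfl
    rw [h3, Spec.map_comp]
    congr 1
    rw [IsAffineOpen.fromSpec_top, Scheme.isoSpec_Spec_inv]
  rw [← h1, ← Category.assoc]
  congr 1
  rw [← hU.isoSpec_inv_ι, Iso.hom_inv_id_assoc]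

end AffineConstants

section ChartSections

variable {S S' : Scheme.{u}} {σ : S' ⟶ S} {U : S.Opens} {I : Ideal Γ(S, U)}
  (e : (σ ⁻¹ᵁ U).toScheme ≅ Proj (reesPiece I))

theorem ι_appLE_image {X : Scheme.{u}} (B : X.Opens) (W : B.toScheme.Opens) (h) :
    B.ι.appLE (B.ι ''ᵁ W) W h = 𝟙 _ := by
  rw [Scheme.Opens.ι_appLE]
  exact X.presheaf.map_id _

/-- The restriction of functions from `Proj` of the Rees algebra to a chart of the blow-up. -/
def chartPullback (c : I) :
    HomogeneousLocalization.Away (reesPiece I) (reesGen I c) →+* Γ(S', chartOpen e c) :=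
  (Proj.awayToSection (reesPiece I) (reesGen I c) ≫
    e.hom.app (Proj.basicOpen (reesPiece I) (reesGen I c))).hom

variable {e}

theorem app_comp_appLE_eq {X P Y : Scheme.{u}} {B : X.Opens} {f : X ⟶ Y} {e : B.toScheme ⟶ P}
    {j : P ⟶ Y} (h : e ≫ j = B.ι ≫ f) {U : Y.Opens} {D : P.Opens} (hD : D ≤ j ⁻¹ᵁ U)
    (hle : B.ι ''ᵁ (e ⁻¹ᵁ D) ≤ f ⁻¹ᵁ U) :
    j.appLE U D hD ≫ e.app D = f.appLE U (B.ι ''ᵁ (e ⁻¹ᵁ D)) hle := by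
  have hW : e ⁻¹ᵁ D ≤ B.ι ⁻¹ᵁ (B.ι ''ᵁ (e ⁻¹ᵁ D)) := (B.ι.preimage_image_eq _).ge
  have h1 := appLE_congr_hom h (V := e ⁻¹ᵁ D) (e.preimage_mono hD)
  rw [← Scheme.Hom.appLE_comp_appLE e j U D _ hD le_rfl,
    ← Scheme.Hom.appLE_comp_appLE B.ι f U _ _ hle hW, ι_appLE_image,
    ← Scheme.Hom.app_eq_appLE] at h1
  exact h1.trans (Category.comp_id _)

theorem lift_appLE_eq {X P E : Scheme.{u}} {B : X.Opens} {l : E ⟶ B.toScheme} {i : E ⟶ X}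
    (hl : l ≫ B.ι = i) (e : B.toScheme ⟶ P) (D : P.Opens)
    (hle : i ⁻¹ᵁ (B.ι ''ᵁ (e ⁻¹ᵁ D)) ≤ (l ≫ e) ⁻¹ᵁ D) :
    (l ≫ e).appLE D _ hle = e.app D ≫ i.app (B.ι ''ᵁ (e ⁻¹ᵁ D)) := by
  have hW : e ⁻¹ᵁ D ≤ B.ι ⁻¹ᵁ (B.ι ''ᵁ (e ⁻¹ᵁ D)) := (B.ι.preimage_image_eq _).ge
  subst hl
  rw [Scheme.Hom.app_eq_appLE (f := l ≫ B.ι),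
    ← Scheme.Hom.appLE_comp_appLE l B.ι _ (e ⁻¹ᵁ D) _ hW hle, ι_appLE_image,
    ← Scheme.Hom.appLE_comp_appLE l e D (e ⁻¹ᵁ D) _ le_rfl hle, ← Scheme.Hom.app_eq_appLE]
  exact congrArg (_ ≫ ·) (Category.id_comp _).symm

theorem chartPullback_awayConst (hU : IsAffineOpen U)
    (he : e.hom ≫ projToSpec (reesPiece I) = σ ∣_ U ≫ hU.isoSpec.hom) (c : I)
    (hle : chartOpen e c ≤ σ ⁻¹ᵁ U) (r : Γ(S, U)) :
    chartPullback e c (awayConst (reesPiece I) _ r) = σ.appLE U (chartOpen e c) hle r := by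
  have he' : e.hom ≫ projToSpec (reesPiece I) ≫ hU.fromSpec = (σ ⁻¹ᵁ U).ι ≫ σ := by
    rw [← Category.assoc, he, Category.assoc, ← hU.isoSpec_inv_ι, Iso.hom_inv_id_assoc,
      morphismRestrict_ι]
  have hD : Proj.basicOpen (reesPiece I) (reesGen I c) ≤
      (projToSpec (reesPiece I) ≫ hU.fromSpec) ⁻¹ᵁ U := fun w _ => by
    have : hU.fromSpec (projToSpec (reesPiece I) w) ∈ Set.range hU.fromSpec := ⟨_, rfl⟩
    rwa [hU.range_fromSpec] at this
  have h1 := app_comp_appLE_eq he' hD hle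
  rw [projToSpec_fromSpec_appLE hU (reesPiece I) (reesGen_mem I c) one_pos] at h1
  exact ConcreteCategory.congr_hom h1 r

/-- After multiplication by the regular function z_a both sides become z_b. -/
theorem chartPullback_mk (hU : IsAffineOpen U)
    (he : e.hom ≫ projToSpec (reesPiece I) = σ ∣_ U ≫ hU.isoSpec.hom) {J : Type*}
    {z : J → Γ(S, U)} (hz : ∀ j, z j ∈ I) (a b : J) {hle : chartOpen e ⟨z a, hz a⟩ ≤ σ ⁻¹ᵁ U}
    {y : J → Γ(S', chartOpen e ⟨z a, hz a⟩)} (hy : IsChart (σ.appLE U _ hle).hom z a y) :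
    chartPullback e ⟨z a, hz a⟩ (HomogeneousLocalization.Away.mk _ (reesGen_mem I _) 1
      (reesGen I ⟨z b, hz b⟩) (reesGen_mem I _)) = y b := by
  refine (mul_cancel_left_mem_nonZeroDivisors hy.regular).mp (Eq.trans ?_ (hy.mul b).symm)
  have h1 := congrArg (chartPullback e ⟨z a, hz a⟩)
    (reesAwayMap_mul_mk ⟨z a, hz a⟩ 1 (reesGen I ⟨z b, hz b⟩) (reesGen_mem I _))
  rw [map_mul] at h1
  have h2 := fun r => chartPullback_awayConst hU he ⟨z a, hz a⟩ hle r
  refine (congrArg (· * _) (h2 (z a))).symm.trans (Eq.trans ?_ (h1.trans (Eq.trans ?_ (h2 (z b)))))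
  · exact congrArg (fun r => chartPullback e ⟨z a, hz a⟩ (awayConst (reesPiece I) _ r) * _)
      (pow_one _).symm
  · exact congrArg (fun r => chartPullback e ⟨z a, hz a⟩ (awayConst (reesPiece I) _ r))
      (Polynomial.coeff_monomial_same 1 (z b))

end ChartSections

section LineMap

variable {S S' : Scheme.{u}} {k : Type u} [Field k] {s : S ⟶ Spec (CommRingCat.of k)}
  {σ : S' ⟶ S} {p : S} {U : S.Opens} {x : Fin 2 → Γ(S, U)} {I : Ideal Γ(S, U)}

/-- The morphism is the composite E → σ⁻¹U ≅ Proj(⨁ Iⁱ) → ℙ¹, the last arrow being X_j ↦ x_j t. It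
pulls X_b / X_a back to y_{ab}. -/
theorem exists_lineMap (hp : p ∈ U) (hI : I = Ideal.span (Set.range x))
    (hxI : ∀ a, x a ∈ I) (hU : IsAffineOpen U) (e : (σ ⁻¹ᵁ U).toScheme ≅ Proj (reesPiece I))
    (he : e.hom ≫ projToSpec (reesPiece I) = σ ∣_ U ≫ hU.isoSpec.hom)
    {y : ∀ a, Fin 2 → Γ(S', chartOpen e ⟨x a, hxI a⟩)}
    (hV : IsChartCover σ p U x (fun a => chartOpen e ⟨x a, hxI a⟩) y) :
    ∃ φ : σ.fiber p ⟶ projectiveLine k,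
      φ ≫ projectiveLineToSpec k = σ.fiberι p ≫ σ ≫ s ∧
      ∀ a, ∃ h : φ ⁻¹ᵁ lineChart k a = σ.fiberι p ⁻¹ᵁ chartOpen e ⟨x a, hxI a⟩, ∀ b,
        φ.appLE (lineChart k a) _ h.ge (lineCoord k a b) = (σ.fiberι p).app _ (y a b) := by
  have hr : Set.range (σ.fiberι p) ⊆ Set.range (σ ⁻¹ᵁ U).ι := by
    rw [Scheme.Opens.range_ι]
    rintro _ ⟨w, rfl⟩
    exact top_le_preimage_fiberι σ hp (Opens.mem_top w)
  let l := IsOpenImmersion.lift (σ ⁻¹ᵁ U).ι (σ.fiberι p) hr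
  have hl : l ≫ (σ ⁻¹ᵁ U).ι = σ.fiberι p := IsOpenImmersion.lift_fac _ _ _
  let g := reesToLine (consts s U) hxI hI
  let φ : σ.fiber p ⟶ projectiveLine k := l ≫ e.hom ≫ g
  have hφ : φ ≫ projectiveLineToSpec k = σ.fiberι p ≫ σ ≫ s := by
    have h1 : g ≫ projectiveLineToSpec k = _ := reesToLine_toSpec (consts s U) hxI hI
    have h2 := isoSpec_hom_consts (s := s) hU
    simp only [φ, Category.assoc]
    rw [h1, reassoc_of% he, h2, ← hl, Category.assoc, morphismRestrict_ι_assoc]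
  refine ⟨φ, hφ, fun a => ?_⟩
  have hg : g ⁻¹ᵁ lineChart k a = Proj.basicOpen (reesPiece I) (reesGen I ⟨x a, hxI a⟩) :=
    reesToLine_preimage (consts s U) hxI hI a
  have hlV : l ⁻¹ᵁ (e.hom ⁻¹ᵁ Proj.basicOpen (reesPiece I) (reesGen I ⟨x a, hxI a⟩)) =
      σ.fiberι p ⁻¹ᵁ chartOpen e ⟨x a, hxI a⟩ := by
    rw [← hl, Scheme.Hom.comp_preimage]
    exact congrArg (l ⁻¹ᵁ ·) ((σ ⁻¹ᵁ U).ι.preimage_image_eq _).symm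
  have h : φ ⁻¹ᵁ lineChart k a = σ.fiberι p ⁻¹ᵁ chartOpen e ⟨x a, hxI a⟩ := by
    rw [← hlV, ← hg]
    rfl
  refine ⟨h, fun b => ?_⟩
  have h1 := reesToLine_appLE (consts s U) hxI hI a b (polynomialToRees_X _ _ a)
    (reesGen_mem I ⟨x a, hxI a⟩) hg.ge
  have h2 := chartPullback_mk hU he hxI a b (hV.chart a)
  have hle : σ.fiberι p ⁻¹ᵁ chartOpen e ⟨x a, hxI a⟩ ≤
      (l ≫ e.hom) ⁻¹ᵁ Proj.basicOpen (reesPiece I) (reesGen I ⟨x a, hxI a⟩) := hlV.ge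
  have h3 := lift_appLE_eq hl e.hom (Proj.basicOpen (reesPiece I) (reesGen I ⟨x a, hxI a⟩)) hle
  have h4 : φ.appLE (lineChart k a) (σ.fiberι p ⁻¹ᵁ chartOpen e ⟨x a, hxI a⟩) h.ge =
      g.appLE (lineChart k a) (Proj.basicOpen (reesPiece I) (reesGen I ⟨x a, hxI a⟩)) hg.ge ≫
        (l ≫ e.hom).appLE _ _ hle := by
    rw [Scheme.Hom.appLE_comp_appLE]
    exact appLE_congr_hom (Category.assoc _ _ _).symm _
  have h5 := congrArg ((σ.fiberι p).app (chartOpen e ⟨x a, hxI a⟩)) h2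
  refine (ConcreteCategory.congr_hom h4 _).trans (Eq.trans ?_ h5)
  refine (congrArg ((l ≫ e.hom).appLE _ _ hle) h1).trans ?_
  exact ConcreteCategory.congr_hom h3 _

end LineMap

/-! ### Transcendence, and polynomials on the line -/

section Transcendence

variable {k C : Type*} [Field k] [CharZero k] [CommRing C] [Nontrivial C]

theorem IsDer.pow {k A B : Type*} [CommRing k] [CommRing A] [CommRing B] {φ : k →+* A}
    {f : A →+* B} {D : A → B} (h : IsDer φ f D) (a : A) (n : ℕ) :
    D (a ^ n) = n * f a ^ (n - 1) * D a := by
  induction n with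
  | zero => simp [h.one]
  | succ n ih =>
    rw [pow_succ, h.mul, ih, map_pow]
    obtain _ | n := n
    · simp
    · simp only [Nat.add_sub_cancel]
      push_cast
      ring

theorem IsDer.eval₂ {k C : Type*} [CommRing k] [CommRing C] {κ : k →+* C} {D : C → C}
    (h : IsDer κ (RingHom.id C) D) {v : C} (hv : D v = 1) (P : Polynomial k) :
    D (P.eval₂ κ v) = P.derivative.eval₂ κ v := by
  induction P using Polynomial.induction_on' with
  | add P Q hP hQ =>
    rw [Polynomial.eval₂_add, h.add, hP, hQ, Polynomial.derivative_add, Polynomial.eval₂_add]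
  | monomial n c =>
    rw [Polynomial.eval₂_monomial, h.mul, h.const, h.pow, hv, Polynomial.derivative_monomial,
      Polynomial.eval₂_monomial]
    simp
    ring

/-- In characteristic zero, an element on which a derivation takes the value `1` is transcendental
over the constants. -/
theorem IsDer.eq_zero_of_eval₂_eq_zero {κ : k →+* C} {D : C → C} (h : IsDer κ (RingHom.id C) D)
    {v : C} (hv : D v = 1) {P : Polynomial k} (hP : P.eval₂ κ v = 0) : P = 0 := by
  induction hn : P.natDegree using Nat.strong_induction_on generalizing P with
  | _ n ih =>
    -- As D(v) = 1, applying D to P(v) = 0 gives P'(v) = 0. By induction P' = 0, so P is constant in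
    -- characteristic zero.
    have h1 : P.derivative.eval₂ κ v = 0 := by rw [← h.eval₂ hv, hP, h.zero]
    have h2 : P.natDegree = 0 := by
      by_contra h0
      have h3 := ih _ (hn ▸ Polynomial.natDegree_derivative_lt h0) h1 rfl
      exact h0 (Polynomial.derivative_eq_zero.mp h3)
    rw [Polynomial.eq_C_of_natDegree_eq_zero h2, Polynomial.eval₂_C] at hP
    rw [Polynomial.eq_C_of_natDegree_eq_zero h2, (map_eq_zero κ).mp hP, Polynomial.C_0]

end Transcendence

section LineAlgebra

open MvPolynomial HomogeneousLocalization

theorem eval₂_const_mul {k C J : Type*} [CommRing k] [CommRing C] [Fintype J] (κ : k →+* C) (c : C)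
    (w : J → C) {F : MvPolynomial J k} {N : ℕ} (hF : F.IsHomogeneous N) :
    eval₂ κ (fun j => c * w j) F = c ^ N * eval₂ κ w F := by
  rw [eval₂_eq', eval₂_eq', Finset.mul_sum]
  refine Finset.sum_congr rfl fun m hm => ?_
  have h1 : ∑ j, m j = N := by
    have := hF (mem_support_iff.mp hm)
    rw [← this, Finsupp.weight_apply, Finsupp.sum_fintype _ _ (by simp)]
    simp
  simp only [mul_pow, Finset.prod_mul_distrib, Finset.prod_pow_eq_pow_sum, h1]
  ring

theorem algebraMap_pow_mul_val_mk {ι A τ : Type*} [CommRing A] [SetLike τ A]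
    [AddSubgroupClass τ A] [AddCommMonoid ι] [DecidableEq ι] (𝒜 : ι → τ) [GradedRing 𝒜] {f : A}
    {d : ι} (hf : f ∈ 𝒜 d) (N : ℕ) (F : A) (hF : F ∈ 𝒜 (N • d)) :
    algebraMap A (Localization.Away f) f ^ N * (Away.mk 𝒜 hf N F hF).val =
      algebraMap A (Localization.Away f) F := by
  rw [Away.val_mk, Localization.mk_eq_mk', mul_comm, ← map_pow]
  exact IsLocalization.mk'_spec _ _ _

variable {k : Type u} [CommRing k]

/-- The fraction `X_b / X_a`. -/
def lineFraction (k : Type u) [CommRing k] (a b : Fin 2) :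
    Away (homogeneousSubmodule (Fin 2) k) (X a : MvPolynomial (Fin 2) k) :=
  Away.mk _ ((mem_homogeneousSubmodule 1 _).mpr (isHomogeneous_X k a)) 1
    (X b) ((mem_homogeneousSubmodule 1 _).mpr (isHomogeneous_X k b))

/-- Dehomogenization: F / X_a^N is F evaluated at X_a = 1 and X_b = X_b / X_a, which is checked
after multiplication by X_a^N. -/
theorem exists_eval₂_lineFraction {a b : Fin 2} (hab : a ≠ b)
    (ζ : Away (homogeneousSubmodule (Fin 2) k) (X a : MvPolynomial (Fin 2) k)) :
    ∃ P : Polynomial k, ζ = P.eval₂ (awayConst _ _) (lineFraction k a b) := by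
  obtain ⟨N, F, hF, rfl⟩ := Away.mk_surjective _
    ((mem_homogeneousSubmodule 1 _).mpr (isHomogeneous_X k a)) ζ
  have hF' : F.IsHomogeneous N := by simpa using hF
  let L := Localization.Away (X a : MvPolynomial (Fin 2) k)
  let v : Away (homogeneousSubmodule (Fin 2) k) (X a : MvPolynomial (Fin 2) k) →+* L :=
    ⟨⟨⟨val, val_one⟩, val_mul⟩, val_zero, val_add⟩
  let κ : k →+* L := (algebraMap (MvPolynomial (Fin 2) k) L).comp C
  have hX : IsUnit (algebraMap (MvPolynomial (Fin 2) k) L (X a)) :=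
    IsLocalization.Away.algebraMap_isUnit _
  refine ⟨F.eval₂ Polynomial.C fun j => if j = a then 1 else Polynomial.X, val_injective _ ?_⟩
  change _ = v _
  have h1 : v.comp (awayConst _ _) = κ := RingHom.ext fun c =>
    Localization.mk_one_eq_algebraMap _
  have h3 : ∀ j, algebraMap (MvPolynomial (Fin 2) k) L (X a) * v (lineFraction k a j) =
      algebraMap (MvPolynomial (Fin 2) k) L (X j) := fun j => by
    have := algebraMap_pow_mul_val_mk (homogeneousSubmodule (Fin 2) k)
      ((mem_homogeneousSubmodule 1 _).mpr (isHomogeneous_X k a)) 1 (X j)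
      ((mem_homogeneousSubmodule 1 _).mpr (isHomogeneous_X k j))
    rw [pow_one] at this
    exact this
  have h2 : v ((F.eval₂ Polynomial.C fun j => if j = a then 1 else Polynomial.X).eval₂
      (awayConst _ _) (lineFraction k a b)) = F.eval₂ κ fun j => v (lineFraction k a j) := by
    rw [Polynomial.hom_eval₂, h1]
    have := hom_eval₂ F Polynomial.C (Polynomial.eval₂RingHom κ (v (lineFraction k a b)))
      fun j => if j = a then 1 else Polynomial.X
    refine this.trans ?_
    have e : (Polynomial.eval₂RingHom κ (v (lineFraction k a b))).comp Polynomial.C = κ :=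
      RingHom.ext fun c => Polynomial.eval₂_C _ _
    rw [e]
    congr 1
    funext j
    by_cases hj : j = a
    · subst hj
      refine hX.mul_left_cancel ?_
      simp [h3]
    · have : j = b := by omega
      subst this
      simp [hj]
  rw [h2]
  refine (hX.pow N).mul_left_cancel ?_
  rw [← eval₂_const_mul κ _ _ hF']
  simp only [h3]
  have h5 : F.eval₂ κ (fun j => algebraMap (MvPolynomial (Fin 2) k) L (X j)) =
      algebraMap _ L F := by
    have := hom_eval₂ F C (algebraMap (MvPolynomial (Fin 2) k) L) X
    rw [eval₂_eta] at this
    exact this.symm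
  rw [h5]
  exact algebraMap_pow_mul_val_mk _ _ N F hF

end LineAlgebra

/-! ### Every chart meets the exceptional divisor -/

section Nonempty

/-- This refines the field `pow` by placing the numerator in the N-th power of the ideal. Elements
of A need N = 0 and the y_j need N = 1, and the exponents add under sums and products. -/
theorem IsChart.exists_pow_mul {A B J : Type*} [CommRing A] [CommRing B] {f : A →+* B} {z : J → A}
    {a : J} {y : J → B} (h : IsChart f z a y) (b : B) :
    ∃ N, ∃ c ∈ Ideal.span (Set.range z) ^ N, f (z a) ^ N * b = f c := by
  have hb : b ∈ Subring.closure (Set.range f ∪ Set.range y) := h.closure ▸ Subring.mem_top b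
  have hz : ∀ N, z a ^ N ∈ Ideal.span (Set.range z) ^ N := fun N =>
    Ideal.pow_mem_pow (Ideal.subset_span (Set.mem_range_self a)) N
  induction hb using Subring.closure_induction with
  | mem b hb =>
    obtain ⟨r, rfl⟩ | ⟨j, rfl⟩ := hb
    · exact ⟨0, r, by simp, by simp⟩
    · exact ⟨1, z j, by rw [pow_one]; exact Ideal.subset_span ⟨j, rfl⟩, by rw [pow_one, h.mul]⟩
  | zero => exact ⟨0, 0, by simp, by simp⟩
  | one => exact ⟨0, 1, by simp, by simp⟩
  | add b b' _ _ hb hb' =>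
    obtain ⟨N, c, hc, e⟩ := hb
    obtain ⟨N', c', hc', e'⟩ := hb'
    refine ⟨N + N', c * z a ^ N' + z a ^ N * c', ?_, ?_⟩
    · rw [pow_add]
      exact add_mem (Ideal.mul_mem_mul hc (hz _)) (Ideal.mul_mem_mul (hz _) hc')
    · rw [map_add, map_mul, map_mul, ← e, ← e', map_pow, map_pow]
      ring
  | neg b _ hb =>
    obtain ⟨N, c, hc, e⟩ := hb
    exact ⟨N, -c, neg_mem hc, by rw [map_neg, ← e]; ring⟩
  | mul b b' _ _ hb hb' =>
    obtain ⟨N, c, hc, e⟩ := hb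
    obtain ⟨N', c', hc', e'⟩ := hb'
    refine ⟨N + N', c * c', ?_, ?_⟩
    · rw [pow_add]; exact Ideal.mul_mem_mul hc hc'
    · rw [map_mul, ← e, ← e']; ring

theorem IsDer.apply_mem_pow {k A : Type*} [CommRing k] [CommRing A] {φ : k →+* A} {D : A → A}
    (h : IsDer φ (RingHom.id A) D) (I : Ideal A) (N : ℕ) {c : A} (hc : c ∈ I ^ (N + 1)) :
    D c ∈ I ^ N := by
  induction N generalizing c with
  | zero => simp
  | succ N ih =>
    rw [pow_succ] at hc
    induction hc using Submodule.mul_induction_on' with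
    | mem_mul_mem a ha b hb =>
      rw [h.mul, RingHom.id_apply, RingHom.id_apply]
      refine add_mem (Ideal.mul_mem_right _ _ ha) ?_
      rw [pow_succ, mul_comm b]
      exact Ideal.mul_mem_mul (ih ha) hb
    | add a _ b _ ha hb => rw [h.add]; exact add_mem ha hb

/-- A derivation lowers the order along I by at most one and sends z^(N+1) to (N+1) z^N. As N+1 is
invertible, induction descends to 1 ∉ I. -/
theorem IsDer.pow_notMem {k A : Type*} [Field k] [CharZero k] [CommRing A] {φ : k →+* A} {D : A → A}
    (h : IsDer φ (RingHom.id A) D) {I : Ideal A} (hI : I ≠ ⊤) {z : A} (hz : D z = 1) (N : ℕ) :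
    z ^ N ∉ I ^ (N + 1) := by
  induction N with
  | zero =>
    intro h0
    rw [pow_zero, zero_add, pow_one] at h0
    exact hI ((Ideal.eq_top_iff_one _).mpr h0)
  | succ N ih =>
    intro h0
    refine ih ?_
    have h1 := h.apply_mem_pow I _ h0
    rw [h.pow, hz, mul_one, RingHom.id_apply, Nat.add_sub_cancel] at h1
    have h2 := Ideal.mul_mem_left (I ^ (N + 1)) (φ ((N + 1 : ℕ) : k)⁻¹) h1
    rw [← mul_assoc, ← map_natCast φ, ← map_mul,
      inv_mul_cancel₀ (Nat.cast_ne_zero.mpr N.succ_ne_zero), map_one, one_mul] at h2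
    exact h2

end Nonempty

section LineConstants

theorem appLE_top_of_ι_comp {X : Scheme.{u}} {R C : CommRingCat.{u}} {B : X.Opens}
    {g : X ⟶ Spec R} {j : B.toScheme ⟶ Spec C} {φ : R ⟶ C} {t : C ⟶ Γ(X, B)}
    (h : B.ι ≫ g = j ≫ Spec.map φ)
    (hj : j.app ⊤ = (Scheme.ΓSpecIso C).hom ≫ t ≫ B.topIso.inv) :
    (Scheme.ΓSpecIso R).inv ≫ g.appLE ⊤ B le_top = φ ≫ t := by
  have h2 : Spec.map ((Scheme.ΓSpecIso R).hom ≫ φ) ≫ (isAffineOpen_top (Spec R)).fromSpec =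
      Spec.map φ := by
    rw [IsAffineOpen.fromSpec_top, Scheme.isoSpec_Spec_inv, ← Spec.map_comp,
      Iso.inv_hom_id_assoc]
  rw [appLE_of_ι_comp (isAffineOpen_top (Spec R)) (h.trans (congrArg (j ≫ ·) h2.symm)) hj le_top,
    Category.assoc, Iso.inv_hom_id_assoc]

theorem consts_of_ι_comp {X : Scheme.{u}} {R C : CommRingCat.{u}} {B : X.Opens}
    {g : X ⟶ Spec R} {j : B.toScheme ⟶ Spec C} {φ : R ⟶ C} {t : C ⟶ Γ(X, B)}
    (h : B.ι ≫ g = j ≫ Spec.map φ)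
    (hj : j.app ⊤ = (Scheme.ΓSpecIso C).hom ≫ t ≫ B.topIso.inv) (c : R) :
    consts g B c = t (φ c) :=
  ConcreteCategory.congr_hom (appLE_top_of_ι_comp h hj) c

theorem consts_projToSpec {R A : Type u} [CommRing R] [CommRing A] [Algebra R A]
    (𝒜 : ℕ → Submodule R A) [GradedAlgebra 𝒜] {f : A} {m : ℕ} (hf : f ∈ 𝒜 m) (hm : 0 < m) (c : R) :
    consts (projToSpec 𝒜) (Proj.basicOpen 𝒜 f) c = Proj.awayToSection 𝒜 f (awayConst 𝒜 f c) :=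
  consts_of_ι_comp (basicOpen_ι_projToSpec 𝒜 hf hm) (Proj.basicOpenToSpec_app_top 𝒜 f) c

open MvPolynomial in
theorem consts_lineChart {k : Type u} [CommRing k] (a : Fin 2) (c : k) :
    consts (projectiveLineToSpec k) (lineChart k a) c =
      Proj.awayToSection (homogeneousSubmodule (Fin 2) k) (X a) (awayConst _ _ c) :=
  consts_projToSpec (homogeneousSubmodule (Fin 2) k)
    ((mem_homogeneousSubmodule 1 _).mpr (isHomogeneous_X k a)) one_pos c

end LineConstants

section LineIso

variable {S S' : Scheme.{u}} {k : Type u} [Field k] [CharZero k]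
  {s : S ⟶ Spec (CommRingCat.of k)} {σ : S' ⟶ S} {p : S} {U : S.Opens}

/-- Otherwise 1 = x_a b on the chart. Writing x_a^N b = c with c ∈ I^N gives x_a^N = x_a c ∈
I^(N+1), against `IsDer.pow_notMem` for ∂/∂x_a. -/
theorem IsCentered.nontrivial_exceptional {n : ℕ} {x : Fin n → Γ(S, U)}
    {θ : Fin n → Γ(tangentSheaf s, U)} {q : Γ(S, U) →+* k} {V : Fin n → S'.Opens}
    {y : ∀ a, Fin n → Γ(S', V a)} (hx : IsCentered s p U x θ q) (hV : IsChartCover σ p U x V y)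
    (a : Fin n) : Nontrivial Γ(σ.fiber p, σ.fiberι p ⁻¹ᵁ V a) := by
  by_contra hN
  rw [not_nontrivial_iff_subsingleton] at hN
  obtain ⟨b, hb⟩ := (hV.equation a).exists_eq_mul le_rfl
    (g := 1) (Subsingleton.elim ((σ.fiberι p).app (V a) 1) 0)
  rw [resFun_self] at hb
  obtain ⟨N, c, hc, e⟩ := (hV.chart a).exists_pow_mul b
  refine (hx.coordinates.coord.der a).pow_notMem (I := Ideal.span (Set.range x)) ?_
    (by rw [hx.coordinates.coord.dual, if_pos rfl]) N ?_
  · rw [← hx.ker]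
    exact RingHom.ker_ne_top q
  · have h1 : x a ^ N = x a * c := (hV.chart a).injective (by
      rw [map_mul, ← e, mul_left_comm]
      refine Eq.trans ?_ (congrArg (_ * ·) hb)
      rw [mul_one, map_pow])
    rw [h1, pow_succ']
    exact Ideal.mul_mem_mul (Ideal.subset_span (Set.mem_range_self a)) hc

variable {x : Fin 2 → Γ(S, U)} {θ : Fin 2 → Γ(tangentSheaf s, U)} {q : Γ(S, U) →+* k}
  {V : Fin 2 → S'.Opens} {y : ∀ a, Fin 2 → Γ(S', V a)} {φ : σ.fiber p ⟶ projectiveLine k}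

open MvPolynomial in
-- Functions on E ∩ V_a are generated by constants and the y_{aj}, which are images of constants and
-- the X_j / X_a. Conversely every function on the chart of the line is a polynomial in X_b / X_a,
-- and the vector field x_a ∂/∂x_b takes the value 1 on y_{ab}, so y_{ab} satisfies no polynomial
-- relation.
theorem IsCentered.bijective_lineMap (hx : IsCentered s p U x θ q) (hc : IsClosed {p})
    (hV : IsChartCover σ p U x V y) (hφ : φ ≫ projectiveLineToSpec k = σ.fiberι p ≫ σ ≫ s)
    (a : Fin 2) (h : σ.fiberι p ⁻¹ᵁ V a ≤ φ ⁻¹ᵁ lineChart k a)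
    (hy : ∀ b, φ.appLE (lineChart k a) _ h (lineCoord k a b) = (σ.fiberι p).app _ (y a b)) :
    Function.Bijective (φ.appLE (lineChart k a) _ h) := by
  have := hx.nontrivial_exceptional hV a
  let ψ := Proj.awayToSection (homogeneousSubmodule (Fin 2) k) (X a) ≫ φ.appLE (lineChart k a) _ h
  have hconst : ∀ c, ψ (awayConst _ _ c) =
      consts (σ.fiberι p ≫ σ ≫ s) (σ.fiberι p ⁻¹ᵁ V a) c := fun c => by
    have h1 := appLE_consts φ (t := projectiveLineToSpec k) h c
    rw [consts_lineChart] at h1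
    refine h1.trans ?_
    rw [hφ]
  suffices hψ : Function.Bijective ψ by
    have h1 : IsIso (Proj.awayToSection (homogeneousSubmodule (Fin 2) k) (X a)) := by
      rw [← Proj.basicOpenIsoAway_hom _ _ ((mem_homogeneousSubmodule 1 _).mpr
        (isHomogeneous_X k a)) one_pos]
      infer_instance
    have h2 := ConcreteCategory.bijective_of_isIso
      (Proj.awayToSection (homogeneousSubmodule (Fin 2) k) (X a))
    exact (Function.Bijective.of_comp_iff _ h2).mp hψ
  obtain ⟨b, hab⟩ : ∃ b, a ≠ b := ⟨1 - a, by fin_cases a <;> decide⟩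
  obtain ⟨D, hD⟩ := hx.exists_exceptionalField hc hV a b
  refine ⟨(injective_iff_map_eq_zero ψ.hom).mpr fun ζ hζ => ?_, fun g => ?_⟩
  · obtain ⟨P, rfl⟩ := exists_eval₂_lineFraction hab ζ
    rw [Polynomial.hom_eval₂] at hζ
    have h1 : ψ.hom.comp (awayConst _ _) =
      consts (σ.fiberι p ≫ σ ≫ s) (σ.fiberι p ⁻¹ᵁ V a) := RingHom.ext hconst
    rw [h1] at hζ
    have h2 := (isDer_derive D).eq_zero_of_eval₂_eq_zero (by
      refine (congrArg (derive D) (hy b)).trans ?_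
      rw [hD, if_pos rfl, if_neg hab, mul_zero, sub_zero]) hζ
    rw [h2, Polynomial.eval₂_zero]
  · obtain ⟨g, rfl⟩ := fiberι_app_surjective hc (hV.equation a).affine g
    have hg : g ∈ Subring.closure (Set.range (σ.appLE U (V a) (hV.le a)).hom ∪ Set.range (y a)) :=
      (hV.chart a).closure ▸ Subring.mem_top g
    change (σ.fiberι p).app (V a) g ∈ ψ.hom.range
    induction hg using Subring.closure_induction with
    | mem b hb =>
      obtain ⟨r, rfl⟩ | ⟨j, rfl⟩ := hb
      · exact ⟨awayConst _ _ (q r), (hconst _).trans (hx.fiberι_appLE_appLE _ r).symm⟩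
      · exact ⟨lineFraction k a j, hy j⟩
    | zero => rw [map_zero]; exact zero_mem _
    | one => rw [map_one]; exact one_mem _
    | add b b' _ _ hb hb' => rw [map_add]; exact add_mem hb hb'
    | neg b _ hb => rw [map_neg]; exact neg_mem hb
    | mul b b' _ _ hb hb' => rw [map_mul]; exact mul_mem hb hb'

open MvPolynomial in
theorem iSup_lineChart (k : Type u) [CommRing k] : ⨆ a, lineChart k a = ⊤ := by
  refine Proj.iSup_basicOpen_eq_top' (homogeneousSubmodule (Fin 2) k) _
    (fun a => ⟨1, (mem_homogeneousSubmodule 1 _).mpr (isHomogeneous_X k a)⟩)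
    (eq_top_iff.mpr fun F _ => ?_)
  induction F using MvPolynomial.induction_on with
  | C c =>
    exact Subalgebra.algebraMap_mem _
      (⟨C c, (mem_homogeneousSubmodule 0 _).mpr (isHomogeneous_C _ c)⟩ :
        homogeneousSubmodule (Fin 2) k 0)
  | add F G hF hG => exact add_mem (hF trivial) (hG trivial)
  | mul_X F j hF => exact mul_mem (hF trivial) (Algebra.subset_adjoin ⟨j, rfl⟩)

theorem isIso_appTop_morphismRestrict {X Y : Scheme.{u}} {f : X ⟶ Y} {U : Y.Opens} {V : X.Opens}
    (hV : f ⁻¹ᵁ U = V) (h : Function.Bijective (f.appLE U V hV.ge)) : IsIso (f ∣_ U).appTop := by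
  subst hV
  have key : ∀ (U' : Y.Opens) (V' : X.Opens) (e : V' ≤ f ⁻¹ᵁ U'), U' = U → V' = f ⁻¹ᵁ U →
      IsIso (f.appLE U' V' e) := by
    rintro _ _ e rfl rfl
    exact (ConcreteCategory.isIso_iff_bijective _).mpr h
  rw [Scheme.Hom.appTop, morphismRestrict_app']
  exact key _ _ _ (by simp) (by simp)

/-- Being an isomorphism is local on the target, and over each affine standard chart it is a
statement on rings of functions. -/
theorem IsCentered.isIso_lineMap (hx : IsCentered s p U x θ q) (hc : IsClosed {p})
    (hV : IsChartCover σ p U x V y) (hφ : φ ≫ projectiveLineToSpec k = σ.fiberι p ≫ σ ≫ s)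
    (h : ∀ a, φ ⁻¹ᵁ lineChart k a = σ.fiberι p ⁻¹ᵁ V a)
    (hy : ∀ a b, φ.appLE (lineChart k a) _ (h a).ge (lineCoord k a b) =
      (σ.fiberι p).app _ (y a b)) : IsIso φ := by
  have hU : ∀ a, IsAffineOpen (lineChart k a) := fun a =>
    Proj.isAffineOpen_basicOpen _ _ ((MvPolynomial.mem_homogeneousSubmodule 1 _).mpr
      (MvPolynomial.isHomogeneous_X k a)) one_pos
  have hP := instHasAffinePropertyIsomorphismsSchemeAndIsAffineIsIsoCommRingCatAppTop.{u}
  refine (@HasAffineProperty.iff_of_iSup_eq_top _ _ hP _ _ φ _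
    (fun a => (⟨lineChart k a, hU a⟩ : (projectiveLine k).affineOpens)) (iSup_lineChart k)).mpr
    fun a => ⟨?_, ?_⟩
  · change IsAffineOpen _
    rw [h a]
    exact isAffineOpen_preimage_fiberι hc (hV.equation a).affine
  · exact isIso_appTop_morphismRestrict (h a) (hx.bijective_lineMap hc hV hφ a (h a).ge (hy a))

end LineIso

/-! ### The sheaf 𝒪(1) and its Euler frame -/

section SerreTwist

variable {A τ : Type u} [CommRing A] [SetLike τ A] [AddSubgroupClass τ A] (𝒜 : ℕ → τ)
  [GradedRing 𝒜] {d : ℕ}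

/-- The section of `𝒪(d)` defined by a homogeneous element of degree `d`. -/
def twistSection {f : A} (hf : f ∈ 𝒜 d) (W : (Proj 𝒜).Opens) : Γ(serreTwist 𝒜 d, W) :=
  (⟨fun _ => Localization.mk f 1, fun x => ⟨W, x.2, 𝟙 _, 0, ⟨f, by rwa [zero_add]⟩,
    ⟨1, SetLike.one_mem_graded _⟩, fun y h => y.1.isPrime.ne_top ((Ideal.eq_top_iff_one _).mpr h),
    fun _ => rfl⟩⟩ : twistSections 𝒜 d W)

theorem res_twistSection {f : A} (hf : f ∈ 𝒜 d) {V W : (Proj 𝒜).Opens} (h : W ≤ V) :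
    res _ h (twistSection 𝒜 hf V) = twistSection 𝒜 hf W := rfl

theorem twist_ext {W : (Proj 𝒜).Opens} {m m' : Γ(serreTwist 𝒜 d, W)}
    (h : ∀ x, (show twistSections 𝒜 d W from m).1 x = (show twistSections 𝒜 d W from m').1 x) :
    m = m' := Subtype.ext (funext h)

theorem isUnit_mk_of_mem_basicOpen {f : A} {x : ProjectiveSpectrum.top 𝒜}
    (hx : x ∈ Proj.basicOpen 𝒜 f) :
    IsUnit (Localization.mk f 1 : stalkRing 𝒜 x) := by
  rw [Localization.mk_one_eq_algebraMap]
  exact IsLocalization.map_units _ (⟨f, hx⟩ : x.asHomogeneousIdeal.toIdeal.primeCompl)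

/-- On the chart `D₊(f)`, the section `f` is a basis of `𝒪(d)`, for `f` of degree `d`. -/
theorem isBasisOn_twistSection {f : A} (hf : f ∈ 𝒜 d) :
    IsBasisOn (serreTwist 𝒜 d) (Proj.basicOpen 𝒜 f)
      fun _ : Unit => twistSection 𝒜 hf (Proj.basicOpen 𝒜 f) := by
  refine isBasisOn_of_local (fun V h c hc i => ?_) (fun V h m x hx => ?_)
  · rw [Fintype.sum_unique, res_twistSection] at hc
    refine Subtype.ext (funext fun x => HomogeneousLocalization.val_injective _ ?_)
    have h1 := congrArg (fun m : twistSections 𝒜 d V => m.1 x) hc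
    have h2 : HomogeneousLocalization.val ((c i).1 x) * Localization.mk f 1 = 0 := h1
    exact ((isUnit_mk_of_mem_basicOpen 𝒜 (h x.2)).mul_left_eq_zero.mp h2).trans
      HomogeneousLocalization.val_zero.symm
  · obtain ⟨W, hxW, j, i, r, t, ht, e⟩ := (show twistSections 𝒜 d V from m).2 ⟨x, hx⟩
    have hfW : ∀ y ∈ W, f ∉ y.asHomogeneousIdeal.toIdeal := fun y hy => h (j.le hy)
    have htf : t.1 * f ∈ 𝒜 (i + d) := SetLike.mul_mem_graded t.2 hf
    -- Locally the section is r / t with deg r = deg t + d, which is f times the fraction r / (t f)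
    -- of degree zero.
    let c : Γ(Proj 𝒜, W) := ⟨fun y => HomogeneousLocalization.mk
      ⟨i + d, r, ⟨t.1 * f, htf⟩, y.1.asHomogeneousIdeal.toIdeal.primeCompl.mul_mem (ht y)
        (hfW y.1 y.2)⟩, fun y => ⟨W, y.2, 𝟙 _, i + d, r, ⟨t.1 * f, htf⟩, fun z =>
        z.1.asHomogeneousIdeal.toIdeal.primeCompl.mul_mem (ht z) (hfW z.1 z.2), fun _ => rfl⟩⟩
    refine ⟨W, j.le, hxW, fun _ => c, ?_⟩
    refine Eq.trans ?_ (Fintype.sum_unique _).symm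
    refine twist_ext 𝒜 fun y => ?_
    refine (e y).trans ?_
    change _ = HomogeneousLocalization.val (HomogeneousLocalization.mk _) * Localization.mk f 1
    rw [HomogeneousLocalization.val_mk, Localization.mk_mul, Localization.mk_eq_mk_iff,
      Localization.r_iff_exists]
    refine ⟨1, ?_⟩
    simp
    ring

theorem twistSection_eq_smul {f g : A} (hf : f ∈ 𝒜 d) (hg : g ∈ 𝒜 d) (hg' : g ∈ 𝒜 (1 • d)) :
    twistSection 𝒜 hg (Proj.basicOpen 𝒜 f) =
      (show Γ(Proj 𝒜, Proj.basicOpen 𝒜 f) from Proj.awayToSection 𝒜 f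
        (HomogeneousLocalization.Away.mk 𝒜 hf 1 g hg')) •
        twistSection 𝒜 hf (Proj.basicOpen 𝒜 f) := by
  refine twist_ext 𝒜 fun x => ?_
  change Localization.mk g 1 = HomogeneousLocalization.val
    (HomogeneousLocalization.mk _) * Localization.mk f 1
  rw [HomogeneousLocalization.val_mk, Localization.mk_mul, Localization.mk_eq_mk_iff,
    Localization.r_iff_exists]
  refine ⟨1, ?_⟩
  simp
  ring

end SerreTwist

section LineTwist

open MvPolynomial

variable {k : Type u} [CommRing k]

/-- The section `X_b` of `𝒪(1)` on the projective line. -/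
def lineSection (k : Type u) [CommRing k] (b : Fin 2) (W : (projectiveLine k).Opens) :
    Γ(projectiveLineTwist k, W) :=
  twistSection (homogeneousSubmodule (Fin 2) k)
    ((mem_homogeneousSubmodule 1 _).mpr (isHomogeneous_X k b)) W

theorem res_lineSection (b : Fin 2) {V W : (projectiveLine k).Opens} (h : W ≤ V) :
    res _ h (lineSection k b V) = lineSection k b W := rfl

theorem isBasisOn_lineSection (a : Fin 2) : IsBasisOn (projectiveLineTwist k) (lineChart k a)
    fun _ : Unit => lineSection k a (lineChart k a) := isBasisOn_twistSection _ _

theorem lineSection_eq (a b : Fin 2) :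
    lineSection k b (lineChart k a) = lineCoord k a b • lineSection k a (lineChart k a) :=
  twistSection_eq_smul (homogeneousSubmodule (Fin 2) k) _ _
    ((mem_homogeneousSubmodule 1 _).mpr (isHomogeneous_X k b))

end LineTwist

section LineEulerFrame

/-- Two generators `w₀`, `w₁` of an invertible sheaf, with `w_b = y_{ab} w_a`, provide the Euler frame
`w₁, -w₀`. -/
theorem isEulerFrame_of_generators {X Z : Scheme.{u}} {i : Z ⟶ X} {V : Fin 2 → X.Opens}
    {y : ∀ a, Fin 2 → Γ(X, V a)} {C : Z.Modules} {w : Fin 2 → Γ(C, ⊤)} (hself : ∀ a, y a a = 1)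
    (hcover : ∀ z : Z, ∃ a, i z ∈ V a)
    (hw : ∀ a b W (h : W ≤ i ⁻¹ᵁ V a), res C (le_top : W ≤ ⊤) (w b) =
      i.appLE (V a) W h (y a b) • res C (le_top : W ≤ ⊤) (w a))
    (hindep : ∀ a W (_ : W ≤ i ⁻¹ᵁ V a) (r : Γ(Z, W)),
      r • res C (le_top : W ≤ ⊤) (w a) = 0 → r = 0)
    (hspan : ∀ a W (_ : W ≤ i ⁻¹ᵁ V a) (m : Γ(C, W)), ∃ r : Γ(Z, W),
      m = r • res C (le_top : W ≤ ⊤) (w a)) : IsEulerFrame i V y C ![w 1, -w 0] := by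
  have hsum : ∀ W (b : Fin 2 → Γ(Z, W)),
      ∑ j, b j • res C (le_top : W ≤ ⊤) ((![w 1, -w 0] : Fin 2 → Γ(C, ⊤)) j) =
        b 0 • res C (le_top : W ≤ ⊤) (w 1) - b 1 • res C (le_top : W ≤ ⊤) (w 0) := fun W b => by
    rw [Fin.sum_univ_two, sub_eq_add_neg, ← smul_neg]
    exact congrArg (fun m => _ + b 1 • m) (res_neg _ le_top (w 0))
  -- In terms of the generator w_a the combination is (b₀ y_{a1} - b₁ y_{a0}) w_a, which vanishes
  -- exactly when b is proportional to (y_{a0}, y_{a1}). The sign in the frame w₁, -w₀ serves this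
  -- purpose.
  have hsum' : ∀ a W (h : W ≤ i ⁻¹ᵁ V a) (b : Fin 2 → Γ(Z, W)),
      ∑ j, b j • res C (le_top : W ≤ ⊤) ((![w 1, -w 0] : Fin 2 → Γ(C, ⊤)) j) =
        (b 0 * i.appLE (V a) W h (y a 1) - b 1 * i.appLE (V a) W h (y a 0)) •
          res C (le_top : W ≤ ⊤) (w a) := fun a W h b => by
    rw [hsum, hw a 1 W h, hw a 0 W h, sub_smul, mul_smul, mul_smul]
  have hone : ∀ a W (h : W ≤ i ⁻¹ᵁ V a), i.appLE (V a) W h (y a a) = 1 := fun a W h => by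
    rw [hself, map_one]
  refine ⟨fun a W h => ?_, fun a W h b hb => ?_, fun W m z hz => ?_⟩
  · rw [hsum' a W h fun j => i.appLE (V a) W h (y a j), mul_comm, sub_self, zero_smul]
  · rw [hsum' a W h] at hb
    have h1 := hindep a W h _ hb
    have h2 := hone a W h
    match a, h, h1, h2 with
    | 0, h, h1, h2 =>
      rw [h2] at h1
      refine Fin.forall_fin_two.mpr ⟨by rw [h2, one_mul], ?_⟩
      linear_combination -h1
    | 1, h, h1, h2 =>
      rw [h2] at h1
      refine Fin.forall_fin_two.mpr ⟨?_, by rw [h2, one_mul]⟩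
      linear_combination h1
  · obtain ⟨a, ha⟩ := hcover z
    refine ⟨W ⊓ i ⁻¹ᵁ V a, inf_le_left, ⟨hz, ha⟩, ?_⟩
    obtain ⟨r, hr⟩ := hspan a _ inf_le_right (res C (inf_le_left : W ⊓ i ⁻¹ᵁ V a ≤ W) m)
    simp only [hr, hsum]
    match a with
    | 0 => exact ⟨![0, -r], by simp⟩
    | 1 => exact ⟨![r, 0], by simp⟩

variable {X Z : Scheme.{u}} {k : Type u} [CommRing k] {i : Z ⟶ X} {V : Fin 2 → X.Opens}
  {y : ∀ a, Fin 2 → Γ(X, V a)} {φ : Z ⟶ projectiveLine k}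

/-- The Euler frame of the pullback of `𝒪(1)` along a morphism to the projective line. -/
theorem isEulerFrame_lineTwist (hself : ∀ a, y a a = 1) (hcover : ∀ z : Z, ∃ a, i z ∈ V a)
    (h : ∀ a, φ ⁻¹ᵁ lineChart k a = i ⁻¹ᵁ V a)
    (hy : ∀ a b, φ.appLE (lineChart k a) _ (h a).ge (lineCoord k a b) = i.app _ (y a b)) :
    ∃ c, IsEulerFrame i V y ((Scheme.Modules.pullback φ).obj (projectiveLineTwist k)) c := by
  have htop : (⊤ : Z.Opens) ≤ φ ⁻¹ᵁ (⊤ : (projectiveLine k).Opens) := fun _ _ => trivial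
  have hres : ∀ a b W (hW : W ≤ φ ⁻¹ᵁ lineChart k a),
      res _ (le_top : W ≤ ⊤) (pullbackSection φ (projectiveLineTwist k)
        htop (lineSection k b ⊤)) =
      pullbackSection φ (projectiveLineTwist k) hW (lineSection k b (lineChart k a)) :=
    fun a b W hW => by
      rw [res_pullbackSection, ← res_lineSection b (le_top : lineChart k a ≤ ⊤),
        pullbackSection_res]
  have hbasis := fun a => (isBasisOn_lineSection (k := k) a).pullback φ
  refine ⟨_, isEulerFrame_of_generators (w := fun b => pullbackSection φ (projectiveLineTwist k)
    htop (lineSection k b ⊤)) hself hcover (fun a b W hW => ?_)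
    (fun a W hW r hr => ?_) (fun a W hW m => ?_)⟩
  · have hW' := hW.trans (h a).ge
    rw [hres a b W hW', hres a a W hW', lineSection_eq, pullbackSection_smul]
    refine congrArg (· • _) ?_
    rw [← resFun_appLE φ (h a).ge hW, hy, Scheme.Hom.app_eq_appLE, resFun_appLE]
  · have hW' := hW.trans (h a).ge
    refine (hbasis a).indep W hW' (fun _ => r) ?_ ()
    rw [Fintype.sum_unique, res_pullbackSection, ← hres a a W hW']
    exact hr
  · have hW' := hW.trans (h a).ge
    obtain ⟨r, hr⟩ := (hbasis a).span W hW' m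
    rw [Fintype.sum_unique, res_pullbackSection, ← hres a a W hW'] at hr
    exact ⟨_, hr⟩

end LineEulerFrame

end

end BlowupTangent

/-! ### The two exact sequences -/

theorem lemmaP (n : ℕ) {S S' : Scheme.{0}} (s : S ⟶ Spec (CommRingCat.of ℂ))
    [IsIntegral S] [IsSeparated s] [LocallyOfFiniteType s] [QuasiCompact s]
    [SmoothOfRelativeDimension n s]
    (p : S) (hp : IsClosed {p}) (σ : S' ⟶ S) (hσ : IsBlowupAtPoint σ p hp) :
    ∃ dσ : tangentSheaf (σ ≫ s) ⟶ (Scheme.Modules.pullback σ).obj (tangentSheaf s),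
      IsDifferential σ dσ ∧
      (∃ β : (Scheme.Modules.pullback σ).obj (tangentSheaf s) ⟶
          (Scheme.Modules.pushforward (σ.fiberι p)).obj
            (tensor (tangentSheaf (σ.fiberι p ≫ σ ≫ s))
              ((Scheme.Modules.pullback (σ.fiberι p)).obj (divisorSheaf (σ.fiberι p)))),
        IsShortExact dσ β) ∧
      (n = 2 → ∃ φ : σ.fiber p ≅ projectiveLine ℂ,
        φ.hom ≫ projectiveLineToSpec ℂ = σ.fiberι p ≫ σ ≫ s ∧
        ∃ β : (Scheme.Modules.pullback σ).obj (tangentSheaf s) ⟶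
            (Scheme.Modules.pushforward (σ.fiberι p)).obj
              ((Scheme.Modules.pullback φ.hom).obj (projectiveLineTwist ℂ)),
          IsShortExact dσ β) := by
  obtain ⟨U, x, θ, q, hx⟩ := exists_isCentered (s := s) (n := n) hp
  obtain ⟨e, he⟩ := hσ.exists_iso ⟨U, hx.coordinates.affine⟩
  have hI := hx.ideal_eq hp
  have hxI : ∀ a, x a ∈
      (Scheme.IdealSheafData.vanishingIdeal ⟨{p}, hp⟩).ideal ⟨U, hx.coordinates.affine⟩ := fun a =>
    hI ▸ Ideal.subset_span ⟨a, rfl⟩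
  obtain ⟨y, hV⟩ := hx.exists_isChartCover hp hI hxI e he
  -- The differential is glued from coordinate neighbourhoods of all points of S; the centred
  -- coordinates enter only in the cokernel.
  obtain ⟨dσ, hd⟩ := exists_differential (f := σ) (t := s) fun z => by
    obtain ⟨U, x, θ, hz, -, hx⟩ := exists_coordinate_neighborhood (s := s) (n := n) z ⊤ trivial
    exact ⟨n, U, x, θ, hz, hx⟩
  refine ⟨dσ, isDifferential_of_isImage hd, ?_, ?_⟩
  · obtain ⟨c, hc⟩ := hx.exists_isEulerFrame hp hV
    exact ⟨_, isShortExact_frameMap hp hσ hx hV hd hc⟩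
  -- The map dσ and the charts remain the same; only the sheaf carrying the Euler frame changes.
  · rintro rfl
    obtain ⟨φ, hφ, h⟩ := exists_lineMap (s := s) hx.mem hI hxI hx.coordinates.affine e he hV
    choose h hy using h
    have := hx.isIso_lineMap hp hV hφ h hy
    obtain ⟨c, hc⟩ := isEulerFrame_lineTwist (fun a => hV.self a) (fun z =>
      hV.cover (σ.fiberι p z) (top_le_preimage_fiberι σ hx.mem trivial)) h hy
    exact ⟨asIso φ, hφ, _, isShortExact_frameMap hp hσ hx hV hd hc⟩
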